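/- **Setting.** Let $K$ be a commutative ring and $R=K[\alpha]/(\alpha^2-s\alpha+p_0)$ ($s,p_0\in K$) a $K$-algebra of rank $2$ with a structure of commutative Frobenius $K$-algebra (coproduct $\Delta$ that is a bimodule map, with counit $\varepsilon$). Let $u\mapsto\bar u$ be the $K$-algebra involution with $\bar\alpha=s-\alpha$; put $u^{(+)}=u$, $u^{(-)}=\bar u$, and $\beta=\alpha-\bar\alpha$. Let $A=\mathbb Z[t,\delta,(1-t\delta)^{-1}]$, $\theta=1-t\delta$, graded by $\deg t=2$, $\deg\delta=-2$; $\mathbb Z[\beta]$ with $\deg\beta=-2$ is an $A$-algebra by $t\mapsto0,\ \delta\mapsto\beta$, and $R$ is an $A$-algebra by $t\mapsto\varepsilon(1)$, $\delta\mapsto\omega\beta$, where $\omega\in R^*$ is defined by $\varepsilon(\omega)=0,\ \varepsilon(\omega\alpha)=1$. Let $D$ be an oriented link diagram in the plane with set of crossings $X$, let $e(x)$ be the sign of the crossing $x$, $X_-=e^{-1}(-1)$, and let $p$ be a point of $D$ which is not a crossing. For a finite set $Y$, $\Lambda(Y)$ is the maximal exterior power of $\mathbb Z^Y$; the exponents $\pm$,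 $-e$ indicate that $y\in Y$ has degree $\pm1$, $-e(y)$. *The complex $KH(D,p,R)$.* For a state $s:X\to\{\pm1\}$ let $D_s$ be the resolution of $D$ (with the convention that the oriented resolution corresponds to $s=e$), $C_s$ the set of its components, $X_s=s^{-1}(-1)$ and $\Phi(D_s)=R^{\otimes_K C_s}$. Then $$KH(D,p,R)=\bigoplus_s\Lambda^-(X_s)\otimes\Phi(D_s)\otimes\Lambda^+(X_-),\qquad d(u\otimes v\otimes w)=\sum_{x,\ s(x)=1}x\wedge u\otimes\gamma_x(v)\otimes w,$$ where $\gamma_x$ is given by the product or the coproduct of $R$, according to whether changing $s$ at $x$ merges two components or splits one. Let $e_0=(-1)^n$, where $n$ is the winding number of $D$ about a point close to $p$ on the left of $D$; $a\in R$ acts on $KH(D,p,R)$ by the multiplication by $a^{(e_0)}$ in the tensor factor of the component $c_0$ of $D_s$ containing $p$. *The complexes $KH'(D,p)$, $KH''(D,p)$.* $KH'(D,p)=\bigoplus_s\Lambda^-(X_s)\otimes\bigl(\bigoplus_\lambda A\,e(s,\lambda)\bigr)\otimes\Lambda^+(X_-)$, where $\lambda$ runs over the maps $C_s\to\{\pm1\}$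 with $\lambda(c_0)=1$. Its differential is given by the same formula, $\gamma_x$ having, in the basis $e(s,\lambda)$, its matrix in the basis $\prod_{\lambda(c)=1}\omega_c\omega_{c_0}^{-1}\prod_{\lambda(c)=-1}\omega_c(\alpha_c-\alpha_{c_0})$ of $\Phi(D_s)$ over the factor $R$ of index $c_0$ ($u_c$ denoting $u\in R$ put in the factor of index $c$); the entries come from $A$ and do not depend on $R$: on the two elements $e_+,e_-$ attached to a component, merging is $e_+e_+=e_+-\theta^{-1}t\,e_-$, $e_+e_-=e_-e_+=\theta^{-1}e_-$, $e_-e_-=-\theta^{-1}\delta\,e_-$, and splitting is $e_+\mapsto\delta\,e_+\otimes e_++e_+\otimes e_-+e_-\otimes e_+$, $e_-\mapsto e_-\otimes e_-$, keeping for the component $c_0$ only the terms where its label is $+$. It is bigraded, $e(s,\lambda)$ contributing $\sum_c\lambda(c)$ to the second degree, and $d$ has bidegree $(-1,-1)$. Put $KH''(D,p)=\mathbb Z[\beta]\otimes_AKH'(D,p)$. *The modules $E(D,p,B)$ and the maps.* Let $C$ be the set of components of the link, and $\widehat C$ the set of maps $\sigma:C\to\{\pm1\}$ with value $e_0$ on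 the component of $p$. Let $D(\sigma)$ be $D$ with the orientation changed where $\sigma=-1$, and let $Y(\sigma)$ be the set of crossings between components with different values of $\sigma$. For a commutative ring $B$, $$E(D,p,B)=\bigoplus_{\sigma\in\widehat C}\Lambda^{-e}(Y(\sigma))\otimes B\,v(\sigma),$$ with zero differential, $v(\sigma)$ having as second degree the number of components of the oriented resolution of $D(\sigma)$. The latter is $D_s$ for $s(x)=e(x)\sigma(c)\sigma(c')$, where $c,c'$ are the components through $x$; orient it as $\pm D(\sigma)$, with the sign for which it is oriented as $D$ near $p$, and for a component $c$ of $D_s$ put $a_c=(-1)^{d_c}$, where $d_c$ is the winding number of $D_s$ about a point close to $c$ on its left. The $\sigma$-component of $\varphi(R):KH(D,p,R)\to E(D,p,R)$ vanishes on the summands of index different from $s$ and is, on the summand of index $s$, the tensor product of $\bigotimes_cb_c\mapsto\prod_cb_c^{(a_c)}$ with the isomorphism $\Lambda^-(X_s)\otimes\Lambda^+(X_-)\simeq\Lambda^{-e}(Y(\sigma))$, $$(u_1\wedge u_2)\otimes(u_4\wedge u_5)\mapsto(-1)^{|u_2||u_4|}\langle u_2,u_5\rangle\,u_1\wedge u_4,$$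 where $u_1,u_4$ are exterior products of the positive, resp. negative, crossings of $Y(\sigma)$, $u_2,u_5$ of the negative crossings not in $Y(\sigma)$, and $\langle x_1\wedge\dots\wedge x_n,x_1\wedge\dots\wedge x_n\rangle=(-1)^{n(n-1)/2}$. The map $\varphi':KH'(D,p)\to E(D,p,A)$ is defined in the same way, with $e(s,\lambda)\mapsto0$ if some $c$ has $a_c=e_0$ and $\lambda(c)=-1$, and otherwise $e(s,\lambda)\mapsto\theta^{-i}(-\delta)^{j}v(\sigma)$, where $i$ is the number of $c$ with $a_c=-e_0$ and $j$ the number of $c$ with $\lambda(c)=-1$. Finally $\varphi'':KH''(D,p)\to E(D,p,\mathbb Z[\beta])$ is $\mathbb Z[\beta]\otimes_A\varphi'$. **Theorem.** Let $(D,p)$ be a pointed oriented link diagram whose underlying graph is connected. Then $KH(D,p,R)$, $KH'(D,p)$ and $KH''(D,p)$ are complexes over $R$, $A$ and $\mathbb Z[\beta]$ respectively, and $$\varphi(R):KH(D,p,R)\to E(D,p,R),\qquad\varphi':KH'(D,p)\to E(D,p,A),\qquad\varphi'':KH''(D,p)\to E(D,p,\mathbb Z[\beta])$$ are linear morphisms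 of complexes of degree $0$ (resp. of bidegree $(0,0)$ for the last two), they are surjective, and the action of $\beta$ on the kernels of $\varphi(R)$ and $\varphi''$, and of $\delta$ (the element of $A$ whose image in $\mathbb Z[\beta]$ is $\beta$ and whose image in $R$ is the unit multiple $\omega\beta$ of $\beta$) on the kernel of $\varphi'$, is homotopically nilpotent: some power of it is null-homotopic on the kernel, by a linear homotopy that is homogeneous of homological degree $1$ (and bihomogeneous for $\varphi'$ and $\varphi''$). -/

import Mathlib

open scoped TensorProduct

noncomputable section

open scoped Classical

/-! ## Frobenius algebras of rank two -/

/-- A commutative `K`-algebra `R` with coproduct `comul` and counit `counit` is a commutative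
Frobenius algebra: the coproduct is a morphism of `R`-bimodules. -/
class FrobeniusAlgebra (K R : Type*) [CommRing K] [CommRing R] [Algebra K R] [Coalgebra K R] :
    Prop where
  comul_mul_left : ∀ a b : R, Coalgebra.comul (R := K) (a * b) =
    (a ⊗ₜ[K] (1 : R)) * Coalgebra.comul (R := K) b
  comul_mul_right : ∀ a b : R, Coalgebra.comul (R := K) (a * b) =
    Coalgebra.comul (R := K) a * ((1 : R) ⊗ₜ[K] b)

/-- A presentation `R = K[α] / (α ^ 2 - s α + p)` of an algebra of rank two: `gen` is the
`K`-generator `α`, `tr` is `s` and `nm` is `p`. -/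
structure RankTwoGenerator (K R : Type*) [CommRing K] [CommRing R] [Algebra K R] where
  gen : R
  tr : K
  nm : K
  gen_sq : gen * gen = algebraMap K R tr * gen - algebraMap K R nm
  bij : Function.Bijective fun ab : K × K => algebraMap K R ab.1 + algebraMap K R ab.2 * gen

namespace RankTwoGenerator

variable {K R : Type*} [CommRing K] [CommRing R] [Algebra K R] (g : RankTwoGenerator K R)

/-- The coordinates of an element of `R` in the basis `1, α`. -/
def coord (u : R) : K × K := (Equiv.ofBijective _ g.bij).symm u

theorem coord_spec (u : R) :
    algebraMap K R (g.coord u).1 + algebraMap K R (g.coord u).2 * g.gen = u :=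
  (Equiv.ofBijective _ g.bij).apply_symm_apply u

theorem coord_eq {u : R} {a b : K} (h : algebraMap K R a + algebraMap K R b * g.gen = u) :
    g.coord u = (a, b) := by
  apply g.bij.1
  change algebraMap K R (g.coord u).1 + algebraMap K R (g.coord u).2 * g.gen = _
  rw [coord_spec]
  exact h.symm

/-- The conjugate generator `s - α`. -/
def genBar : R := algebraMap K R g.tr - g.gen

/-- The involution of `R`: the algebra map with `α ↦ s - α`. -/
def conj : R →ₐ[K] R where
  toFun u := algebraMap K R (g.coord u).1 + algebraMap K R (g.coord u).2 * g.genBar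
  map_one' := by
    rw [g.coord_eq (u := 1) (a := 1) (b := 0) (by simp)]
    simp
  map_zero' := by
    rw [g.coord_eq (u := 0) (a := 0) (b := 0) (by simp)]
    simp
  commutes' k := by
    rw [g.coord_eq (u := algebraMap K R k) (a := k) (b := 0) (by simp)]
    simp
  map_add' u v := by
    have hu := g.coord_spec u
    have hv := g.coord_spec v
    rw [g.coord_eq (u := u + v) (a := (g.coord u).1 + (g.coord v).1)
      (b := (g.coord u).2 + (g.coord v).2) (by
        simp only [map_add]
        linear_combination hu + hv)]
    simp only [map_add]
    ring
  map_mul' u v := by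
    have hu := g.coord_spec u
    have hv := g.coord_spec v
    have hs := g.gen_sq
    rw [g.coord_eq (u := u * v)
      (a := (g.coord u).1 * (g.coord v).1 - (g.coord u).2 * (g.coord v).2 * g.nm)
      (b := (g.coord u).1 * (g.coord v).2 + (g.coord u).2 * (g.coord v).1
        + (g.coord u).2 * (g.coord v).2 * g.tr) (by
        conv_rhs => rw [← hu, ← hv]
        simp only [map_add, map_mul, map_sub]
        linear_combination (-(algebraMap K R (g.coord u).2 * algebraMap K R (g.coord v).2)) * hs)]
    simp only [map_add, map_mul, map_sub, genBar]
    linear_combination (-(algebraMap K R (g.coord u).2 * algebraMap K R (g.coord v).2)) * hs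

/-- `u ^ (e)`: equal to `u` if `e = 1` and to the conjugate of `u` if `e = -1`. -/
def twist (e : ℤˣ) : R →ₐ[K] R := if e = 1 then AlgHom.id K R else g.conj

/-- `β = α - ᾱ`. -/
def beta : R := g.gen - g.genBar

end RankTwoGenerator

/-! ## Link diagrams in the plane -/

/-- The half-edges of a diagram with crossings `X` and bivalent vertices `V`, each pointing away
from its vertex.  At a crossing the four half-edges are numbered counterclockwise, `0, 2` lie on the
under strand and `1, 3` on the over strand.  (Bivalent vertices are marked points of the curve; a
component without crossings carries at least one of them.) -/
abbrev Dart (X V : Type) : Type := (X × ZMod 4) ⊕ (V × ZMod 2)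

namespace Dart

variable {X V : Type}

/-- The next half-edge counterclockwise around the vertex. -/
def rot : Dart X V → Dart X V
  | .inl (x, i) => .inl (x, i + 1)
  | .inr (v, i) => .inr (v, i + 1)

/-- The opposite half-edge at the same vertex (go straight on through the vertex). -/
def straight : Dart X V → Dart X V
  | .inl (x, i) => .inl (x, i + 2)
  | .inr (v, i) => .inr (v, i + 1)

end Dart

/-- A link diagram in the plane, as a plane graph with crossing information: `F` is the set of
regions (components of the complement of the diagram), `opp` exchanges the two half-edges of an
edge, `left d` is the region on the left of the directed edge `d`, and `outer` is the unbounded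
region.  Any two regions are joined by a path in the plane crossing edges, and planarity is Euler's
formula `#vertices - #edges + #regions = 1 + #components of the graph`. -/
structure LinkDiagram (X V F : Type) [Fintype X] [Fintype V] [Fintype F] where
  opp : Dart X V → Dart X V
  opp_opp : ∀ d, opp (opp d) = d
  opp_ne : ∀ d, opp d ≠ d
  left : Dart X V → F
  left_rot : ∀ d, left (opp d.rot) = left d
  outer : F
  regions_connected : ∀ f f' : F,
    Relation.EqvGen (fun a b => ∃ d, a = left d ∧ b = left (opp d)) f f'
  euler : Fintype.card X + Fintype.card V + Fintype.card F =
    (2 * Fintype.card X + Fintype.card V)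
      + Nat.card (Quot fun d d' : Dart X V => d' = opp d ∨ d' = d.rot) + 1

namespace LinkDiagram

variable {X V F : Type} [Fintype X] [LinearOrder X] [Fintype V] [Fintype F]
variable (D : LinkDiagram X V F)

/-- The underlying graph of the diagram is connected (and nonempty). -/
def Connected : Prop :=
  Nat.card (Quot fun d d' : Dart X V => d' = D.opp d ∨ d' = d.rot) = 1

/-- The components of the link. -/
def Comp : Type := Quot fun d d' : Dart X V => d' = D.opp d ∨ d' = d.straight

/-- The component of the link containing the edge of `d`. -/
def comp (d : Dart X V) : D.Comp := Quot.mk _ d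

/-! ### Orientations and winding numbers -/

/-- An orientation of the link: `dir d = 1` if the half-edge `d`, directed away from its vertex, is
directed as the link, and `dir d = -1` otherwise. -/
structure Orientation where
  dir : Dart X V → ℤˣ
  dir_opp : ∀ d, dir (D.opp d) = -dir d
  dir_straight : ∀ d : Dart X V, dir d.straight = -dir d

namespace Orientation

variable {D} (o : D.Orientation)

/-- The orientation changed on the components where `σ` is `-1`. -/
def change (σ : D.Comp → ℤˣ) : D.Orientation where
  dir d := σ (D.comp d) * o.dir d
  dir_opp d := by
    have h : D.comp (D.opp d) = D.comp d := by
      symm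
      exact Quot.sound (Or.inl rfl)
    rw [h, o.dir_opp, mul_neg]
  dir_straight d := by
    have h : D.comp d.straight = D.comp d := by
      symm
      exact Quot.sound (Or.inr rfl)
    rw [h, o.dir_straight, mul_neg]

/-- The sign of a crossing: it is positive if the over strand has to be turned counterclockwise (by
less than a half turn) to get the under strand. -/
def sign (x : X) : ℤˣ := o.dir (.inl (x, 1)) * o.dir (.inl (x, 2))

/-- `w` is the winding number of the oriented diagram about the points of each region: it vanishes
on the unbounded region and decreases by one when an edge is crossed from left to right. -/
def IsWinding (w : F → ℤ) : Prop :=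
  w D.outer = 0 ∧ ∀ d, o.dir d = 1 → w (D.left d) = w (D.left (D.opp d)) + 1

/-- The winding number about the points of a region. -/
def winding : F → ℤ := Classical.epsilon o.IsWinding

/-- The region on the left of the diagram along the edge of `d`. -/
def leftRegion (d : Dart X V) : F := if o.dir d = 1 then D.left d else D.left (D.opp d)

/-- `(-1) ^ n`, where `n` is the winding number of the oriented diagram about a point on the left
of the edge of `d`. -/
def leftSign (d : Dart X V) : ℤˣ := (-1) ^ o.winding (o.leftRegion d)

end Orientation

/-! ### States and resolutions -/

/-- How the resolution of the diagram with respect to the state `s` joins the half-edges at a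
vertex.  At a crossing `x`, it joins `0` with `1` and `2` with `3` if `s x = 1`, and `0` with `3`
and `1` with `2` if `s x = -1`. -/
def smooth (s : X → ℤˣ) : Dart X V → Dart X V
  | .inl (x, i) => .inl (x, if s x = 1 then 1 - i else 3 - i)
  | .inr (v, i) => .inr (v, i + 1)

/-- The components of the resolution `D_s`. -/
def Circ (s : X → ℤˣ) : Type := Quot fun d d' : Dart X V => d' = D.opp d ∨ d' = smooth s d

/-- The component of `D_s` containing the edge of `d`. -/
def circ (s : X → ℤˣ) (d : Dart X V) : D.Circ s := Quot.mk _ d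

instance (s : X → ℤˣ) : Finite (D.Circ s) :=
  Finite.of_surjective (D.circ s) (Quot.mk_surjective)

instance (s : X → ℤˣ) : Fintype (D.Circ s) := Fintype.ofFinite _

instance : Finite D.Comp := Finite.of_surjective D.comp (Quot.mk_surjective)

instance : Fintype D.Comp := Fintype.ofFinite _

/-! ### The complex `kh(D)`

A maximal exterior power `Λ(Y)`, for a set `Y` of crossings, is identified with `ℤ` through its
basis element `y₁ ∧ y₂ ∧ ⋯ ∧ yₙ`, where `y₁ < y₂ < ⋯ < yₙ` are the elements of `Y`. -/

/-- The sign `ε` with `x ∧ [Y] = ε [Y ∪ {x}]`, where `Y ∪ {x} = s⁻¹(-1)` and `[Y]` is the increasing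
exterior product of the elements of `Y`. -/
def wedgeSign (s : X → ℤˣ) (x : X) : ℤˣ :=
  (-1) ^ (Finset.univ.filter fun y : X => s y = -1 ∧ y < x).card

/-- `Φ(D_s)`: the tensor product of copies of `R` indexed by the components of `D_s`. -/
abbrev Phi (K R : Type*) [CommRing K] [CommRing R] [Algebra K R] (s : X → ℤˣ) : Type _ :=
  ⨂[K] _ : D.Circ s, R

section Khovanov

variable (K R : Type*) [CommRing K] [CommRing R] [Algebra K R]

/-- The element `a` of `R` placed in the factor of `Φ(D_s)` of index `c`. -/
def factor (s : X → ℤˣ) (c : D.Circ s) : R →ₐ[K] D.Phi K R s :=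
  PiTensorProduct.singleAlgHom (R := K) (A := fun _ : D.Circ s => R) c

/-- The surgery map `γ_x : Φ(D_s) → Φ(D_s')`, where `s x = 1` and `s'` is `s` with the value at `x`
changed to `-1`.  If the two arcs of `D_s` near `x` belong to the same component, its factor is
sent by the coproduct to the factors of the two components of `D_s'` near `x`; if not, the
two factors are multiplied in the factor of the component of `D_s'` near `x`.  All the other
components of `D_s` are components of `D_s'`. -/
def surgery [Coalgebra K R] (s s' : X → ℤˣ) (x : X) : D.Phi K R s →ₗ[K] D.Phi K R s' :=
  PiTensorProduct.lift
    ((MultilinearMap.mkPiAlgebra K (D.Circ s) (D.Phi K R s')).compLinearMap fun c =>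
      if c = D.circ s (.inl (x, 0)) ∧ c = D.circ s (.inl (x, 2)) then
        (Algebra.TensorProduct.productMap (D.factor K R s' (D.circ s' (.inl (x, 0))))
          (D.factor K R s' (D.circ s' (.inl (x, 2))))).toLinearMap ∘ₗ Coalgebra.comul
      else (D.factor K R s' (D.circ s' (Quot.out c))).toLinearMap)

end Khovanov

/-! ### Pointed oriented diagrams -/

variable {D} (o : D.Orientation) (p : Dart X V)

namespace Orientation

/-- The sign `e₀` of the pointed oriented diagram. -/
def baseSign : ℤˣ := o.leftSign p

/-- The orientation changes `σ` with value `e₀` on the component of the base point. -/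
def Change : Type := {σ : D.Comp → ℤˣ // σ (D.comp p) = o.baseSign p}

instance : Fintype (o.Change p) :=
  inferInstanceAs (Fintype {σ : D.Comp → ℤˣ // σ (D.comp p) = o.baseSign p})

/-- The homological degree of `Λ⁻(X_s) ⊗ Φ(D_s) ⊗ Λ⁺(X_-)`. -/
def stateDegree (s : X → ℤˣ) : ℤ :=
  ((Finset.univ.filter fun x => o.sign x = -1).card : ℤ)
    - (Finset.univ.filter fun x => s x = -1).card

section KH

variable {K R : Type*} [CommRing K] [CommRing R] [Algebra K R] (g : RankTwoGenerator K R)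

/-- The module underlying `KH(D,p,R)`: the sum of the modules
`Λ⁻(X_s) ⊗ Φ(D_s) ⊗ Λ⁺(X_-)`. -/
@[nolint unusedArguments]
def KH (_ : D.Orientation) (_ : Dart X V) (_ : RankTwoGenerator K R) : Type _ :=
  ∀ s : X → ℤˣ, D.Phi K R s

instance : AddCommGroup (o.KH p g) := inferInstanceAs (AddCommGroup (∀ s, D.Phi K R s))

/-- The element `a` acts through the operator `T̂_p(a)`: multiplication by `a`, or by its conjugate
if `e₀ = -1`, in the factor of the component of `D_s` containing `p`. -/
instance : Module R (o.KH p g) where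
  smul a v := fun s => D.factor K R s (D.circ s p) (g.twist (o.baseSign p) a) * v s
  one_smul v := by
    funext s
    change D.factor K R s (D.circ s p) (g.twist (o.baseSign p) 1) * v s = v s
    rw [map_one, map_one, one_mul]
  mul_smul a b v := by
    funext s
    change D.factor K R s (D.circ s p) (g.twist (o.baseSign p) (a * b)) * v s =
      D.factor K R s (D.circ s p) (g.twist (o.baseSign p) a) *
        (D.factor K R s (D.circ s p) (g.twist (o.baseSign p) b) * v s)
    rw [map_mul, map_mul, mul_assoc]
  smul_zero a := by
    funext s
    exact mul_zero _
  smul_add a v w := by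
    funext s
    exact mul_add _ _ _
  add_smul a b v := by
    funext s
    change D.factor K R s (D.circ s p) (g.twist (o.baseSign p) (a + b)) * v s =
      D.factor K R s (D.circ s p) (g.twist (o.baseSign p) a) * v s +
        D.factor K R s (D.circ s p) (g.twist (o.baseSign p) b) * v s
    rw [map_add, map_add, add_mul]
  zero_smul v := by
    funext s
    change D.factor K R s (D.circ s p) (g.twist (o.baseSign p) 0) * v s = 0
    rw [map_zero, map_zero, zero_mul]

/-- The elements of `KH(D,p,R)` of homological degree `n`. -/
def khHomogeneous (n : ℤ) : Set (o.KH p g) := {v | ∀ s, v s ≠ 0 → o.stateDegree s = n}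

/-- The differential of `KH(D,p,R)`. -/
def khD [Coalgebra K R] (v : o.KH p g) : o.KH p g := fun s' =>
  ∑ x : X, if s' x = -1 then
    (wedgeSign s' x : ℤ) •
      D.surgery K R (Function.update s' x 1) s' x (v (Function.update s' x 1))
  else 0

end KH

/-! ### The modules `E(D,p,B)` -/

variable {o p}

section

variable (σ : o.Change p)

/-- The state of the oriented resolution of `D(σ)`. -/
def changeState (x : X) : ℤˣ :=
  o.sign x * σ.1 (D.comp (.inl (x, 0))) * σ.1 (D.comp (.inl (x, 1)))

/-- The crossings of sign `e` between components with different values of `σ`. -/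
def mixed (e : ℤˣ) : Finset X :=
  Finset.univ.filter fun x =>
    o.sign x = e ∧ σ.1 (D.comp (.inl (x, 0))) ≠ σ.1 (D.comp (.inl (x, 1)))

/-- The crossings of sign `e` between components with equal values of `σ`. -/
def pure (e : ℤˣ) : Finset X :=
  Finset.univ.filter fun x =>
    o.sign x = e ∧ σ.1 (D.comp (.inl (x, 0))) = σ.1 (D.comp (.inl (x, 1)))

/-- The homological degree of `Λ^{-e}(Y(σ))`. -/
def changeDegree : ℤ := ((mixed σ (-1)).card : ℤ) - (mixed σ 1).card

/-- The sign `a_c = (-1) ^ d`, where `d` is the winding number of `D_s` about a point on the left of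
its component `c`; here `D_s` is the oriented resolution of `D(σ)`, with the global orientation for
which it is oriented as `D` near the base point. -/
def circSign (c : D.Circ (changeState σ)) : ℤˣ :=
  (o.change fun k => o.baseSign p * σ.1 k).leftSign (Quot.out c)

/-- The sign `ε` with `[A] ∧ [B] = ε [A ∪ B]`, for disjoint `A` and `B`. -/
def shuffleSign (A B : Finset X) : ℤˣ :=
  (-1) ^ ((A ×ˢ B).filter fun ab => ab.2 < ab.1).card

/-- The sign of the isomorphism from `Λ⁻(X_s) ⊗ Λ⁺(X_-)` to `Λ^{-e}(Y)` with
`(u₁ ∧ u₂) ⊗ (u₄ ∧ u₅) ↦ (-1)^{|u₂||u₄|} ⟨u₂, u₅⟩ u₁ ∧ u₄` for `u₁` in `Λ⁻(Y₊)`, `u₂` in `Λ⁻(Z₋)`,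
`u₄` in `Λ⁺(Y₋)` and `u₅` in `Λ⁺(Z₋)`, where `⟨u, u⟩ = (-1)^{n(n-1)/2}` for the exterior product `u`
of `n` crossings; here `Y = mixed σ` and `Z = pure σ`. -/
def contractionSign : ℤˣ :=
  shuffleSign (mixed σ 1) (pure σ (-1)) * shuffleSign (mixed σ (-1)) (pure σ (-1))
    * (-1) ^ ((pure σ (-1)).card * (mixed σ (-1)).card)
    * (-1) ^ ((pure σ (-1)).card * ((pure σ (-1)).card - 1) / 2)
    * shuffleSign (mixed σ 1) (mixed σ (-1))

end

variable (o p)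

/-- The elements of homological degree `n` of `E(D,p,R)`. -/
def eHomogeneous (R : Type*) [CommRing R] (n : ℤ) : Set (o.Change p → R) :=
  {v | ∀ σ : o.Change p, v σ ≠ 0 → changeDegree σ = n}

/-- The map `φ(R) : KH(D,p,R) → E(D,p,R)`. Its component of index `σ` is, up to a sign,
`⊗ b_c ↦ ∏ b_c ^ (a_c)` on the summand of the oriented resolution of `D(σ)`, and zero on the
other ones. -/
def khPhi {K R : Type*} [CommRing K] [CommRing R] [Algebra K R] (g : RankTwoGenerator K R)
    (v : o.KH p g) : o.Change p → R := fun σ =>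
  (contractionSign σ : ℤ) •
    PiTensorProduct.lift
      ((MultilinearMap.mkPiAlgebra K (D.Circ (changeState σ)) R).compLinearMap fun c =>
        (g.twist (circSign σ c)).toLinearMap) (v (changeState σ))

end Orientation

end LinkDiagram

/-! ## The universal coefficients -/

/-- The polynomial ring `ℤ[t, δ]`. -/
abbrev PolyTD : Type := MvPolynomial (Fin 2) ℤ

/-- The element `θ = 1 - t δ` of `ℤ[t, δ]`. -/
def polyTheta : PolyTD := 1 - MvPolynomial.X 0 * MvPolynomial.X 1

/-- The ring `A = ℤ[t, δ, (1 - t δ)⁻¹]`. -/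
abbrev CoeffA : Type := Localization.Away polyTheta

namespace CoeffA

def t : CoeffA := algebraMap PolyTD CoeffA (MvPolynomial.X 0)

def δ : CoeffA := algebraMap PolyTD CoeffA (MvPolynomial.X 1)

/-- `θ⁻¹`. -/
def θinv : CoeffA := IsLocalization.Away.invSelf polyTheta

/-- The elements of degree `n` of `A`, where `t` has degree `2` and `δ` has degree `-2`. -/
def homogeneous (n : ℤ) : Set CoeffA :=
  {a | ∃ (k : ℕ) (f : PolyTD), MvPolynomial.IsWeightedHomogeneous (![2, -2] : Fin 2 → ℤ) f n ∧
    a = algebraMap PolyTD CoeffA f * θinv ^ k}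

/-- The ring map `A → ℤ[β]` with `t ↦ 0` and `δ ↦ β`. -/
def toPoly : CoeffA →+* Polynomial ℤ :=
  IsLocalization.Away.lift (S := CoeffA)
    (g := (MvPolynomial.aeval ![0, Polynomial.X] : PolyTD →ₐ[ℤ] Polynomial ℤ).toRingHom) polyTheta
    (by simp [polyTheta])

end CoeffA

/-- The elements of degree `n` of `ℤ[β]`, where `β` has degree `-2`. -/
def polyHomogeneous (n : ℤ) : Set (Polynomial ℤ) :=
  {f | ∀ k ∈ f.support, -2 * (k : ℤ) = n}

/-- The elements of bidegree `n` of a free module over a graded ring `B`, with elements of degree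
`m` in `𝓑 m`, on a basis with bidegrees `deg`. -/
def freeHomogeneous {B ι : Type*} [CommRing B] (𝓑 : ℤ → Set B) (deg : ι → ℤ × ℤ) (n : ℤ × ℤ) :
    Set (ι → B) :=
  {v | ∀ i, v i ≠ 0 → (deg i).1 = n.1 ∧ v i ∈ 𝓑 (n.2 - (deg i).2)}

namespace LinkDiagram

variable {X V F : Type} [Fintype X] [LinearOrder X] [Fintype V] [Fintype F]
variable {D : LinkDiagram X V F} (o : D.Orientation) (p : Dart X V)

/-! ### The reduced complexes -/

variable (D) in
/-- The index set of the basis `e(s, l)` of `kh'(D,p)`: `s` is a state and `l` is a map from the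
components of `D_s` to the signs with value `1` on the component of `p`. -/
abbrev RedIndex : Type :=
  Σ s : X → ℤˣ, {l : D.Circ s → ℤˣ // l (D.circ s p) = 1}

/-- The coefficients of the product: the basis elements of signs `i` and `j` of two factors have a
product with coefficient `mergeCoeff i j k` at the basis element of sign `k`. -/
def mergeCoeff (i j k : ℤˣ) : CoeffA :=
  if k = 1 then (if i = 1 ∧ j = 1 then 1 else 0)
  else if i = 1 ∧ j = 1 then -(CoeffA.θinv * CoeffA.t)
  else if i = -1 ∧ j = -1 then -(CoeffA.θinv * CoeffA.δ)
  else CoeffA.θinv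

/-- The coefficients of the coproduct: the basis element of sign `i` has a coproduct with
coefficient `splitCoeff i j k` at the tensor product of the basis elements of signs `j` and `k`. -/
def splitCoeff (i j k : ℤˣ) : CoeffA :=
  if i = 1 then (if j = 1 ∧ k = 1 then CoeffA.δ else if j = -1 ∧ k = -1 then 0 else 1)
  else (if j = -1 ∧ k = -1 then 1 else 0)

/-- The coefficient of the surgery map `γ_x` from `e(s, l)` to `e(s', l')`, where `s x = 1` and `s'`
is `s` with the value at `x` changed to `-1`, computed in the basis of `Φ(D_s)` over the copy of
`R` at `p` which consists of the products, over the components `c`, of `ω_c / ω_p` if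
`l(c) = 1` and of `ω_c (α_c - α_p)` if `l(c) = -1`.  For a component `c` different from the one of
`p`, this is the multiplication and comultiplication of these two elements; the factor of the
component of `p` only contributes `1`, which is compatible with the same formulas. -/
def redSurgery (x : X) (s s' : X → ℤˣ) (l : D.Circ s → ℤˣ) (l' : D.Circ s' → ℤˣ) : CoeffA :=
  if ∀ d, D.circ s d ≠ D.circ s (.inl (x, 0)) → D.circ s d ≠ D.circ s (.inl (x, 2)) →
      l' (D.circ s' d) = l (D.circ s d) then
    if D.circ s (.inl (x, 0)) = D.circ s (.inl (x, 2)) then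
      splitCoeff (l (D.circ s (.inl (x, 0)))) (l' (D.circ s' (.inl (x, 0))))
        (l' (D.circ s' (.inl (x, 2))))
    else
      mergeCoeff (l (D.circ s (.inl (x, 0)))) (l (D.circ s (.inl (x, 2))))
        (l' (D.circ s' (.inl (x, 0))))
  else 0

variable (D) in
instance : Fintype (D.RedIndex p) :=
  inferInstanceAs (Fintype (Σ s : X → ℤˣ, {l : D.Circ s → ℤˣ // l (D.circ s p) = 1}))

variable (D) in
/-- The matrix of the differential of `kh'(D,p)`. -/
def redMatrix : Matrix (D.RedIndex p) (D.RedIndex p) CoeffA := fun i' i =>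
  ∑ x : X, if i.1 x = 1 ∧ i'.1 = Function.update i.1 x (-1) then
    ((wedgeSign i'.1 x : ℤ) : CoeffA) * redSurgery x i.1 i'.1 i.2.1 i'.2.1
  else 0

namespace Orientation

/-- The bidegree of the basis element `e(s, l)` of `KH'(D,p)`. -/
def redDegree (i : D.RedIndex p) : ℤ × ℤ :=
  (o.stateDegree i.1, ∑ c, (i.2.1 c : ℤ))

/-- The bidegree of the basis element `v(σ)` of `E(D,p,B)`. -/
def changeBidegree (σ : o.Change p) : ℤ × ℤ :=
  (changeDegree σ, Nat.card (D.Circ (changeState σ)))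

/-- The contribution to `φ'` of a component `c` with `a_c = a` and `l(c) = l`. -/
def redWeight (a l : ℤˣ) : CoeffA :=
  if a = o.baseSign p then (if l = 1 then 1 else 0)
  else (if l = 1 then CoeffA.θinv else -(CoeffA.θinv * CoeffA.δ))

/-- The matrix of `φ' : KH'(D,p) → E(D,p,A)`. -/
def redPhiMatrix : Matrix (o.Change p) (D.RedIndex p) CoeffA := fun σ i =>
  if h : changeState σ = i.1 then
    ((contractionSign σ : ℤ) : CoeffA) *
      ∏ c : D.Circ (changeState σ), o.redWeight p (circSign σ c) (i.2.1 (h ▸ c))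
  else 0

/-! For a ring map `η : A → B`, the complex `B ⊗_A KH'(D,p)` is the free `B`-module on the basis
`e(s, l)` with the following differential. It is `KH'(D,p)` if `η` is the identity of `A` and
`KH''(D,p)` if `η` is the map from `A` to `ℤ[β]`. -/

/-- The differential of `B ⊗_A KH'(D,p)`. -/
@[nolint unusedArguments]
def redD (_ : D.Orientation) (p : Dart X V) {B : Type*} [CommRing B] (η : CoeffA →+* B)
    (v : D.RedIndex p → B) : D.RedIndex p → B :=
  ((D.redMatrix p).map η).mulVec v

variable {B : Type*} [CommRing B] (η : CoeffA →+* B)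

/-- The map from `B ⊗_A KH'(D,p)` to `E(D,p,B)` induced by `φ'`. -/
def redPhi (v : D.RedIndex p → B) : o.Change p → B :=
  ((o.redPhiMatrix p).map η).mulVec v

/-- The elements of bidegree `n` of `B ⊗_A KH'(D,p)`, for a graded ring `B` with elements of degree
`m` in `𝓑 m`. -/
def redHomogeneous (𝓑 : ℤ → Set B) (n : ℤ × ℤ) : Set (D.RedIndex p → B) :=
  freeHomogeneous 𝓑 (o.redDegree p) n

/-- The elements of bidegree `n` of `E(D,p,B)`, for a graded ring `B` with elements of degree
`m` in `𝓑 m`. -/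
def eBihomogeneous (𝓑 : ℤ → Set B) (n : ℤ × ℤ) : Set (o.Change p → B) :=
  freeHomogeneous 𝓑 (o.changeBidegree p) n

end Orientation

end LinkDiagram

/-! ## Complexes and homotopically nilpotent actions

Graded modules are given by their sets of homogeneous elements. -/

section Complexes

variable {B M E G : Type*} [CommRing B] [AddCommGroup M] [Module B M] [AddCommGroup E] [Module B E]
  [AddCommGroup G]

variable (B) in
/-- `d` is a `B`-linear differential of degree `e`. -/
structure IsDifferential (𝓜 : G → Set M) (e : G) (d : M → M) : Prop where
  linear : IsLinearMap B d
  degree : ∀ n, Set.MapsTo d (𝓜 n) (𝓜 (n + e))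
  sq_zero : ∀ u, d (d u) = 0

variable (B) in
/-- `f` is a `B`-linear morphism of degree zero from the complex `M` to the graded module `E` with
the zero differential. -/
structure IsMorphismToZeroComplex (𝓜 : G → Set M) (𝓔 : G → Set E) (d : M → M) (f : M → E) :
    Prop where
  linear : IsLinearMap B f
  degree : ∀ n, Set.MapsTo f (𝓜 n) (𝓔 n)
  comm : ∀ u, f (d u) = 0

/-- The kernel of a morphism. -/
def IsMorphismToZeroComplex.ker {𝓜 : G → Set M} {𝓔 : G → Set E} {d : M → M} {f : M → E}
    (h : IsMorphismToZeroComplex B 𝓜 𝓔 d f) : Submodule B M :=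
  LinearMap.ker (h.linear.mk' f)

/-- The multiplication by `b`, of degree `e'`, is homotopically nilpotent on the subcomplex `U` of
the complex `M`, with a differential `d` of degree `e`: `U` is stable under `d` and
some power `b ^ N` is null-homotopic on `U`, by a homotopy which is homogeneous of the degree
`N e' - e`. -/
def HomotopicallyNilpotentOn (𝓜 : G → Set M) (e : G) (d : M → M) (U : Submodule B M) (b : B)
    (e' : G) : Prop :=
  ∃ hd : ∀ u : U, d u ∈ U, ∃ (N : ℕ) (k : U →ₗ[B] U),
    (∀ (n : G) (u : U), (u : M) ∈ 𝓜 n → (k u : M) ∈ 𝓜 (n + (N • e' - e))) ∧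
    ∀ u : U, d (k u) + k ⟨d u, hd u⟩ = b ^ N • (u : M)

end Complexes

end

open scoped TensorProduct

noncomputable section

open scoped Classical

set_option linter.unusedSectionVars false

namespace Dart

variable {X V : Type}

/-- The vertex of a half-edge. -/
def vert : Dart X V → X ⊕ V
  | .inl (x, _) => .inl x
  | .inr (v, _) => .inr v

theorem vert_rot (d : Dart X V) : d.rot.vert = d.vert := by
  rcases d with ⟨x, i⟩ | ⟨v, i⟩ <;> rfl

theorem vert_straight (d : Dart X V) : d.straight.vert = d.vert := by
  rcases d with ⟨x, i⟩ | ⟨v, i⟩ <;> rfl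

theorem rot_bijective : Function.Bijective (rot : Dart X V → Dart X V) := by
  refine ⟨?_, ?_⟩
  · rintro (⟨x, i⟩ | ⟨v, i⟩) (⟨y, j⟩ | ⟨w, j⟩) h <;> simp [rot] at h ⊢ <;> exact h
  · rintro (⟨x, i⟩ | ⟨v, i⟩)
    · exact ⟨.inl (x, i - 1), by simp [rot]⟩
    · exact ⟨.inr (v, i - 1), by simp [rot]⟩

theorem straight_straight (d : Dart X V) : d.straight.straight = d := by
  rcases d with ⟨x, i⟩ | ⟨v, i⟩
  · have : i + 2 + 2 = i := by revert i; decide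
    simp [straight, this]
  · have : i + 1 + 1 = i := by revert i; decide
    simp [straight, this]

theorem card [Fintype X] [Fintype V] :
    Fintype.card (Dart X V) = 2 * (2 * Fintype.card X + Fintype.card V) := by
  simp [Dart, ZMod.card]
  ring

end Dart

namespace LinkDiagram

variable {X V F : Type} [Fintype X] [Fintype V] [Fintype F]
variable (D : LinkDiagram X V F)

/-- The permutation of the half-edges exchanging the two halves of each edge. -/
def oppEquiv : Equiv.Perm (Dart X V) := ⟨D.opp, D.opp, D.opp_opp, D.opp_opp⟩

theorem sum_opp {M : Type*} [AddCommMonoid M] (f : Dart X V → M) :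
    ∑ d, f (D.opp d) = ∑ d, f d :=
  Equiv.sum_comp D.oppEquiv f

/-- Antisymmetric functions on the half-edges. -/
def antisymm : Submodule ℚ (Dart X V → ℚ) where
  carrier := {a | ∀ d, a (D.opp d) = -a d}
  add_mem' ha hb d := by simp [ha d, hb d]; ring
  zero_mem' d := by simp
  smul_mem' c a ha d := by simp [ha d]

/-- The coboundary of a function on the regions. -/
def regionDiff : (F → ℚ) →ₗ[ℚ] (Dart X V → ℚ) where
  toFun w d := w (D.left d) - w (D.left (D.opp d))
  map_add' a b := by ext d; simp; ring
  map_smul' c a := by ext d; simp; ring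

/-- The coboundary of a function on the vertices. -/
def vertexDiff : (X ⊕ V → ℚ) →ₗ[ℚ] (Dart X V → ℚ) where
  toFun g d := g d.vert - g (D.opp d).vert
  map_add' a b := by ext d; simp; ring
  map_smul' c a := by ext d; simp; ring

theorem finrank_antisymm_le (o : D.Orientation) :
    Module.finrank ℚ D.antisymm ≤ 2 * Fintype.card X + Fintype.card V := by
  let P := {d : Dart X V // o.dir d = 1}
  let r : D.antisymm →ₗ[ℚ] (P → ℚ) :=
    { toFun := fun a d => a.1 d.1, map_add' := fun _ _ => rfl, map_smul' := fun _ _ => rfl }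
  have hr : Function.Injective r := by
    intro a b h
    ext d
    by_cases hd : o.dir d = 1
    · exact congrFun h ⟨d, hd⟩
    · have hd' : o.dir (D.opp d) = 1 := by
        rw [o.dir_opp, (Int.units_eq_one_or (o.dir d)).resolve_left hd, neg_neg]
      have := congrFun h ⟨_, hd'⟩
      have h2 : a.1 (D.opp d) = b.1 (D.opp d) := this
      rw [a.2 d, b.2 d] at h2
      exact neg_injective h2
  have h1 := LinearMap.finrank_le_finrank_of_injective hr
  rw [Module.finrank_fintype_fun_eq_card] at h1
  have e : P ≃ {d : Dart X V // ¬ o.dir d = 1} := D.oppEquiv.subtypeEquiv fun d => by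
    change _ ↔ ¬ o.dir (D.opp d) = 1
    rw [o.dir_opp]
    rcases Int.units_eq_one_or (o.dir d) with h | h <;> simp [h]
  have h2 := Fintype.card_congr e
  have h3 := Fintype.card_subtype_compl (fun d : Dart X V => o.dir d = 1)
  have h4 := Fintype.card_subtype_le (fun d : Dart X V => o.dir d = 1)
  have h5 := Dart.card (X := X) (V := V)
  change Fintype.card P ≤ _ at h4
  change _ = _ - Fintype.card P at h3
  omega

theorem regionDiff_mem (w : F → ℚ) : D.regionDiff w ∈ D.antisymm := fun d => by
  simp [regionDiff, D.opp_opp]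

theorem vertexDiff_mem (g : X ⊕ V → ℚ) : D.vertexDiff g ∈ D.antisymm := fun d => by
  simp [vertexDiff, D.opp_opp]

theorem sum_mul_vertexDiff {a : Dart X V → ℚ} (ha : a ∈ D.antisymm) (g : X ⊕ V → ℚ) :
    ∑ d, a d * D.vertexDiff g d = 2 * ∑ d, a d * g d.vert := by
  have h : ∑ d, a d * g (D.opp d).vert = - ∑ d, a d * g d.vert := by
    rw [← D.sum_opp, ← Finset.sum_neg_distrib]
    refine Finset.sum_congr rfl fun d _ => ?_
    rw [ha d, D.opp_opp, neg_mul]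
  simp only [vertexDiff, LinearMap.coe_mk, AddHom.coe_mk, mul_sub, Finset.sum_sub_distrib, h]
  ring

theorem sum_regionDiff_mul_vertexDiff (w : F → ℚ) (g : X ⊕ V → ℚ) :
    ∑ d, D.regionDiff w d * D.vertexDiff g d = 0 := by
  rw [D.sum_mul_vertexDiff (D.regionDiff_mem w)]
  simp only [regionDiff, LinearMap.coe_mk, AddHom.coe_mk, sub_mul, Finset.sum_sub_distrib]
  rw [mul_eq_zero, sub_eq_zero]
  right
  rw [← Function.Bijective.sum_comp Dart.rot_bijective
    (fun d : Dart X V => w (D.left (D.opp d)) * g d.vert)]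
  simp [D.left_rot, Dart.vert_rot]

theorem finrank_range_regionDiff :
    Fintype.card F ≤ Module.finrank ℚ (LinearMap.range D.regionDiff) + 1 := by
  have hk : LinearMap.ker D.regionDiff ≤ Submodule.span ℚ {fun _ => (1 : ℚ)} := by
    intro w hw
    have hc : ∀ f f', w f = w f' := fun f f' => by
      induction D.regions_connected f f' with
      | rel a b h =>
        obtain ⟨d, rfl, rfl⟩ := h
        have := congrFun (LinearMap.mem_ker.1 hw) d
        exact sub_eq_zero.1 this
      | refl => rfl
      | symm _ _ _ h => exact h.symm
      | trans _ _ _ _ _ h h' => exact h.trans h'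
    refine Submodule.mem_span_singleton.2 ⟨w D.outer, ?_⟩
    ext f
    simp [hc f D.outer]
  have h1 := Submodule.finrank_mono hk
  have h2 := finrank_span_le_card (R := ℚ) {fun _ : F => (1 : ℚ)}
  rw [Set.toFinset_singleton, Finset.card_singleton] at h2
  have h3 := LinearMap.finrank_range_add_finrank_ker D.regionDiff
  rw [Module.finrank_fintype_fun_eq_card] at h3
  omega

variable {D} in
theorem Connected.eqvGen (hD : D.Connected) (d d' : Dart X V) :
    Relation.EqvGen (fun d d' : Dart X V => d' = D.opp d ∨ d' = d.rot) d d' := by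
  have := (Nat.card_eq_one_iff_unique.1 hD).1
  exact Quot.eqvGen_exact (Subsingleton.elim _ _)

theorem finrank_range_vertexDiff (hD : D.Connected) :
    Fintype.card X + Fintype.card V ≤
      Module.finrank ℚ (LinearMap.range D.vertexDiff) + 1 := by
  have hk : LinearMap.ker D.vertexDiff ≤ Submodule.span ℚ {fun _ => (1 : ℚ)} := by
    intro g hg
    have hc : ∀ d d' : Dart X V, g d.vert = g d'.vert := fun d d' => by
      induction hD.eqvGen d d' with
      | rel a b h =>
        rcases h with rfl | rfl
        · exact sub_eq_zero.1 (congrFun (LinearMap.mem_ker.1 hg) a)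
        · rw [Dart.vert_rot]
      | refl => rfl
      | symm _ _ _ h => exact h.symm
      | trans _ _ _ _ _ h h' => exact h.trans h'
    have hv : ∀ y : X ⊕ V, ∃ d : Dart X V, d.vert = y := by
      rintro (x | v)
      · exact ⟨.inl (x, 0), rfl⟩
      · exact ⟨.inr (v, 0), rfl⟩
    obtain ⟨d₀⟩ : Nonempty (Dart X V) := by
      have := (Nat.card_eq_one_iff_unique.1 hD).2
      exact this.elim fun q => ⟨q.out⟩
    refine Submodule.mem_span_singleton.2 ⟨g d₀.vert, ?_⟩
    ext y
    obtain ⟨d, rfl⟩ := hv y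
    simp [hc d d₀]
  have h1 := Submodule.finrank_mono hk
  have h2 := finrank_span_le_card (R := ℚ) {fun _ : X ⊕ V => (1 : ℚ)}
  rw [Set.toFinset_singleton, Finset.card_singleton] at h2
  have h3 := LinearMap.finrank_range_add_finrank_ker D.vertexDiff
  rw [Module.finrank_fintype_fun_eq_card, Fintype.card_sum] at h3
  omega

/-- On a connected diagram, an antisymmetric function on the half-edges whose sums with all
coboundaries of functions on the vertices vanish is the coboundary of a function on the regions. -/
theorem exists_regionDiff_eq (hD : D.Connected) (o : D.Orientation) {a : Dart X V → ℚ}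
    (ha : a ∈ D.antisymm) (hv : ∀ g, ∑ d, a d * D.vertexDiff g d = 0) :
    ∃ w, D.regionDiff w = a := by
  have hF : Fintype.card F = Fintype.card X + 2 := by
    have := D.euler
    rw [show Nat.card _ = 1 from hD] at this
    omega
  have hdis : Disjoint (LinearMap.range D.regionDiff) (LinearMap.range D.vertexDiff) := by
    rw [Submodule.disjoint_def]
    rintro _ ⟨w, rfl⟩ ⟨g, hg⟩
    have h := D.sum_regionDiff_mul_vertexDiff w g
    rw [hg] at h
    ext d
    exact mul_self_eq_zero.1 ((Finset.sum_eq_zero_iff_of_nonneg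
      fun d _ => mul_self_nonneg (D.regionDiff w d)).1 h d (Finset.mem_univ _))
  have hle : LinearMap.range D.regionDiff ⊔ LinearMap.range D.vertexDiff ≤ D.antisymm := by
    rw [sup_le_iff]
    constructor
    · rintro _ ⟨w, rfl⟩
      exact D.regionDiff_mem w
    · rintro _ ⟨g, rfl⟩
      exact D.vertexDiff_mem g
  have heq := Submodule.eq_of_le_of_finrank_le hle (by
    have h1 := Submodule.finrank_sup_add_finrank_inf_eq (LinearMap.range D.regionDiff)
      (LinearMap.range D.vertexDiff)
    rw [hdis.eq_bot, finrank_bot] at h1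
    have h2 := D.finrank_antisymm_le o
    have h3 := D.finrank_range_regionDiff
    have h4 := D.finrank_range_vertexDiff hD
    omega)
  rw [← heq] at ha
  obtain ⟨_, ⟨w, rfl⟩, _, ⟨g, rfl⟩, rfl⟩ := Submodule.mem_sup.1 ha
  refine ⟨w, ?_⟩
  have h := hv g
  simp only [Pi.add_apply, add_mul, Finset.sum_add_distrib,
    D.sum_regionDiff_mul_vertexDiff w g, zero_add] at h
  ext d
  have := mul_self_eq_zero.1 ((Finset.sum_eq_zero_iff_of_nonneg
      fun d _ => mul_self_nonneg (D.vertexDiff g d)).1 h d (Finset.mem_univ _))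
  simp [this]

namespace Orientation

variable {D}

theorem exists_isWinding (hD : D.Connected) (o : D.Orientation) : ∃ w, o.IsWinding w := by
  have ha : (fun d => ((o.dir d : ℤ) : ℚ)) ∈ D.antisymm := fun d => by simp [o.dir_opp]
  obtain ⟨w, hw⟩ := D.exists_regionDiff_eq hD o ha fun g => by
    rw [D.sum_mul_vertexDiff ha]
    have : ∑ d : Dart X V, ((o.dir d : ℤ) : ℚ) * g d.vert =
        - ∑ d : Dart X V, ((o.dir d : ℤ) : ℚ) * g d.vert := by
      conv_lhs => rw [← Function.Bijective.sum_comp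
        (Function.Involutive.bijective Dart.straight_straight)]
      rw [← Finset.sum_neg_distrib]
      simp [o.dir_straight, Dart.vert_straight]
    linarith
  have hw' : ∀ d, w (D.left d) - w (D.left (D.opp d)) = ((o.dir d : ℤ) : ℚ) := congrFun hw
  have hint : ∀ f f', ∃ n : ℤ, w f - w f' = n := fun f f' => by
    induction D.regions_connected f f' with
    | rel a b h =>
      obtain ⟨d, rfl, rfl⟩ := h
      exact ⟨_, hw' d⟩
    | refl => exact ⟨0, by simp⟩
    | symm _ _ _ h =>
      obtain ⟨n, h⟩ := h
      exact ⟨-n, by push_cast; linarith⟩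
    | trans _ _ _ _ _ h h' =>
      obtain ⟨n, h⟩ := h
      obtain ⟨m, h'⟩ := h'
      exact ⟨n + m, by push_cast; linarith⟩
  choose n hn using fun f => hint f D.outer
  refine ⟨n, ?_, fun d hd => ?_⟩
  · have := hn D.outer
    rw [sub_self] at this
    exact_mod_cast this.symm
  · have := hw' d
    rw [hd] at this
    have h : ((n (D.left d) : ℤ) : ℚ) = n (D.left (D.opp d)) + 1 := by
      rw [← hn, ← hn]
      push_cast at this
      linarith
    exact_mod_cast h

theorem isWinding_winding (hD : D.Connected) (o : D.Orientation) : o.IsWinding o.winding :=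
  Classical.epsilon_spec (o.exists_isWinding hD)

/-- The checkerboard colouring: the parity of the winding number on the left of a half-edge. -/
def checker (o : D.Orientation) (d : Dart X V) : ℤˣ := (-1) ^ o.winding (D.left d)

theorem neg_one_pow_winding_opp (hD : D.Connected) (o : D.Orientation) (d : Dart X V) :
    ((-1) ^ o.winding (D.left (D.opp d)) : ℤˣ) = -(-1) ^ o.winding (D.left d) := by
  have h := (o.isWinding_winding hD).2
  rcases Int.units_eq_one_or (o.dir d) with hd | hd
  · rw [h d hd, zpow_add]
    simp
  · have := h (D.opp d) (by rw [o.dir_opp, hd, neg_neg])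
    rw [this, D.opp_opp, zpow_add]
    simp

theorem neg_one_pow_winding_eq (hD : D.Connected) (o o' : D.Orientation) (f : F) :
    ((-1) ^ o.winding f : ℤˣ) = (-1) ^ o'.winding f := by
  have key : ∀ f f', ((-1) ^ o.winding f * (-1) ^ o'.winding f : ℤˣ) =
      (-1) ^ o.winding f' * (-1) ^ o'.winding f' := fun f f' => by
    induction D.regions_connected f f' with
    | rel a b h =>
      obtain ⟨d, rfl, rfl⟩ := h
      rw [neg_one_pow_winding_opp hD, neg_one_pow_winding_opp hD, neg_mul_neg]
    | refl => rfl
    | symm _ _ _ h => exact h.symm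
    | trans _ _ _ _ _ h h' => exact h.trans h'
  replace key := key f D.outer
  rw [(o.isWinding_winding hD).1, (o'.isWinding_winding hD).1] at key
  simp only [zpow_zero, mul_one] at key
  rcases Int.units_eq_one_or ((-1) ^ o.winding f) with h | h <;>
    rcases Int.units_eq_one_or ((-1) ^ o'.winding f) with h' | h' <;> simp_all

theorem checker_opp (hD : D.Connected) (o : D.Orientation) (d : Dart X V) :
    o.checker (D.opp d) = -o.checker d := neg_one_pow_winding_opp hD o d

theorem checker_rot (hD : D.Connected) (o : D.Orientation) (d : Dart X V) :
    o.checker d.rot = -o.checker d := by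
  have := o.checker_opp hD d.rot
  rw [checker, D.left_rot] at this
  rw [eq_comm, neg_eq_iff_eq_neg]
  exact this

theorem leftSign_eq (hD : D.Connected) (o o' : D.Orientation) (d : Dart X V) :
    o'.leftSign d = o'.dir d * o.checker d := by
  unfold leftSign leftRegion
  rw [neg_one_pow_winding_eq hD o' o]
  rcases Int.units_eq_one_or (o'.dir d) with h | h
  · rw [if_pos h, h, one_mul, checker]
  · rw [if_neg (by rw [h]; decide), h, neg_one_pow_winding_opp hD, checker, neg_one_mul]

end Orientation

end LinkDiagram

namespace Equiv.Perm

variable {α : Type*} [Finite α] [DecidableEq α]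

theorem SameCycle.of_mul_swap_of_not {π : Perm α} {a b : α}
    (h : ¬ π.SameCycle a b) : (π * swap a b).SameCycle a b := by
  by_contra h'
  have key : ∀ n : ℕ, (π * swap a b).SameCycle b ((π ^ (n + 1)) a) := by
    intro n
    induction n with
    | zero => exact ⟨1, by simp⟩
    | succ n ih =>
      have ha : (π ^ (n + 1)) a ≠ a := fun e => h' (e ▸ ih).symm
      have hb : (π ^ (n + 1)) a ≠ b := fun e => h ⟨(n + 1 : ℕ), by rw [zpow_natCast]; exact e⟩
      have : (π * swap a b) ((π ^ (n + 1)) a) = (π ^ (n + 1 + 1)) a := by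
        rw [pow_succ' π (n + 1), mul_apply, mul_apply, swap_apply_of_ne_of_ne ha hb]
      rw [← this]
      exact (sameCycle_apply_right).2 ih
  have hpos := orderOf_pos π
  have := key (orderOf π - 1)
  rw [Nat.sub_add_cancel hpos, pow_orderOf_eq_one] at this
  exact h' this.symm

theorem SameCycle.not_mul_swap {π : Perm α} {a b : α} (hab : a ≠ b)
    (h : π.SameCycle a b) : ¬ (π * swap a b).SameCycle a b := by
  intro h'
  have hex : ∃ n : ℕ, (π ^ n) b = a := by
    obtain ⟨n, -, -, hn⟩ := h.symm.exists_pow_eq''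
    exact ⟨n, hn⟩
  let m := Nat.find hex
  have hm : (π ^ m) b = a := Nat.find_spec hex
  have hm0 : m ≠ 0 := fun e => by
    rw [e] at hm
    exact hab hm.symm
  have key : ∀ n : ℕ, ∃ i, 1 ≤ i ∧ i ≤ m ∧ ((π * swap a b) ^ n) a = (π ^ i) b := by
    intro n
    induction n with
    | zero => exact ⟨m, by omega, le_rfl, by simp [hm]⟩
    | succ n ih =>
      obtain ⟨i, h1, hi, e⟩ := ih
      rw [pow_succ', mul_apply, e]
      rcases hi.lt_or_eq with hlt | rfl
      · have ha : (π ^ i) b ≠ a := Nat.find_min hex hlt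
        have hb : (π ^ i) b ≠ b := fun eb => by
          refine Nat.find_min hex (m := m - i) (by omega) ?_
          rw [← eb, ← mul_apply, ← pow_add, Nat.sub_add_cancel hi]
          exact hm
        refine ⟨i + 1, by omega, hlt, ?_⟩
        rw [pow_succ' π i, mul_apply, mul_apply, swap_apply_of_ne_of_ne ha hb]
      · refine ⟨1, le_rfl, h1, ?_⟩
        rw [hm]
        simp
  obtain ⟨n, -, -, hn⟩ := h'.exists_pow_eq''
  obtain ⟨i, h1, hi, e⟩ := key n
  rw [hn] at e
  refine Nat.find_min hex (m := m - i) (by omega) ?_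
  conv_lhs => rw [e]
  rw [← mul_apply, ← pow_add, Nat.sub_add_cancel hi]
  exact hm

end Equiv.Perm

namespace LinkDiagram

variable {X V F : Type} [Fintype X] [LinearOrder X] [Fintype V] [Fintype F]

/-- The state `s` changed at the crossing `x`. -/
def flip (s : X → ℤˣ) (x : X) : X → ℤˣ := Function.update s x (-s x)

theorem flip_same (s : X → ℤˣ) (x : X) : flip s x x = -s x := by simp [flip]

theorem flip_of_ne (s : X → ℤˣ) {x y : X} (h : y ≠ x) : flip s x y = s y := by simp [flip, h]

theorem flip_flip (s : X → ℤˣ) (x : X) : flip (flip s x) x = s := by simp [flip]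

theorem flip_comm (s : X → ℤˣ) (x y : X) : flip (flip s x) y = flip (flip s y) x := by
  by_cases h : x = y
  · rw [h]
  · simp only [flip, Function.update_of_ne h, Function.update_of_ne (Ne.symm h)]
    rw [Function.update_comm h]

theorem flip_eq_iff {s s' : X → ℤˣ} {x : X} : flip s x = s' ↔ s = flip s' x := by
  constructor <;> rintro rfl <;> rw [flip_flip]

variable (D : LinkDiagram X V F)

theorem circ_opp (s : X → ℤˣ) (d : Dart X V) : D.circ s (D.opp d) = D.circ s d := by
  symm
  exact Quot.sound (Or.inl rfl)

theorem circ_smooth (s : X → ℤˣ) (d : Dart X V) : D.circ s (smooth s d) = D.circ s d := by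
  symm
  exact Quot.sound (Or.inr rfl)

variable {D}

/-- A function on the half-edges which is compatible with a resolution is constant on its
components. -/
theorem eq_of_circ_eq {α : Sort*} {s : X → ℤˣ} (f : Dart X V → α) (h1 : ∀ d, f (D.opp d) = f d)
    (h2 : ∀ d, f (smooth s d) = f d) {d d' : Dart X V} (h : D.circ s d = D.circ s d') :
    f d = f d' := by
  have := congrArg (Quot.lift f (by
    rintro a b (rfl | rfl)
    · exact (h1 a).symm
    · exact (h2 a).symm)) h
  exact this

theorem circ_out {s : X → ℤˣ} (c : D.Circ s) : D.circ s (Quot.out c) = c := Quot.out_eq c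

theorem circ_near {s : X → ℤˣ} (x : X) (i : ZMod 4) :
    D.circ s (.inl (x, i)) = D.circ s (.inl (x, 0)) ∨
      D.circ s (.inl (x, i)) = D.circ s (.inl (x, 2)) := by
  have h0 := D.circ_smooth s (.inl (x, 0))
  have h2 := D.circ_smooth s (.inl (x, 2))
  simp only [smooth] at h0 h2
  have e1 : (1 : ZMod 4) - 0 = 1 := by decide
  have e2 : (3 : ZMod 4) - 0 = 3 := by decide
  have e3 : (1 : ZMod 4) - 2 = 3 := by decide
  have e4 : (3 : ZMod 4) - 2 = 1 := by decide
  simp only [e1, e2, e3, e4] at h0 h2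
  have hi : i = 0 ∨ i = 1 ∨ i = 2 ∨ i = 3 := by revert i; decide
  rcases hi with rfl | rfl | rfl | rfl
  · exact Or.inl rfl
  · by_cases h : s x = 1
    · rw [if_pos h] at h0; exact Or.inl h0
    · rw [if_neg h] at h2; exact Or.inr h2
  · exact Or.inr rfl
  · by_cases h : s x = 1
    · rw [if_pos h] at h2; exact Or.inr h2
    · rw [if_neg h] at h0; exact Or.inl h0

/-- The arcs of `D_s` at the crossing `x` contain `1` and `3` in some order besides `0` and `2`. -/
theorem circ_one_three {s : X → ℤˣ} (x : X) :
    (D.circ s (.inl (x, 1)) = D.circ s (.inl (x, 0)) ∧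
      D.circ s (.inl (x, 3)) = D.circ s (.inl (x, 2))) ∨
    (D.circ s (.inl (x, 1)) = D.circ s (.inl (x, 2)) ∧
      D.circ s (.inl (x, 3)) = D.circ s (.inl (x, 0))) := by
  have h0 := D.circ_smooth s (.inl (x, 0))
  have h2 := D.circ_smooth s (.inl (x, 2))
  simp only [smooth] at h0 h2
  have e1 : (1 : ZMod 4) - 0 = 1 := by decide
  have e2 : (3 : ZMod 4) - 0 = 3 := by decide
  have e3 : (1 : ZMod 4) - 2 = 3 := by decide
  have e4 : (3 : ZMod 4) - 2 = 1 := by decide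
  simp only [e1, e2, e3, e4] at h0 h2
  by_cases h : s x = 1
  · rw [if_pos h] at h0 h2; exact Or.inl ⟨h0, h2⟩
  · rw [if_neg h] at h0 h2; exact Or.inr ⟨h2, h0⟩

/-- The half-edge `d` is on one of the components of `D_s` near `x`. -/
def Near (D : LinkDiagram X V F) (s : X → ℤˣ) (x : X) (d : Dart X V) : Prop :=
  D.circ s d = D.circ s (.inl (x, 0)) ∨ D.circ s d = D.circ s (.inl (x, 2))

/-- The two arcs of `D_s` near `x` belong to the same component. -/
def Joined (D : LinkDiagram X V F) (s : X → ℤˣ) (x : X) : Prop :=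
  D.circ s (.inl (x, 0)) = D.circ s (.inl (x, 2))

theorem Near.of_circ_eq {s : X → ℤˣ} {x : X} {d d' : Dart X V} (h : D.circ s d = D.circ s d')
    (hn : D.Near s x d) : D.Near s x d' := by
  unfold Near at hn ⊢
  rwa [← h]

theorem circ_flip_or {s : X → ℤˣ} (x : X) {d d' : Dart X V} (h : D.circ s d = D.circ s d') :
    D.circ (flip s x) d = D.circ (flip s x) d' ∨
      (D.Near (flip s x) x d ∧ D.Near (flip s x) x d') := by
  let f : Dart X V → Option (D.Circ (flip s x)) := fun d =>
    if D.Near (flip s x) x d then none else some (D.circ (flip s x) d)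
  have key : ∀ a b, (D.circ (flip s x) a = D.circ (flip s x) b ∨
      (D.Near (flip s x) x a ∧ D.Near (flip s x) x b)) ↔ f a = f b := by
    intro a b
    by_cases ha : D.Near (flip s x) x a <;> by_cases hb : D.Near (flip s x) x b
    · simp [f, ha, hb]
    · simp only [f, ha, hb, if_true, if_false, and_false, or_false]
      simp only [reduceCtorEq, iff_false]
      exact fun e => hb (ha.of_circ_eq e)
    · simp only [f, ha, hb, if_true, if_false, false_and, or_false]
      simp only [reduceCtorEq, iff_false]
      exact fun e => ha (hb.of_circ_eq e.symm)
    · simp [f, ha, hb]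
  rw [key]
  refine eq_of_circ_eq f (fun d => (key _ _).1 (Or.inl (D.circ_opp _ d))) (fun d => ?_) h
  rw [← key]
  rcases d with ⟨y, i⟩ | ⟨v, i⟩
  · by_cases hy : y = x
    · subst hy
      exact Or.inr ⟨circ_near _ _, circ_near _ _⟩
    · left
      have := D.circ_smooth (flip s x) (.inl (y, i))
      simpa only [smooth, flip_of_ne s hy] using this
  · exact Or.inl (D.circ_smooth (flip s x) (.inr (v, i)))

theorem Near.flip {s : X → ℤˣ} {x : X} {d : Dart X V} (h : D.Near s x d) :
    D.Near (flip s x) x d := by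
  rcases h with h | h
  · rcases circ_flip_or x h with h | h
    · exact Or.inl h
    · exact h.1
  · rcases circ_flip_or x h with h | h
    · exact Or.inr h
    · exact h.1

theorem near_flip_iff {s : X → ℤˣ} {x : X} {d : Dart X V} :
    D.Near (flip s x) x d ↔ D.Near s x d :=
  ⟨fun h => by simpa only [flip_flip] using h.flip, Near.flip⟩

/-- If the two arcs near `x` belong to the same component after the surgery, components do not
break. -/
theorem circ_flip_of_joined {s : X → ℤˣ} {x : X} (hx : D.Joined (flip s x) x) {d d' : Dart X V}
    (h : D.circ s d = D.circ s d') : D.circ (flip s x) d = D.circ (flip s x) d' := by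
  rcases circ_flip_or x h with h | ⟨h | h, h' | h'⟩
  · exact h
  all_goals rw [h, h']
  · exact hx
  · exact hx.symm

/-- Components away from `x` do not break. -/
theorem circ_flip_of_not_near {s : X → ℤˣ} {x : X} {d d' : Dart X V}
    (h : D.circ s d = D.circ s d') (hd : ¬ D.Near s x d) :
    D.circ (flip s x) d = D.circ (flip s x) d' := by
  rcases circ_flip_or x h with h | h
  · exact h
  · exact absurd (near_flip_iff.1 h.1) hd

theorem smooth_smooth (s : X → ℤˣ) (d : Dart X V) : smooth s (smooth s d) = d := by
  rcases d with ⟨x, i⟩ | ⟨v, i⟩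
  · by_cases h : s x = 1 <;> simp [smooth, h]
  · have : i + 1 + 1 = i := by revert i; decide
    simp [smooth, this]

/-- The permutation of the half-edges following the components of a resolution. -/
def follow (D : LinkDiagram X V F) (s : X → ℤˣ) : Equiv.Perm (Dart X V) :=
  D.oppEquiv * ⟨smooth s, smooth s, smooth_smooth s, smooth_smooth s⟩

theorem follow_apply (s : X → ℤˣ) (d : Dart X V) : D.follow s d = D.opp (smooth s d) := rfl

/-- A source-sink structure: an alternating choice of directions at all vertices. -/
def IsAlternating (D : LinkDiagram X V F) (τ : Dart X V → ℤˣ) : Prop :=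
  (∀ d, τ (D.opp d) = -τ d) ∧ ∀ d, τ d.rot = -τ d

namespace IsAlternating

variable {τ : Dart X V → ℤˣ}

theorem inl (h : D.IsAlternating τ) (x : X) : τ (.inl (x, 1)) = -τ (.inl (x, 0)) ∧
    τ (.inl (x, 2)) = τ (.inl (x, 0)) ∧ τ (.inl (x, 3)) = -τ (.inl (x, 0)) := by
  have h0 := h.2 (.inl (x, 0))
  have h1 := h.2 (.inl (x, 1))
  have h2 := h.2 (.inl (x, 2))
  simp only [Dart.rot, zero_add] at h0 h1 h2
  have e1 : (1 : ZMod 4) + 1 = 2 := by decide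
  have e2 : (2 : ZMod 4) + 1 = 3 := by decide
  rw [e1] at h1
  rw [e2] at h2
  simp [h0, h1, h2]

theorem smooth (h : D.IsAlternating τ) (s : X → ℤˣ) (d : Dart X V) :
    τ (LinkDiagram.smooth s d) = -τ d := by
  rcases d with ⟨x, i⟩ | ⟨v, i⟩
  · obtain ⟨h1, h2, h3⟩ := h.inl x
    have e1 : (1 : ZMod 4) - 0 = 1 := by decide
    have e2 : (3 : ZMod 4) - 0 = 3 := by decide
    have e3 : (1 : ZMod 4) - 2 = 3 := by decide
    have e4 : (3 : ZMod 4) - 2 = 1 := by decide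
    have e5 : (1 : ZMod 4) - 1 = 0 := by decide
    have e6 : (3 : ZMod 4) - 1 = 2 := by decide
    have e7 : (1 : ZMod 4) - 3 = 2 := by decide
    have e8 : (3 : ZMod 4) - 3 = 0 := by decide
    have hi : i = 0 ∨ i = 1 ∨ i = 2 ∨ i = 3 := by revert i; decide
    by_cases hs : s x = 1 <;> rcases hi with rfl | rfl | rfl | rfl <;>
      simp [LinkDiagram.smooth, *]
  · exact h.2 (.inr (v, i))

theorem follow (h : D.IsAlternating τ) (s : X → ℤˣ) (d : Dart X V) :
    τ (D.follow s d) = τ d := by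
  rw [follow_apply, h.1, h.smooth, neg_neg]

/-- The permutation following the components of a resolution, on the half-edges of one
direction. -/
def followSub (h : D.IsAlternating τ) (s : X → ℤˣ) (ε : ℤˣ) :
    Equiv.Perm {d : Dart X V // τ d = ε} :=
  (D.follow s).subtypePerm fun d => by rw [h.follow]

theorem circ_eq_iff (h : D.IsAlternating τ) {s : X → ℤˣ} {ε : ℤˣ}
    (a b : {d : Dart X V // τ d = ε}) :
    D.circ s a.1 = D.circ s b.1 ↔ (h.followSub s ε).SameCycle a b := by
  have hneg : ∀ d, τ d ≠ ε → -τ d = ε := fun d hd => by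
    rcases Int.units_eq_one_or (τ d) with h1 | h1 <;>
      rcases Int.units_eq_one_or ε with h2 | h2 <;> simp_all
  constructor
  · intro e
    let f : Dart X V → Quotient (Equiv.Perm.SameCycle.setoid (h.followSub s ε)) := fun d =>
      if hd : τ d = ε then Quotient.mk _ ⟨d, hd⟩
      else Quotient.mk _ ⟨D.opp d, by rw [h.1]; exact hneg d hd⟩
    have hf : ∀ d : Dart X V, ∀ hd : τ d = ε, f d = Quotient.mk _ ⟨d, hd⟩ :=
      fun d hd => dif_pos hd
    have hf' : ∀ d : Dart X V, ∀ hd : τ d ≠ ε, f d = Quotient.mk _ ⟨D.opp d, by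
        rw [h.1]; exact hneg d hd⟩ := fun d hd => dif_neg hd
    have hne : ∀ d, τ d = ε → -τ d ≠ ε := fun d hd e' => by
      rw [hd] at e'
      revert e'
      rcases Int.units_eq_one_or ε with h2 | h2 <;> rw [h2] <;> decide
    have := eq_of_circ_eq (D := D) (s := s) f ?_ ?_ e
    · rw [hf _ a.2, hf _ b.2] at this
      exact Quotient.exact this
    · intro d
      by_cases hd : τ d = ε
      · rw [hf d hd, hf' (D.opp d) (by rw [h.1]; exact hne d hd)]
        congr 2
        exact D.opp_opp d
      · rw [hf' d hd, hf]
    · intro d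
      by_cases hd : τ d = ε
      · rw [hf d hd, hf' (LinkDiagram.smooth s d) (by rw [h.smooth]; exact hne d hd)]
        refine Quotient.sound (Equiv.Perm.SameCycle.symm ⟨1, ?_⟩)
        rw [zpow_one]
        rfl
      · rw [hf' d hd, hf (LinkDiagram.smooth s d) (by rw [h.smooth]; exact hneg d hd)]
        refine Quotient.sound ⟨1, ?_⟩
        rw [zpow_one]
        apply Subtype.ext
        change D.opp (LinkDiagram.smooth s (LinkDiagram.smooth s d)) = D.opp d
        rw [smooth_smooth]
  · intro e
    obtain ⟨n, -, -, rfl⟩ := e.exists_pow_eq''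
    clear e
    induction n with
    | zero => rfl
    | succ n ih =>
      rw [ih, pow_succ', Equiv.Perm.mul_apply]
      change _ = D.circ s (D.opp (LinkDiagram.smooth s _))
      rw [D.circ_opp, D.circ_smooth]

theorem joined_flip (h : D.IsAlternating τ) (s : X → ℤˣ) (x : X) :
    D.Joined (flip s x) x ↔ ¬ D.Joined s x := by
  obtain ⟨h1, h2, h3⟩ := h.inl x
  let a : {d : Dart X V // τ d = τ (.inl (x, 0))} := ⟨.inl (x, 0), rfl⟩
  let b : {d : Dart X V // τ d = τ (.inl (x, 0))} := ⟨.inl (x, 2), h2⟩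
  have hab : a ≠ b := fun e => by
    have : (0 : ZMod 4) = 2 := by
      have := congrArg Subtype.val e
      simp only [a, b, Sum.inl.injEq, Prod.mk.injEq, true_and] at this
      exact this
    revert this
    decide
  have e1 : (1 : ZMod 4) - 0 = 1 := by decide
  have e2 : (3 : ZMod 4) - 0 = 3 := by decide
  have e3 : (1 : ZMod 4) - 2 = 3 := by decide
  have e4 : (3 : ZMod 4) - 2 = 1 := by decide
  have key : h.followSub (flip s x) (τ (.inl (x, 0))) =
      h.followSub s (τ (.inl (x, 0))) * Equiv.swap a b := by
    ext z
    rw [Equiv.Perm.mul_apply]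
    change D.opp (LinkDiagram.smooth (flip s x) z.1) =
      D.opp (LinkDiagram.smooth s (Equiv.swap a b z).1)
    congr 1
    by_cases hza : z = a
    · rw [hza, Equiv.swap_apply_left]
      rcases Int.units_eq_one_or (s x) with hs | hs <;>
        simp [a, b, LinkDiagram.smooth, flip_same, hs, e1, e2, e3, e4]
    by_cases hzb : z = b
    · rw [hzb, Equiv.swap_apply_right]
      rcases Int.units_eq_one_or (s x) with hs | hs <;>
        simp [a, b, LinkDiagram.smooth, flip_same, hs, e1, e2, e3, e4]
    rw [Equiv.swap_apply_of_ne_of_ne hza hzb]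
    obtain ⟨⟨y, i⟩ | ⟨v, i⟩, hz⟩ := z
    · have hy : y ≠ x := by
        rintro rfl
        have hi : ∀ i : ZMod 4, i = 0 ∨ i = 1 ∨ i = 2 ∨ i = 3 := by decide
        rcases hi i with rfl | rfl | rfl | rfl
        · exact hza rfl
        · rw [h1] at hz
          exact absurd hz (by
            rcases Int.units_eq_one_or (τ (.inl (y, 0))) with h | h <;> rw [h] <;> decide)
        · exact hzb rfl
        · rw [h3] at hz
          exact absurd hz (by
            rcases Int.units_eq_one_or (τ (.inl (y, 0))) with h | h <;> rw [h] <;> decide)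
      simp only [LinkDiagram.smooth, flip_of_ne s hy]
    · rfl
  have hs := h.circ_eq_iff (s := s) a b
  have hs' := h.circ_eq_iff (s := flip s x) a b
  change D.Joined s x ↔ _ at hs
  change D.Joined (flip s x) x ↔ _ at hs'
  rw [hs, hs', key]
  constructor
  · exact fun h1 h2 => h2.not_mul_swap hab h1
  · exact Equiv.Perm.SameCycle.of_mul_swap_of_not

end IsAlternating

theorem isAlternating_checker (hD : D.Connected) (o : D.Orientation) :
    D.IsAlternating o.checker := ⟨o.checker_opp hD, o.checker_rot hD⟩

end LinkDiagram

theorem Int.units_mul_eq_one_iff {a b : ℤˣ} : a * b = 1 ↔ a = b := by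
  rcases Int.units_eq_one_or a with rfl | rfl <;> rcases Int.units_eq_one_or b with rfl | rfl <;>
    decide

theorem Int.units_ne_iff {a b : ℤˣ} : a ≠ b ↔ a = -b := by
  rcases Int.units_eq_one_or a with rfl | rfl <;> rcases Int.units_eq_one_or b with rfl | rfl <;>
    decide

namespace LinkDiagram

variable {X V F : Type} [Fintype X] [LinearOrder X] [Fintype V] [Fintype F]
variable {D : LinkDiagram X V F}

theorem comp_opp (d : Dart X V) : D.comp (D.opp d) = D.comp d := by
  symm
  exact Quot.sound (Or.inl rfl)

theorem comp_straight (d : Dart X V) : D.comp d.straight = D.comp d := by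
  symm
  exact Quot.sound (Or.inr rfl)

theorem comp_inl_two (x : X) : D.comp (.inl (x, 2)) = D.comp (.inl (x, 0)) :=
  comp_straight (.inl (x, 0))

theorem comp_inl_three (x : X) : D.comp (.inl (x, 3)) = D.comp (.inl (x, 1)) :=
  comp_straight (.inl (x, 1))

namespace Orientation

variable (o : D.Orientation)

/-- The two-colouring of the edges which corresponds to the orientation `o` changed by `σ`. -/
def colour (σ : D.Comp → ℤˣ) (d : Dart X V) : ℤˣ := σ (D.comp d) * o.dir d * o.checker d

variable {o}
theorem changeDegree_eq {p : Dart X V} (σ : o.Change p) : changeDegree σ = o.stateDegree (changeState σ) := by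
  have h1 : (Finset.univ.filter fun x => o.sign x = -1) = mixed σ (-1) ∪ pure σ (-1) := by
    ext x
    simp only [mixed, pure, Finset.mem_filter, Finset.mem_univ, true_and, Finset.mem_union]
    tauto
  have h2 : (Finset.univ.filter fun x => changeState σ x = -1) = mixed σ 1 ∪ pure σ (-1) := by
    ext x
    simp only [mixed, pure, Finset.mem_filter, Finset.mem_univ, true_and, Finset.mem_union]
    rw [changeState]
    rcases Int.units_eq_one_or (o.sign x) with h1 | h1 <;>
    rcases Int.units_eq_one_or (σ.1 (D.comp (.inl (x, 0)))) with h2 | h2 <;>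
    rcases Int.units_eq_one_or (σ.1 (D.comp (.inl (x, 1)))) with h3 | h3 <;>
    simp [h1, h2, h3]
  have d1 : ∀ e, Disjoint (mixed σ e) (pure σ (-1)) := fun e => by
    rw [Finset.disjoint_left]
    simp only [mixed, pure, Finset.mem_filter, Finset.mem_univ, true_and]
    tauto
  rw [changeDegree, stateDegree, h1, h2, Finset.card_union_of_disjoint (d1 _),
    Finset.card_union_of_disjoint (d1 _)]
  push_cast
  ring

variable (hD : D.Connected)
include hD

theorem colour_opp (σ : D.Comp → ℤˣ) (d : Dart X V) : o.colour σ (D.opp d) = o.colour σ d := by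
  simp [colour, comp_opp, o.dir_opp, o.checker_opp hD]

theorem checker_inl (x : X) : o.checker (.inl (x, 1)) = -o.checker (.inl (x, 0)) ∧
    o.checker (.inl (x, 2)) = o.checker (.inl (x, 0)) ∧
    o.checker (.inl (x, 3)) = -o.checker (.inl (x, 0)) :=
  (isAlternating_checker hD o).inl x

theorem colour_inl_two (σ : D.Comp → ℤˣ) (x : X) :
    o.colour σ (.inl (x, 2)) = -o.colour σ (.inl (x, 0)) := by
  have h := o.dir_straight (.inl (x, 0))
  simp only [Dart.straight, zero_add] at h
  simp [colour, comp_inl_two, (checker_inl hD x).2.1, h]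

theorem colour_inl_three (σ : D.Comp → ℤˣ) (x : X) :
    o.colour σ (.inl (x, 3)) = -o.colour σ (.inl (x, 1)) := by
  have h := o.dir_straight (.inl (x, 1))
  have e : (1 : ZMod 4) + 2 = 3 := by decide
  simp only [Dart.straight, e] at h
  simp [colour, comp_inl_three, (checker_inl hD x).2.2, (checker_inl hD x).1, h]

theorem colour_inr (σ : D.Comp → ℤˣ) (v : V) (i : ZMod 2) :
    o.colour σ (.inr (v, i + 1)) = o.colour σ (.inr (v, i)) := by
  have h := o.dir_straight (.inr (v, i))
  have h' := o.checker_rot hD (.inr (v, i))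
  have h'' := comp_straight (D := D) (.inr (v, i))
  simp only [Dart.straight, Dart.rot] at h h' h''
  simp [colour, h, h', h'']

variable {p : Dart X V}

theorem colour_base {σ : D.Comp → ℤˣ} :
    o.colour σ p = 1 ↔ σ (D.comp p) = o.baseSign p := by
  rw [baseSign, leftSign_eq hD o o, colour, mul_assoc, Int.units_mul_eq_one_iff]

theorem changeState_eq (σ : o.Change p) (x : X) :
    changeState σ x = o.colour σ.1 (.inl (x, 0)) * o.colour σ.1 (.inl (x, 1)) := by
  have h := o.dir_straight (.inl (x, 0))
  simp only [Dart.straight, zero_add] at h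
  simp only [changeState, sign, h, colour, (checker_inl hD x).1]
  have hc := Int.units_mul_self (o.checker (.inl (x, 0)))
  simp only [mul_neg, neg_mul]
  congr 1
  calc _ = o.dir (.inl (x, 1)) * o.dir (.inl (x, 0)) * σ.1 (D.comp (.inl (x, 0))) *
      σ.1 (D.comp (.inl (x, 1))) * 1 := by rw [mul_one]
    _ = _ := by rw [← hc]; ac_rfl

theorem colour_smooth_inl (σ : D.Comp → ℤˣ) (s : X → ℤˣ) (x : X) (i : ZMod 4) :
    o.colour σ (smooth s (.inl (x, i))) = s x * (o.colour σ (.inl (x, 0)) *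
      o.colour σ (.inl (x, 1))) * o.colour σ (.inl (x, i)) := by
  have h2 := colour_inl_two (o := o) hD σ x
  have h3 := colour_inl_three (o := o) hD σ x
  have hi : i = 0 ∨ i = 1 ∨ i = 2 ∨ i = 3 := by revert i; decide
  have e1 : (1 : ZMod 4) - 0 = 1 := by decide
  have e2 : (3 : ZMod 4) - 0 = 3 := by decide
  have e3 : (1 : ZMod 4) - 2 = 3 := by decide
  have e4 : (3 : ZMod 4) - 2 = 1 := by decide
  have e5 : (1 : ZMod 4) - 1 = 0 := by decide
  have e6 : (3 : ZMod 4) - 1 = 2 := by decide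
  have e7 : (1 : ZMod 4) - 3 = 2 := by decide
  have e8 : (3 : ZMod 4) - 3 = 0 := by decide
  have hne : ¬ ((-1 : ℤˣ) = 1) := by decide
  rcases Int.units_eq_one_or (s x) with hs | hs <;>
    rcases Int.units_eq_one_or (o.colour σ (.inl (x, 0))) with h0 | h0 <;>
    rcases Int.units_eq_one_or (o.colour σ (.inl (x, 1))) with h1 | h1 <;>
    rcases hi with rfl | rfl | rfl | rfl <;>
      simp only [smooth, hs, if_true, if_neg hne, e1, e2, e3, e4, e5, e6, e7, e8, h0, h1, h2, h3] <;>
      decide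

theorem colour_smooth (σ : o.Change p) (d : Dart X V) :
    o.colour σ.1 (smooth (changeState σ) d) = o.colour σ.1 d := by
  rcases d with ⟨x, i⟩ | ⟨v, i⟩
  · rw [colour_smooth_inl hD, changeState_eq hD, Int.units_mul_self, one_mul]
  · exact colour_inr hD _ _ _

theorem colour_eq_of_circ_eq (σ : o.Change p) {d d' : Dart X V}
    (h : D.circ (changeState σ) d = D.circ (changeState σ) d') :
    o.colour σ.1 d = o.colour σ.1 d' :=
  eq_of_circ_eq _ (colour_opp hD _) (colour_smooth hD _) h

theorem not_joined_changeState (σ : o.Change p) (x : X) : ¬ D.Joined (changeState σ) x := by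
  intro h
  have := colour_eq_of_circ_eq hD σ h
  rw [colour_inl_two hD] at this
  exact absurd this.symm (by
    rcases Int.units_eq_one_or (o.colour σ.1 (.inl (x, 0))) with h | h <;> rw [h] <;> decide)

theorem exists_colour_ne {σ : o.Change p} {s : X → ℤˣ} (h : changeState σ ≠ s) :
    ∃ d d', D.circ s d = D.circ s d' ∧ o.colour σ.1 d' = -o.colour σ.1 d := by
  obtain ⟨x, hx⟩ := Function.ne_iff.1 h
  refine ⟨.inl (x, 0), smooth s (.inl (x, 0)), (D.circ_smooth s _).symm, ?_⟩
  rw [colour_smooth_inl hD, ← changeState_eq hD, ← neg_eq_iff_eq_neg.2 (Int.units_ne_iff.1 hx)]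
  rcases Int.units_eq_one_or (changeState σ x) with h | h <;> simp [h]

theorem changeState_injective :
    Function.Injective (changeState : o.Change p → X → ℤˣ) := by
  intro σ σ' h
  have hx : ∀ x, o.colour σ.1 (.inl (x, 0)) * o.colour σ'.1 (.inl (x, 0)) =
      o.colour σ.1 (.inl (x, 1)) * o.colour σ'.1 (.inl (x, 1)) := fun x => by
    have := congrFun h x
    rw [changeState_eq hD, changeState_eq hD] at this
    rcases Int.units_eq_one_or (o.colour σ.1 (.inl (x, 0))) with h1 | h1 <;>
    rcases Int.units_eq_one_or (o.colour σ.1 (.inl (x, 1))) with h2 | h2 <;>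
    rcases Int.units_eq_one_or (o.colour σ'.1 (.inl (x, 0))) with h3 | h3 <;>
    rcases Int.units_eq_one_or (o.colour σ'.1 (.inl (x, 1))) with h4 | h4 <;>
    simp_all
  have hrot : ∀ d : Dart X V, o.colour σ.1 d.rot * o.colour σ'.1 d.rot =
      o.colour σ.1 d * o.colour σ'.1 d := by
    rintro (⟨x, i⟩ | ⟨v, i⟩)
    · have hi : i = 0 ∨ i = 1 ∨ i = 2 ∨ i = 3 := by revert i; decide
      have e1 : (1 : ZMod 4) + 1 = 2 := by decide
      have e2 : (2 : ZMod 4) + 1 = 3 := by decide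
      have e3 : (3 : ZMod 4) + 1 = 0 := by decide
      rcases hi with rfl | rfl | rfl | rfl <;>
        simp [Dart.rot, e1, e2, e3, colour_inl_two hD, colour_inl_three hD, hx]
    · simp [Dart.rot, colour_inr hD]
  have hc : ∀ d d', o.colour σ.1 d * o.colour σ'.1 d = o.colour σ.1 d' * o.colour σ'.1 d' := by
    intro d d'
    induction hD.eqvGen d d' with
    | rel a b h =>
      rcases h with rfl | rfl
      · rw [colour_opp hD, colour_opp hD]
      · exact (hrot a).symm
    | refl => rfl
    | symm _ _ _ h => exact h.symm
    | trans _ _ _ _ _ h h' => exact h.trans h'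
  apply Subtype.ext
  funext c
  obtain ⟨d, rfl⟩ : ∃ d, D.comp d = c := Quot.mk_surjective c
  have := hc d p
  rw [(colour_base hD).2 σ.2, (colour_base hD).2 σ'.2, one_mul, Int.units_mul_eq_one_iff] at this
  simpa [colour] using this

theorem circSign_eq (σ : o.Change p) (d : Dart X V) :
    circSign σ (D.circ _ d) = o.baseSign p * o.colour σ.1 d := by
  rw [circSign, leftSign_eq hD o]
  have h : o.colour σ.1 (Quot.out (D.circ (changeState σ) d)) = o.colour σ.1 d :=
    colour_eq_of_circ_eq hD σ (circ_out _)
  rw [← h]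
  simp only [change, colour, mul_assoc]

end Orientation

end LinkDiagram

open MvPolynomial (C)

namespace LinkDiagram

variable {X V F : Type} [Fintype X] [LinearOrder X] [Fintype V] [Fintype F]
variable {D : LinkDiagram X V F}

/-- Two surgeries at different crossings: if the first one changes the type of the second one,
both have the same type before and after, and the pairs of components at the two crossings agree in
the end. -/
theorem IsAlternating.joined_exchange {τ : Dart X V → ℤˣ} (h : D.IsAlternating τ) {s : X → ℤˣ}
    {x y : X} (hxy : ¬ (D.Joined s x ↔ D.Joined (flip s y) x)) :
    (D.Joined s y ↔ D.Joined s x) ∧ (D.Joined (flip s x) y ↔ D.Joined (flip s y) x) ∧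
    ((D.circ (flip (flip s x) y) (.inl (x, 0)) = D.circ (flip (flip s x) y) (.inl (y, 0)) ∧
      D.circ (flip (flip s x) y) (.inl (x, 2)) = D.circ (flip (flip s x) y) (.inl (y, 2))) ∨
    (D.circ (flip (flip s x) y) (.inl (x, 0)) = D.circ (flip (flip s x) y) (.inl (y, 2)) ∧
      D.circ (flip (flip s x) y) (.inl (x, 2)) = D.circ (flip (flip s x) y) (.inl (y, 0)))) := by
  have hx := h.joined_flip s x
  have hy := h.joined_flip s y
  have hxy' := h.joined_flip (flip s x) y
  have hyx := h.joined_flip (flip s y) x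
  rw [flip_comm s y x] at hyx
  by_cases hA : D.Joined s x
  · have hB : ¬ D.Joined (flip s y) x := fun e => hxy ⟨fun _ => e, fun _ => hA⟩
    have hsy : D.Joined s y := by
      by_contra hc
      exact hB (circ_flip_of_joined (hy.2 hc) hA)
    have hJ := hyx.2 hB
    have hpair : (D.circ (flip (flip s x) y) (.inl (x, 0)) =
          D.circ (flip (flip s x) y) (.inl (y, 0)) ∧
        D.circ (flip (flip s x) y) (.inl (x, 2)) = D.circ (flip (flip s x) y) (.inl (y, 2))) ∨
      (D.circ (flip (flip s x) y) (.inl (x, 0)) = D.circ (flip (flip s x) y) (.inl (y, 2)) ∧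
        D.circ (flip (flip s x) y) (.inl (x, 2)) = D.circ (flip (flip s x) y) (.inl (y, 0))) := by
      have hJ' := hJ
      rw [flip_comm s x y] at hJ' ⊢
      rcases circ_flip_or y hA with e | ⟨e1 | e1, e2 | e2⟩
      · exact absurd e hB
      · exact absurd (e1.trans e2.symm) hB
      · exact Or.inl ⟨circ_flip_of_joined hJ' e1, circ_flip_of_joined hJ' e2⟩
      · exact Or.inr ⟨circ_flip_of_joined hJ' e1, circ_flip_of_joined hJ' e2⟩
      · exact absurd (e1.trans e2.symm) hB
    refine ⟨⟨fun _ => hA, fun _ => hsy⟩, ?_, hpair⟩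
    have hJy : D.Joined (flip (flip s x) y) y := by
      unfold Joined at hJ ⊢
      rcases hpair with ⟨e1, e2⟩ | ⟨e1, e2⟩
      · rw [← e1, ← e2, hJ]
      · rw [← e1, ← e2, hJ]
    tauto
  · have hB : D.Joined (flip s y) x := by
      by_contra e
      exact hxy ⟨fun e' => absurd e' hA, fun e' => absurd e' e⟩
    have hsy : ¬ D.Joined s y := by
      intro hc
      have := circ_flip_of_joined (s := flip s y) (x := y) (by rwa [flip_flip]) hB
      rw [flip_flip] at this
      exact hA this
    have hnear := circ_flip_or y hB
    rw [flip_flip] at hnear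
    have hJx := hx.2 hA
    have c : ∀ {d d' : Dart X V}, D.circ s d = D.circ s d' →
      D.circ (flip s x) d = D.circ (flip s x) d' := circ_flip_of_joined hJx
    have hsxy : D.Joined (flip s x) y ∧
        D.circ (flip s x) (.inl (x, 0)) = D.circ (flip s x) (.inl (y, 0)) := by
      unfold Joined at hJx ⊢
      rcases hnear with e | ⟨e1 | e1, e2 | e2⟩
      · exact absurd e hA
      · exact absurd (e1.trans e2.symm) hA
      · rw [← c e1, ← c e2]
        exact ⟨hJx, rfl⟩
      · rw [← c e1, ← c e2]
        exact ⟨hJx.symm, hJx⟩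
      · exact absurd (e1.trans e2.symm) hA
    refine ⟨⟨fun e => absurd e hsy, fun e => absurd e hA⟩, ⟨fun _ => hB, fun _ => hsxy.1⟩, ?_⟩
    have hnot : ¬ D.Joined (flip (flip s x) y) x := by tauto
    have n0 : D.Near (flip (flip s x) y) y (.inl (x, 0)) := by
      rcases circ_flip_or y hsxy.2 with e | e
      · exact Or.inl e
      · exact e.1
    have n2 : D.Near (flip (flip s x) y) y (.inl (x, 2)) := by
      rcases circ_flip_or y (hJx.symm.trans hsxy.2) with e | e
      · exact Or.inl e
      · exact e.1
    rcases n0 with e1 | e1 <;> rcases n2 with e2 | e2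
    · exact absurd (e1.trans e2.symm) hnot
    · exact Or.inl ⟨e1, e2⟩
    · exact Or.inr ⟨e1, e2⟩
    · exact absurd (e1.trans e2.symm) hnot

theorem eq_of_comp_eq {α : Sort*} (f : Dart X V → α) (h1 : ∀ d, f (D.opp d) = f d)
    (h2 : ∀ d, f d.straight = f d) {d d' : Dart X V} (h : D.comp d = D.comp d') :
    f d = f d' :=
  congrArg (Quot.lift f (by
    rintro a b (rfl | rfl)
    · exact (h1 a).symm
    · exact (h2 a).symm)) h

theorem wedgeSign_eq_prod (s : X → ℤˣ) (x : X) :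
    wedgeSign s x = ∏ z ∈ Finset.univ.filter (· < x), s z := by
  rw [wedgeSign, ← Finset.prod_const, Finset.prod_filter, Finset.prod_filter]
  refine Finset.prod_congr rfl fun z _ => ?_
  rcases Int.units_eq_one_or (s z) with h | h <;> simp [h]

theorem wedgeSign_flip_of_lt (s : X → ℤˣ) {x y : X} (h : y < x) :
    wedgeSign (flip s y) x = -wedgeSign s x := by
  have hy : y ∈ Finset.univ.filter (· < x) := by simpa using h
  rw [wedgeSign_eq_prod, wedgeSign_eq_prod, flip, Finset.prod_update_of_mem hy, neg_mul,
    ← Finset.mul_prod_erase _ _ hy, Finset.sdiff_singleton_eq_erase]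

theorem wedgeSign_flip_of_le (s : X → ℤˣ) {x y : X} (h : x ≤ y) :
    wedgeSign (flip s y) x = wedgeSign s x := by
  have hy : y ∉ Finset.univ.filter (· < x) := by simpa using h
  rw [wedgeSign_eq_prod, wedgeSign_eq_prod, flip, Finset.prod_update_of_notMem hy]

/-- The coefficients of the surgeries at `x` towards the states of value `e` at `x` in the
differential. -/
def wedgeFun (e : ℤˣ) (x : X) (s : X → ℤˣ) : ℤ := if s x = e then (wedgeSign s x : ℤ) else 0

theorem wedgeFun_anticomm (e e' : ℤˣ) {x y : X} (h : x ≠ y) :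
    ((wedgeFun e x * fun s => wedgeFun e' y (flip s x)) : (X → ℤˣ) → ℤ) =
      -(wedgeFun e' y * fun s => wedgeFun e x (flip s y)) := by
  wlog hlt : x < y generalizing x y e e'
  · have := this e' e h.symm (lt_of_le_of_ne (not_lt.1 hlt) h.symm)
    rw [this, neg_neg]
  funext s
  simp only [wedgeFun, Pi.mul_apply, Pi.neg_apply, flip_of_ne s h, flip_of_ne s h.symm,
    wedgeSign_flip_of_lt s hlt, wedgeSign_flip_of_le s hlt.le]
  split_ifs <;> simp
  ring

theorem wedgeFun_mul_self (e : ℤˣ) (x : X) :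
    ((wedgeFun e x * fun s => wedgeFun e x (flip s x)) : (X → ℤˣ) → ℤ) = 0 := by
  funext s
  simp only [wedgeFun, Pi.mul_apply, flip_same, Pi.zero_apply]
  rcases Int.units_eq_one_or (s x) with h | h <;> rcases Int.units_eq_one_or e with h' | h' <;>
    simp [h, h']

theorem wedgeFun_mul_neg (x : X) :
    ((wedgeFun (-1) x * fun s => wedgeFun 1 x (flip s x)) +
      wedgeFun 1 x * fun s => wedgeFun (-1) x (flip s x) : (X → ℤˣ) → ℤ) = 1 := by
  funext s
  have hsq : (wedgeSign s x : ℤ) * (wedgeSign s x : ℤ) = 1 := by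
    rw [← Units.val_mul, Int.units_mul_self]
    rfl
  simp only [wedgeFun, Pi.mul_apply, Pi.add_apply, flip_same, wedgeSign_flip_of_le s le_rfl,
    Pi.one_apply]
  rcases Int.units_eq_one_or (s x) with h | h <;> simp [h, hsq]

end LinkDiagram

open MvPolynomial (C)

namespace LinkDiagram

variable {X V F : Type} [Fintype X] [LinearOrder X] [Fintype V] [Fintype F]
variable {D : LinkDiagram X V F}

/-- The value of the variable of an edge of a given colour. -/
def colourValue {B : Type*} [CommRing B] (κ : B) (a : ℤˣ) : B := if a = 1 then 0 else -κ

theorem colourValue_mul {B : Type*} [CommRing B] (κ : B) (a : ℤˣ) :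
    colourValue κ a * colourValue κ a = -(κ * colourValue κ a) := by
  unfold colourValue
  split_ifs <;> ring

theorem colourValue_neg {B : Type*} [CommRing B] (κ : B) (a : ℤˣ) :
    colourValue κ (-a) = -κ - colourValue κ a := by
  rcases Int.units_eq_one_or a with rfl | rfl <;> simp [colourValue]

theorem colourValue_sub_neg {B : Type*} [CommRing B] (κ : B) (a : ℤˣ) :
    colourValue κ a - colourValue κ (-a) = ((a : ℤ) : B) * κ := by
  rcases Int.units_eq_one_or a with rfl | rfl <;> simp [colourValue]

/-- A cube of surgeries over the states of a diagram: all the modules of the cube are generated by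
elements `one s` over operators `rep (X d)`, one for each half-edge, which have square `-κ` times
themselves, and the surgeries are determined by their values at `one s`. -/
structure CubeModel (o : D.Orientation) (p : Dart X V) (B M : Type*) [CommRing B] [AddCommGroup M]
    [Module B M] where
  part : ((X → ℤˣ) → ℤ) →+* Module.End B M
  rep : MvPolynomial (Dart X V) B →ₐ[B] Module.End B M
  surg : X → Module.End B M
  one : (X → ℤˣ) → M
  proj : M →ₗ[B] (o.Change p → B)
  κ : B
  u₀ : B
  u₁ : B
  v₀ : B
  v₁ : B
  sgn : o.Change p → ℤˣ
  part_rep : ∀ f d, part f * rep (.X d) = rep (.X d) * part f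
  surg_part : ∀ x f, surg x * part f = part (fun s => f (flip s x)) * surg x
  part_one : ∀ f s, part f (one s) = f s • one s
  surg_rep : ∀ x d, surg x * rep (.X d) = rep (.X d) * surg x
  rep_circ : ∀ s d d', D.circ s d = D.circ s d' → rep (.X d) (one s) = rep (.X d') (one s)
  rep_sq : ∀ d, rep (.X d) * rep (.X d) = -(κ • rep (.X d))
  rep_base : rep (.X p) = 0
  surg_one_joined : ∀ s x, D.Joined s x → surg x (one s) =
    rep ((C u₀ + C u₁ * .X (.inl (x, 0))) * (C κ + .X (.inl (x, 0)) + .X (.inl (x, 2))))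
      (one (flip s x))
  surg_one : ∀ s x, ¬ D.Joined s x → surg x (one s) = one (flip s x)
  span : ∀ N : Submodule B M, (∀ s, one s ∈ N) → (∀ d, ∀ v ∈ N, rep (.X d) v ∈ N) → N = ⊤
  unit₀ : u₀ * v₀ = 1
  unit₁ : u₀ * v₁ + u₁ * v₀ = κ * (u₁ * v₁)
  proj_rep : ∀ d v σ, proj (rep (.X d) v) σ = colourValue κ (o.colour σ.1 d) * proj v σ
  proj_one : ∀ s σ, proj (one s) σ = if Orientation.changeState σ = s then ((sgn σ : ℤ) : B) else 0

namespace CubeModel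

variable {o : D.Orientation} {p : Dart X V} {B M : Type*} [CommRing B] [AddCommGroup M] [Module B M]
variable (Q : CubeModel o p B M)

theorem hom_ext {M' : Type*} [AddCommGroup M'] [Module B M'] {f g : M →ₗ[B] M'}
    (h1 : ∀ s, f (Q.one s) = g (Q.one s))
    (h2 : ∀ d v, f v = g v → f (Q.rep (.X d) v) = g (Q.rep (.X d) v)) : f = g := by
  have h := Q.span (LinearMap.eqLocus f g) h1 h2
  ext v
  have : v ∈ LinearMap.eqLocus f g := by rw [h]; trivial
  exact this

theorem end_ext {f g : Module.End B M} (h1 : ∀ s, f (Q.one s) = g (Q.one s))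
    (hf : ∀ d, f * Q.rep (.X d) = Q.rep (.X d) * f)
    (hg : ∀ d, g * Q.rep (.X d) = Q.rep (.X d) * g) : f = g := by
  refine Q.hom_ext h1 fun d v hv => ?_
  have hf' := LinearMap.congr_fun (hf d) v
  have hg' := LinearMap.congr_fun (hg d) v
  simp only [Module.End.mul_apply] at hf' hg'
  rw [hf', hg', hv]

theorem commute_rep {S : Module.End B M} (h : ∀ d, S * Q.rep (.X d) = Q.rep (.X d) * S)
    (f : MvPolynomial (Dart X V) B) : S * Q.rep f = Q.rep f * S := by
  induction f using MvPolynomial.induction_on with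
  | C a =>
    rw [← MvPolynomial.algebraMap_eq, AlgHom.commutes]
    exact (Algebra.commutes a S).symm
  | add f g hf hg => rw [map_add, mul_add, add_mul, hf, hg]
  | mul_X f d hf => rw [map_mul, ← mul_assoc, hf, mul_assoc, h, mul_assoc]

theorem rep_comm (f g : MvPolynomial (Dart X V) B) : Q.rep f * Q.rep g = Q.rep g * Q.rep f := by
  rw [← map_mul, mul_comm, map_mul]

theorem surg_comm_rep (x : X) (f : MvPolynomial (Dart X V) B) :
    Q.surg x * Q.rep f = Q.rep f * Q.surg x := Q.commute_rep (Q.surg_rep x) f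

theorem part_comm_rep (a : (X → ℤˣ) → ℤ) (f : MvPolynomial (Dart X V) B) :
    Q.part a * Q.rep f = Q.rep f * Q.part a := Q.commute_rep (Q.part_rep a) f

theorem rep_C (a : B) : Q.rep (C a) = a • (1 : Module.End B M) := by
  rw [← MvPolynomial.algebraMap_eq, AlgHom.commutes, Algebra.algebraMap_eq_smul_one]

theorem rep_X_eq {d d' : Dart X V} (h : ∀ s, D.circ s d = D.circ s d') :
    Q.rep (.X d) = Q.rep (.X d') :=
  Q.end_ext (fun s => Q.rep_circ s d d' (h s)) (fun _ => Q.rep_comm _ _) fun _ => Q.rep_comm _ _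

/-- The polynomials which annihilate `one s`. -/
def annOne (s : X → ℤˣ) : Ideal (MvPolynomial (Dart X V) B) where
  carrier := {f | Q.rep f (Q.one s) = 0}
  add_mem' {f g} hf hg := by
    change Q.rep (f + g) (Q.one s) = 0
    rw [map_add, LinearMap.add_apply, hf, hg, add_zero]
  zero_mem' := by simp
  smul_mem' f g hg := by
    change Q.rep (f * g) (Q.one s) = 0
    rw [map_mul, Module.End.mul_apply, hg, map_zero]

theorem rep_one_eq_iff {s : X → ℤˣ} {f g : MvPolynomial (Dart X V) B} :
    Q.rep f (Q.one s) = Q.rep g (Q.one s) ↔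
      Ideal.Quotient.mk (Q.annOne s) f = Ideal.Quotient.mk (Q.annOne s) g := by
  rw [Ideal.Quotient.eq]
  change _ ↔ Q.rep (f - g) (Q.one s) = 0
  rw [map_sub, LinearMap.sub_apply, sub_eq_zero]

theorem quot_sq (s : X → ℤˣ) (d : Dart X V) :
    Ideal.Quotient.mk (Q.annOne s) (.X d) * Ideal.Quotient.mk (Q.annOne s) (.X d) =
      -(Ideal.Quotient.mk (Q.annOne s) (C Q.κ) * Ideal.Quotient.mk (Q.annOne s) (.X d)) := by
  rw [← map_mul, ← map_mul, ← map_neg, ← rep_one_eq_iff, map_mul, Q.rep_sq, map_neg, map_mul,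
    Q.rep_C, smul_mul_assoc, one_mul]

/-- The factor `κ + y₀ + y₂` of the value of the surgeries which split a component. -/
def crossFactor (x : X) : MvPolynomial (Dart X V) B :=
  C Q.κ + .X (.inl (x, 0)) + .X (.inl (x, 2))

/-- The value of the surgeries which split a component. -/
def splitFactor (x : X) : MvPolynomial (Dart X V) B :=
  (C Q.u₀ + C Q.u₁ * .X (.inl (x, 0))) * Q.crossFactor x

theorem splitFactor_eq {s : X → ℤˣ} {x y : X}
    (h : (D.circ s (.inl (x, 0)) = D.circ s (.inl (y, 0)) ∧
      D.circ s (.inl (x, 2)) = D.circ s (.inl (y, 2))) ∨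
    (D.circ s (.inl (x, 0)) = D.circ s (.inl (y, 2)) ∧
      D.circ s (.inl (x, 2)) = D.circ s (.inl (y, 0)))) :
    Q.rep (Q.splitFactor x) (Q.one s) = Q.rep (Q.splitFactor y) (Q.one s) := by
  rw [rep_one_eq_iff]
  simp only [splitFactor, crossFactor, map_mul, map_add]
  rcases h with ⟨h0, h2⟩ | ⟨h0, h2⟩
  · rw [Q.rep_one_eq_iff.1 (Q.rep_circ _ _ _ h0), Q.rep_one_eq_iff.1 (Q.rep_circ _ _ _ h2)]
  · rw [Q.rep_one_eq_iff.1 (Q.rep_circ _ _ _ h0), Q.rep_one_eq_iff.1 (Q.rep_circ _ _ _ h2)]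
    have e0 := Q.quot_sq s (.inl (y, 0))
    have e2 := Q.quot_sq s (.inl (y, 2))
    linear_combination (Ideal.Quotient.mk (Q.annOne s) (C Q.u₁)) * (e2 - e0)

theorem surg_one_eq (s : X → ℤˣ) (x : X) : Q.surg x (Q.one s) =
    Q.rep (if D.Joined s x then Q.splitFactor x else 1) (Q.one (flip s x)) := by
  split_ifs with h
  · exact Q.surg_one_joined s x h
  · rw [map_one]
    exact Q.surg_one s x h

theorem surg_rep_apply (x : X) (f : MvPolynomial (Dart X V) B) (v : M) :
    Q.surg x (Q.rep f v) = Q.rep f (Q.surg x v) := LinearMap.congr_fun (Q.surg_comm_rep x f) v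

variable (hD : D.Connected)
include hD

theorem surg_sq (x : X) : Q.surg x * Q.surg x = Q.rep (Q.splitFactor x) := by
  refine Q.end_ext (fun s => ?_) (fun d => ?_) fun d => Q.rep_comm _ _
  · rw [Module.End.mul_apply, surg_one_eq, surg_rep_apply, surg_one_eq, flip_flip,
      ← Module.End.mul_apply, ← map_mul]
    have := (isAlternating_checker hD o).joined_flip s x
    by_cases h : D.Joined s x
    · rw [if_pos h, if_neg (by tauto), mul_one]
    · rw [if_neg h, if_pos (by tauto), one_mul]
  · rw [mul_assoc, Q.surg_rep, ← mul_assoc, Q.surg_rep, mul_assoc]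

theorem surg_surg_one (s : X → ℤˣ) (x y : X) :
    Q.surg x (Q.surg y (Q.one s)) = Q.surg y (Q.surg x (Q.one s)) := by
  rw [surg_one_eq, surg_one_eq, surg_rep_apply, surg_rep_apply, surg_one_eq, surg_one_eq,
    ← Module.End.mul_apply, ← Module.End.mul_apply, ← map_mul, ← map_mul, flip_comm s y x]
  by_cases hxy : D.Joined s x ↔ D.Joined (flip s y) x
  · by_cases hyx : D.Joined s y ↔ D.Joined (flip s x) y
    · simp only [hxy, hyx]
      rw [mul_comm]
    · obtain ⟨h1, h2, -⟩ := (isAlternating_checker hD o).joined_exchange hyx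
      tauto
  · obtain ⟨h1, h2, h3⟩ := (isAlternating_checker hD o).joined_exchange hxy
    have := Q.splitFactor_eq h3
    by_cases h : D.Joined s x
    · have hn : ¬ D.Joined (flip s y) x := by tauto
      rw [if_pos h, if_pos (h1.2 h), if_neg hn, if_neg (by tauto), mul_one, mul_one]
      exact this.symm
    · have hn : D.Joined (flip s y) x := by tauto
      rw [if_neg h, if_neg (by tauto), if_pos hn, if_pos (by tauto), one_mul, one_mul]
      exact this

theorem surg_comm (x y : X) : Q.surg x * Q.surg y = Q.surg y * Q.surg x := by
  refine Q.end_ext (fun s => Q.surg_surg_one hD s x y) (fun d => ?_) fun d => ?_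
  · rw [mul_assoc, Q.surg_rep, ← mul_assoc, Q.surg_rep, mul_assoc]
  · rw [mul_assoc, Q.surg_rep, ← mul_assoc, Q.surg_rep, mul_assoc]

omit hD

/-- The component at `x` of the differential (for `e = -1`) and of its homotopy inverse (for
`e = 1`). -/
def edge (e : ℤˣ) (x : X) : Module.End B M := Q.part (wedgeFun e x) * Q.surg x

/-- The differential of the cube. -/
def diff : Module.End B M := ∑ x, Q.edge (-1) x

theorem edge_mul (e e' : ℤˣ) (x y : X) : Q.edge e x * Q.edge e' y =
    Q.part (wedgeFun e x * fun s => wedgeFun e' y (flip s x)) * (Q.surg x * Q.surg y) := by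
  rw [edge, edge, mul_assoc, ← mul_assoc (Q.surg x), Q.surg_part, map_mul]
  simp only [mul_assoc]

theorem edge_comm_rep (e : ℤˣ) (x : X) (f : MvPolynomial (Dart X V) B) :
    Q.edge e x * Q.rep f = Q.rep f * Q.edge e x := by
  rw [edge, mul_assoc, surg_comm_rep, ← mul_assoc, part_comm_rep, mul_assoc]

theorem diff_comm_rep (f : MvPolynomial (Dart X V) B) :
    Q.diff * Q.rep f = Q.rep f * Q.diff := by
  simp only [diff, Finset.sum_mul, Finset.mul_sum, edge_comm_rep]

include hD

theorem edge_anticomm (e e' : ℤˣ) {x y : X} (h : x ≠ y) :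
    Q.edge e x * Q.edge e' y = -(Q.edge e' y * Q.edge e x) := by
  rw [edge_mul, edge_mul, wedgeFun_anticomm e e' h, Q.surg_comm hD x y, map_neg, neg_mul]

theorem diff_sq : Q.diff * Q.diff = 0 := by
  have h : ∀ x y, Q.edge (-1) x * Q.edge (-1) y = -(Q.edge (-1) y * Q.edge (-1) x) := fun x y => by
    by_cases hxy : x = y
    · subst hxy
      rw [edge_mul, wedgeFun_mul_self, map_zero, zero_mul, neg_zero]
    · exact Q.edge_anticomm hD _ _ hxy
  have h2 : ∑ x, ∑ y, Q.edge (-1) x * Q.edge (-1) y = 0 := by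
    rw [← Finset.sum_product']
    refine Finset.sum_involution (fun a _ => (a.2, a.1)) ?_ ?_ ?_ ?_
    · intro a _
      rw [h a.1 a.2]
      simp
    · rintro ⟨x, y⟩ - hne he
      obtain rfl : x = y := by
        have := congrArg Prod.fst he
        exact this.symm
      refine hne ?_
      rw [edge_mul, wedgeFun_mul_self, map_zero, zero_mul]
    · simp
    · simp
  rw [diff, Finset.sum_mul_sum]
  exact h2

theorem diff_edge (x : X) : Q.diff * Q.edge 1 x + Q.edge 1 x * Q.diff =
    Q.rep (Q.splitFactor x) := by
  rw [diff, Finset.sum_mul, Finset.mul_sum, ← Finset.sum_add_distrib,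
    Finset.sum_eq_single x]
  · rw [edge_mul, edge_mul, ← add_mul, ← map_add, wedgeFun_mul_neg, map_one, one_mul, Q.surg_sq hD]
  · intro y _ hy
    rw [Q.edge_anticomm hD (-1) 1 hy, neg_add_cancel]
  · simp

omit hD

theorem proj_rep_eval (f : MvPolynomial (Dart X V) B) (v : M) (σ : o.Change p) :
    Q.proj (Q.rep f v) σ =
      MvPolynomial.eval (fun d => colourValue Q.κ (o.colour σ.1 d)) f * Q.proj v σ := by
  induction f using MvPolynomial.induction_on generalizing v with
  | C a => simp [Q.rep_C]
  | add f g hf hg =>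
    rw [map_add, LinearMap.add_apply, map_add, Pi.add_apply, hf, hg, map_add, add_mul]
  | mul_X f d hf =>
    rw [map_mul, Module.End.mul_apply, hf, Q.proj_rep, map_mul, MvPolynomial.eval_X, mul_assoc]

theorem proj_part (a : (X → ℤˣ) → ℤ) (v : M) (σ : o.Change p) :
    Q.proj (Q.part a v) σ = ((a (Orientation.changeState σ) : ℤ) : B) * Q.proj v σ := by
  have h : (LinearMap.proj σ : (o.Change p → B) →ₗ[B] B) ∘ₗ Q.proj ∘ₗ Q.part a =
      ((a (Orientation.changeState σ) : ℤ) : B) • ((LinearMap.proj σ : (o.Change p → B) →ₗ[B] B) ∘ₗ Q.proj) := by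
    refine Q.hom_ext (fun s => ?_) fun d v hv => ?_
    · simp only [LinearMap.comp_apply, LinearMap.smul_apply, LinearMap.proj_apply, Q.part_one,
        map_zsmul, Q.proj_one]
      simp only [smul_eq_mul, zsmul_eq_mul]
      split_ifs with hs
      · rw [hs]
      · simp
    · have hc := LinearMap.congr_fun (Q.part_rep a d) v
      simp only [Module.End.mul_apply] at hc
      simp only [LinearMap.comp_apply, LinearMap.smul_apply, LinearMap.proj_apply] at hv ⊢
      rw [hc, Q.proj_rep, hv, Q.proj_rep]
      simp only [smul_eq_mul]
      ring
  exact LinearMap.congr_fun h v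

include hD

theorem proj_surg (x : X) (v : M) : Q.proj (Q.surg x v) = 0 := by
  have h : Q.proj ∘ₗ Q.surg x = 0 := by
    refine Q.hom_ext (fun s => ?_) fun d v hv => ?_
    · funext σ
      rw [LinearMap.comp_apply, surg_one_eq, proj_rep_eval, Q.proj_one]
      simp only [LinearMap.zero_apply, Pi.zero_apply]
      split_ifs with h1 h2 h2
      · rw [splitFactor, crossFactor]
        simp [Orientation.colour_inl_two hD, colourValue_neg]
      · simp
      · refine absurd (Orientation.not_joined_changeState hD σ x) (not_not.2 ?_)
        rw [h2]
        exact ((isAlternating_checker hD o).joined_flip s x).2 h1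
      · simp
    · simp only [LinearMap.comp_apply, LinearMap.zero_apply] at hv ⊢
      rw [surg_rep_apply]
      funext σ
      rw [Q.proj_rep, hv]
      simp
  exact LinearMap.congr_fun h v

theorem proj_diff (v : M) : Q.proj (Q.diff v) = 0 := by
  simp only [diff, LinearMap.sum_apply, map_sum]
  refine Finset.sum_eq_zero fun x _ => ?_
  funext σ
  rw [edge, Module.End.mul_apply, Q.proj_part, Q.proj_surg hD]
  simp

theorem proj_surjective : Function.Surjective Q.proj := by
  intro w
  refine ⟨∑ σ, (w σ * ((Q.sgn σ : ℤ) : B)) • Q.one (Orientation.changeState σ), ?_⟩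
  funext τ
  rw [map_sum, Finset.sum_apply, Finset.sum_eq_single τ]
  · have : ((Q.sgn τ : ℤ) : B) * ((Q.sgn τ : ℤ) : B) = 1 := by
      rw [← Int.cast_mul, ← Units.val_mul, Int.units_mul_self]
      simp
    rw [map_smul, Pi.smul_apply, Q.proj_one, if_pos rfl, smul_eq_mul, mul_assoc, this, mul_one]
  · intro σ _ hσ
    rw [map_smul, Pi.smul_apply, Q.proj_one,
      if_neg fun e => hσ (Orientation.changeState_injective hD e).symm, smul_zero]
  · simp

omit hD

/-- The factor of `Θ` and `η` at a half-edge. -/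
def factorAt (σ : D.Comp → ℤˣ) (d : Dart X V) : MvPolynomial (Dart X V) B :=
  .X d - C (colourValue Q.κ (-o.colour σ d))

/-- The product over all half-edges which is supported on the colouring of `σ`. -/
def allFactor (σ : D.Comp → ℤˣ) : MvPolynomial (Dart X V) B := ∏ d, Q.factorAt σ d

/-- The product over the components of the link which is supported, up to homotopy, on the
colouring of `σ`. -/
def compFactor (σ : D.Comp → ℤˣ) : MvPolynomial (Dart X V) B :=
  ∏ k : D.Comp, Q.factorAt σ (Quot.out k)

theorem rep_X_sub_mul (d : Dart X V) (a : ℤˣ) :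
    Q.rep ((.X d - C (colourValue Q.κ a)) * (.X d - C (colourValue Q.κ (-a)))) = 0 := by
  have h : (.X d - C (colourValue Q.κ a)) * (.X d - C (colourValue Q.κ (-a))) =
      (.X d * .X d + C Q.κ * .X d : MvPolynomial (Dart X V) B) := by
    have := congrArg (C : B → MvPolynomial (Dart X V) B) (colourValue_mul Q.κ a)
    rw [colourValue_neg]
    simp only [map_sub, map_neg, map_mul] at this ⊢
    linear_combination -this
  rw [h, map_add, map_mul, Q.rep_sq, map_mul, Q.rep_C, smul_mul_assoc, one_mul, neg_add_cancel]

theorem rep_mul_eq_zero_of_dvd {f g : MvPolynomial (Dart X V) B} (h : f ∣ g) (hf : Q.rep f = 0) :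
    Q.rep g = 0 := by
  obtain ⟨q, rfl⟩ := h
  rw [map_mul, hf, zero_mul]

theorem X_mul_allFactor (σ : D.Comp → ℤˣ) (d : Dart X V) :
    Q.rep (.X d * Q.allFactor σ) = colourValue Q.κ (o.colour σ d) • Q.rep (Q.allFactor σ) := by
  have : Q.rep ((.X d - C (colourValue Q.κ (o.colour σ d))) * Q.allFactor σ) = 0 := by
    refine Q.rep_mul_eq_zero_of_dvd (mul_dvd_mul_left _ ?_)
      (Q.rep_X_sub_mul d (o.colour σ d))
    exact Finset.dvd_prod_of_mem (Q.factorAt σ) (Finset.mem_univ d)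
  rw [sub_mul, map_sub, sub_eq_zero] at this
  rw [this, map_mul, Q.rep_C, smul_mul_assoc, one_mul]

include hD

theorem allFactor_apply (σ : o.Change p) (v : M) :
    Q.rep (Q.allFactor σ.1) v =
      (Q.proj v σ * ((Q.sgn σ : ℤ) : B)) • Q.rep (Q.allFactor σ.1) (Q.one (Orientation.changeState σ)) := by
  let g : M →ₗ[B] M := LinearMap.smulRight
    ((LinearMap.proj σ : (o.Change p → B) →ₗ[B] B) ∘ₗ Q.proj)
    (((Q.sgn σ : ℤ) : B) • Q.rep (Q.allFactor σ.1) (Q.one (Orientation.changeState σ)))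
  have h : Q.rep (Q.allFactor σ.1) = g := by
    refine Q.hom_ext (fun s => ?_) fun d v hv => ?_
    · simp only [g, LinearMap.smulRight_apply, LinearMap.comp_apply, LinearMap.proj_apply,
        Q.proj_one]
      split_ifs with hs
      · have : ((Q.sgn σ : ℤ) : B) * ((Q.sgn σ : ℤ) : B) = 1 := by
          rw [← Int.cast_mul, ← Units.val_mul, Int.units_mul_self]
          simp
        rw [smul_smul, this, one_smul, hs]
      · rw [zero_smul]
        obtain ⟨d, d', hc, hcol⟩ := Orientation.exists_colour_ne hD hs
        have hne : d ≠ d' := by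
          rintro rfl
          revert hcol
          rcases Int.units_eq_one_or (o.colour σ.1 d) with h | h <;> rw [h] <;> decide
        have hdvd : Q.factorAt σ.1 d * Q.factorAt σ.1 d' ∣ Q.allFactor σ.1 := by
          rw [← Finset.prod_pair hne]
          exact Finset.prod_dvd_prod_of_subset _ _ _ (Finset.subset_univ _)
        obtain ⟨q, hq⟩ := hdvd
        have h0 : Q.rep (Q.factorAt σ.1 d * Q.factorAt σ.1 d') (Q.one s) = 0 := by
          have h1 : Q.rep (Q.factorAt σ.1 d') (Q.one s) =
              Q.rep (.X d - C (colourValue Q.κ (o.colour σ.1 d))) (Q.one s) := by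
            rw [factorAt, hcol, neg_neg, map_sub, map_sub, LinearMap.sub_apply,
              LinearMap.sub_apply, Q.rep_circ s d d' hc]
          rw [map_mul, Module.End.mul_apply, h1, ← Module.End.mul_apply, ← map_mul, mul_comm,
            factorAt, Q.rep_X_sub_mul, LinearMap.zero_apply]
        rw [hq, mul_comm, map_mul, Module.End.mul_apply, h0, map_zero]
    · rw [← Module.End.mul_apply, ← map_mul, mul_comm, Q.X_mul_allFactor, LinearMap.smul_apply, hv]
      simp only [g, LinearMap.smulRight_apply, LinearMap.comp_apply, LinearMap.proj_apply,
        Q.proj_rep, smul_smul, mul_assoc]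
  have := LinearMap.congr_fun h v
  simpa only [g, LinearMap.smulRight_apply, LinearMap.comp_apply, LinearMap.proj_apply,
    smul_smul] using this

omit hD

theorem eval_allFactor (σ : D.Comp → ℤˣ) (τ : D.Comp → ℤˣ) :
    MvPolynomial.eval (fun d => colourValue Q.κ (o.colour τ d)) (Q.allFactor σ) =
      if σ = τ then ((((∏ d, o.colour σ d : ℤˣ) : ℤ) : B)) *
        Q.κ ^ Fintype.card (Dart X V) else 0 := by
  rw [allFactor, map_prod]
  simp only [factorAt, map_sub, MvPolynomial.eval_X, MvPolynomial.eval_C]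
  split_ifs with h
  · subst h
    simp only [colourValue_sub_neg, Finset.prod_mul_distrib, Finset.prod_const, Finset.card_univ]
    congr 1
    push_cast
    rfl
  · obtain ⟨k, hk⟩ := Function.ne_iff.1 h
    refine Finset.prod_eq_zero (Finset.mem_univ (Quot.out k)) ?_
    have : D.comp (Quot.out k) = k := Quot.out_eq k
    simp only [Orientation.colour, this, Int.units_ne_iff.1 hk]
    simp

end CubeModel

end LinkDiagram

open MvPolynomial (C)

/-! ### Homogeneous operators and null-homotopies -/

section Homogeneous

variable {B M G : Type*} [CommRing B] [AddCommGroup M] [Module B M] [AddCommGroup G]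

/-- The operator `S` is homogeneous of degree `g`. -/
def IsHomogeneousEnd (𝓜 : G → AddSubgroup M) (g : G) (S : Module.End B M) : Prop :=
  ∀ n, Set.MapsTo S (𝓜 n) (𝓜 (n + g))

namespace IsHomogeneousEnd

variable {𝓜 : G → AddSubgroup M} {g g' : G} {S S' : Module.End B M}

theorem add (h : IsHomogeneousEnd 𝓜 g S) (h' : IsHomogeneousEnd 𝓜 g S') :
    IsHomogeneousEnd 𝓜 g (S + S') := fun n _ hv => add_mem (h n hv) (h' n hv)

theorem neg (h : IsHomogeneousEnd 𝓜 g S) : IsHomogeneousEnd 𝓜 g (-S) :=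
  fun n _ hv => neg_mem (h n hv)

theorem sub (h : IsHomogeneousEnd 𝓜 g S) (h' : IsHomogeneousEnd 𝓜 g S') :
    IsHomogeneousEnd 𝓜 g (S - S') := fun n _ hv => sub_mem (h n hv) (h' n hv)

theorem zero : IsHomogeneousEnd 𝓜 g (0 : Module.End B M) := fun _ _ _ => zero_mem _

theorem one : IsHomogeneousEnd 𝓜 0 (1 : Module.End B M) := fun n v hv => by
  simpa using hv

theorem mul (h : IsHomogeneousEnd 𝓜 g S) (h' : IsHomogeneousEnd 𝓜 g' S') :
    IsHomogeneousEnd 𝓜 (g + g') (S * S') := fun n v hv => by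
  have := h (n + g') (h' n hv)
  rwa [add_assoc, add_comm g' g] at this

theorem pow (h : IsHomogeneousEnd 𝓜 g S) (n : ℕ) : IsHomogeneousEnd 𝓜 (n • g) (S ^ n) := by
  induction n with
  | zero => simpa using one
  | succ n ih =>
    rw [pow_succ, succ_nsmul]
    exact ih.mul h

theorem sum {ι : Type*} {s : Finset ι} {f : ι → Module.End B M}
    (h : ∀ i ∈ s, IsHomogeneousEnd 𝓜 g (f i)) : IsHomogeneousEnd 𝓜 g (∑ i ∈ s, f i) := by
  induction s using Finset.induction_on with
  | empty => simpa using zero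
  | insert a s ha ih =>
    rw [Finset.sum_insert ha]
    exact (h _ (Finset.mem_insert_self _ _)).add
      (ih fun i hi => h i (Finset.mem_insert_of_mem hi))

theorem intSmul (h : IsHomogeneousEnd 𝓜 g S) (a : ℤ) : IsHomogeneousEnd 𝓜 g (a • S) :=
  fun n _ hv => zsmul_mem (h n hv) a

end IsHomogeneousEnd

/-- The operator `S` of degree `g` is null-homotopic, for the differential `d` of degree `e`. -/
def IsNullHomotopic (𝓜 : G → AddSubgroup M) (e : G) (d : Module.End B M) (g : G)
    (S : Module.End B M) : Prop :=
  ∃ k, IsHomogeneousEnd 𝓜 (g - e) k ∧ d * k + k * d = S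

namespace IsNullHomotopic

variable {𝓜 : G → AddSubgroup M} {e g g' : G} {d S S' : Module.End B M}

theorem add (h : IsNullHomotopic 𝓜 e d g S) (h' : IsNullHomotopic 𝓜 e d g S') :
    IsNullHomotopic 𝓜 e d g (S + S') := by
  obtain ⟨k, hk, rfl⟩ := h
  obtain ⟨k', hk', rfl⟩ := h'
  exact ⟨k + k', hk.add hk', by rw [mul_add, add_mul]; abel⟩

theorem neg (h : IsNullHomotopic 𝓜 e d g S) : IsNullHomotopic 𝓜 e d g (-S) := by
  obtain ⟨k, hk, rfl⟩ := h
  exact ⟨-k, hk.neg, by rw [mul_neg, neg_mul]; abel⟩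

theorem zero : IsNullHomotopic 𝓜 e d g 0 := ⟨0, IsHomogeneousEnd.zero, by simp⟩

theorem mul_left (h : IsNullHomotopic 𝓜 e d g S) (hS : d * S' = S' * d)
    (hS' : IsHomogeneousEnd 𝓜 g' S') : IsNullHomotopic 𝓜 e d (g' + g) (S' * S) := by
  obtain ⟨k, hk, rfl⟩ := h
  refine ⟨S' * k, ?_, ?_⟩
  · rw [add_sub_assoc]
    exact hS'.mul hk
  · rw [← mul_assoc, hS, mul_add]
    simp only [mul_assoc]

end IsNullHomotopic

end Homogeneous

namespace LinkDiagram.CubeModel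

variable {X V F : Type} [Fintype X] [LinearOrder X] [Fintype V] [Fintype F]
variable {D : LinkDiagram X V F}
variable {o : D.Orientation} {p : Dart X V} {B M : Type*} [CommRing B] [AddCommGroup M] [Module B M]
variable (Q : CubeModel o p B M)
variable {G : Type*} [AddCommGroup G]

/-- A grading of the modules of the cube, for which the differential has degree `e` and the
operators of the half-edges have degree `ε`. -/
structure IsGraded (𝓜 : G → AddSubgroup M) (e ε : G) : Prop where
  edge_neg : ∀ x, IsHomogeneousEnd 𝓜 e (Q.edge (-1) x)
  edge_one : ∀ x, IsHomogeneousEnd 𝓜 (ε - e) (Q.edge 1 x)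
  rep_X : ∀ d, IsHomogeneousEnd 𝓜 ε (Q.rep (.X d))
  kappa : IsHomogeneousEnd 𝓜 ε (Q.κ • (1 : Module.End B M))
  unit : ∀ d, IsHomogeneousEnd 𝓜 0 (Q.rep (C Q.v₀ + C Q.v₁ * .X d))

variable {Q} {𝓜 : G → AddSubgroup M} {e ε : G}

namespace IsGraded

variable (hQ : Q.IsGraded 𝓜 e ε)
include hQ

theorem diff : IsHomogeneousEnd 𝓜 e Q.diff := IsHomogeneousEnd.sum fun x _ => hQ.edge_neg x

theorem rep_C_colourValue (a : ℤˣ) : IsHomogeneousEnd 𝓜 ε (Q.rep (C (colourValue Q.κ a))) := by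
  rw [Q.rep_C, colourValue]
  split_ifs
  · rw [zero_smul]
    exact IsHomogeneousEnd.zero
  · rw [neg_smul]
    exact hQ.kappa.neg

theorem factorAt (σ : D.Comp → ℤˣ) (d : Dart X V) :
    IsHomogeneousEnd 𝓜 ε (Q.rep (Q.factorAt σ d)) := by
  rw [CubeModel.factorAt, map_sub]
  exact (hQ.rep_X d).sub (hQ.rep_C_colourValue _)

omit hQ in
theorem rep_prod {ι : Type*} {s : Finset ι} {f : ι → MvPolynomial (Dart X V) B}
    (h : ∀ i ∈ s, IsHomogeneousEnd 𝓜 ε (Q.rep (f i))) :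
    IsHomogeneousEnd 𝓜 (s.card • ε) (Q.rep (∏ i ∈ s, f i)) := by
  induction s using Finset.induction_on with
  | empty => simpa using IsHomogeneousEnd.one
  | insert a s ha ih =>
    rw [Finset.prod_insert ha, map_mul, Finset.card_insert_of_notMem ha, succ_nsmul']
    exact (h _ (Finset.mem_insert_self _ _)).mul
      (ih fun i hi => h i (Finset.mem_insert_of_mem hi))

theorem allFactor (σ : D.Comp → ℤˣ) :
    IsHomogeneousEnd 𝓜 (Fintype.card (Dart X V) • ε) (Q.rep (Q.allFactor σ)) :=
  rep_prod fun d _ => hQ.factorAt σ d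

theorem compFactor (σ : D.Comp → ℤˣ) :
    IsHomogeneousEnd 𝓜 (Fintype.card D.Comp • ε) (Q.rep (Q.compFactor σ)) :=
  rep_prod fun _ _ => hQ.factorAt σ _

variable (hD : D.Connected)
include hD

theorem crossFactor (x : X) : IsNullHomotopic 𝓜 e Q.diff ε (Q.rep (Q.crossFactor x)) := by
  have h : IsNullHomotopic 𝓜 e Q.diff ε (Q.rep (Q.splitFactor x)) :=
    ⟨_, hQ.edge_one x, Q.diff_edge hD x⟩
  have h' := h.mul_left (Q.diff_comm_rep _) (hQ.unit (.inl (x, 0)))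
  rw [zero_add, ← map_mul] at h'
  convert h' using 1
  have e0 : Q.rep ((C Q.v₀ + C Q.v₁ * .X (.inl (x, 0))) *
      (C Q.u₀ + C Q.u₁ * .X (.inl (x, 0)))) = 1 := by
    have hsq : Q.rep (.X (.inl (x, 0)) * .X (.inl (x, 0)) + C Q.κ * .X (.inl (x, 0))) = 0 := by
      rw [map_add, map_mul, map_mul, Q.rep_sq, Q.rep_C, smul_mul_assoc, one_mul, neg_add_cancel]
    have h0 := congrArg (C : B → MvPolynomial (Dart X V) B) Q.unit₀
    have h1 := congrArg (C : B → MvPolynomial (Dart X V) B) Q.unit₁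
    simp only [map_add, map_mul, map_one] at h0 h1
    have : (C Q.v₀ + C Q.v₁ * .X (.inl (x, 0))) * (C Q.u₀ + C Q.u₁ * .X (.inl (x, 0))) =
        1 + C Q.u₁ * C Q.v₁ * (.X (.inl (x, 0)) * .X (.inl (x, 0)) + C Q.κ * .X (.inl (x, 0)) :
          MvPolynomial (Dart X V) B) := by
      linear_combination h0 + .X (.inl (x, 0)) * h1
    rw [this, map_add, map_one, map_mul, hsq, mul_zero, add_zero]
  rw [splitFactor, ← mul_assoc, map_mul, e0, one_mul]

theorem crossFactor_odd (x : X) : IsNullHomotopic 𝓜 e Q.diff ε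
    (Q.rep (C Q.κ + .X (.inl (x, 1)) + .X (.inl (x, 3)))) := by
  convert hQ.crossFactor hD x using 1
  refine Q.end_ext (fun s => ?_) (fun _ => Q.rep_comm _ _) fun _ => Q.rep_comm _ _
  simp only [CubeModel.crossFactor, map_add, LinearMap.add_apply]
  rcases circ_one_three (D := D) (s := s) x with ⟨h1, h3⟩ | ⟨h1, h3⟩
  · rw [Q.rep_circ _ _ _ h1, Q.rep_circ _ _ _ h3]
  · rw [Q.rep_circ _ _ _ h1, Q.rep_circ _ _ _ h3]
    abel

/-- On the part of the colouring `σ`, all half-edges act, up to homotopy, through their colours. -/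
theorem X_sub_mul_compFactor (σ : D.Comp → ℤˣ) (d : Dart X V) :
    IsNullHomotopic 𝓜 e Q.diff ((Fintype.card D.Comp + 1) • ε)
      (Q.rep (Q.compFactor σ * (.X d - C (colourValue Q.κ (o.colour σ d))))) := by
  let P : Dart X V → Prop := fun d =>
    IsNullHomotopic 𝓜 e Q.diff ((Fintype.card D.Comp + 1) • ε)
      (Q.rep (Q.compFactor σ * (.X d - C (colourValue Q.κ (o.colour σ d)))))
  have hopp : ∀ d, P (D.opp d) = P d := fun d => by
    simp only [P, map_mul, map_sub, Orientation.colour_opp hD]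
    rw [Q.rep_X_eq fun s => D.circ_opp s d]
  have step : ∀ d d' : Dart X V, o.colour σ d' = -o.colour σ d →
      IsNullHomotopic 𝓜 e Q.diff ε (Q.rep (C Q.κ + .X d + .X d')) → P d → P d' := by
    intro d d' hc hn hP
    have h1 := hn.mul_left (Q.diff_comm_rep _) (hQ.compFactor σ)
    rw [← succ_nsmul, ← map_mul] at h1
    have h2 := h1.add hP.neg
    rw [← map_neg, ← map_add] at h2
    change IsNullHomotopic _ _ _ _ _
    convert h2 using 2
    rw [hc, colourValue_neg, map_sub, map_neg]
    ring
  have hstr1 : ∀ d : Dart X V, P d → P d.straight := by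
    rintro (⟨x, i⟩ | ⟨v, i⟩) hP
    · have hi : ∀ i : ZMod 4, i = 0 ∨ i = 1 ∨ i = 2 ∨ i = 3 := by decide
      have e1 : (1 : ZMod 4) + 2 = 3 := by decide
      have e2 : (2 : ZMod 4) + 2 = 0 := by decide
      have e3 : (3 : ZMod 4) + 2 = 1 := by decide
      have hcross := hQ.crossFactor hD x
      have hcross' := hQ.crossFactor_odd hD x
      rw [CubeModel.crossFactor] at hcross
      rcases hi i with rfl | rfl | rfl | rfl
      · simp only [Dart.straight, zero_add]
        exact step _ _ (Orientation.colour_inl_two hD σ x) hcross hP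
      · simp only [Dart.straight, e1]
        exact step _ _ (Orientation.colour_inl_three hD σ x) hcross' hP
      · simp only [Dart.straight, e2]
        rw [add_right_comm] at hcross
        exact step _ _ (by rw [Orientation.colour_inl_two hD, neg_neg]) hcross hP
      · simp only [Dart.straight, e3]
        rw [add_right_comm] at hcross'
        exact step _ _ (by rw [Orientation.colour_inl_three hD, neg_neg]) hcross' hP
    · simp only [P, Dart.straight, map_mul, map_sub, Orientation.colour_inr hD] at hP ⊢
      rw [Q.rep_X_eq fun s => D.circ_smooth s (.inr (v, i))]
      exact hP
  have hstr : ∀ d : Dart X V, P d.straight = P d := fun d =>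
    propext ⟨fun h => by simpa [Dart.straight_straight] using hstr1 _ h, hstr1 d⟩
  have hk : D.comp (Quot.out (D.comp d)) = D.comp d := Quot.out_eq _
  have := eq_of_comp_eq P hopp hstr hk
  change P d
  rw [← this]
  change IsNullHomotopic _ _ _ _ _
  have h0 : Q.rep (Q.compFactor σ * (.X (Quot.out (D.comp d)) -
      C (colourValue Q.κ (o.colour σ (Quot.out (D.comp d)))))) = 0 := by
    refine Q.rep_mul_eq_zero_of_dvd ?_ (Q.rep_X_sub_mul (Quot.out (D.comp d))
      (o.colour σ (Quot.out (D.comp d))))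
    rw [mul_comm]
    refine mul_dvd_mul_right ?_ _
    exact Finset.dvd_prod_of_mem (fun k : D.Comp => Q.factorAt σ (Quot.out k))
      (Finset.mem_univ (D.comp d))
  rw [h0]
  exact IsNullHomotopic.zero

theorem prod_factorAt (σ : D.Comp → ℤˣ) (S : Finset (Dart X V)) :
    IsNullHomotopic 𝓜 e Q.diff ((S.card + Fintype.card D.Comp) • ε)
      (Q.rep ((∏ d ∈ S, Q.factorAt σ d) * Q.compFactor σ -
        (∏ d ∈ S, C (((o.colour σ d : ℤ) : B) * Q.κ)) * Q.compFactor σ)) := by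
  induction S using Finset.induction_on with
  | empty => simpa using IsNullHomotopic.zero
  | insert a S ha ih =>
    rw [Finset.prod_insert ha, Finset.prod_insert ha, Finset.card_insert_of_notMem ha]
    have h1 := ih.mul_left (Q.diff_comm_rep _) (hQ.factorAt σ a)
    have hc : ∀ d, IsHomogeneousEnd 𝓜 ε (Q.rep (C (((o.colour σ d : ℤ) : B) * Q.κ))) := fun d => by
      rw [← colourValue_sub_neg, map_sub, map_sub]
      exact (hQ.rep_C_colourValue _).sub (hQ.rep_C_colourValue _)
    have h2 := (hQ.X_sub_mul_compFactor hD σ a).mul_left (Q.diff_comm_rep _)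
      (rep_prod (s := S) fun d _ => hc d)
    rw [← succ_nsmul', ← map_mul] at h1
    rw [← add_nsmul, ← map_mul] at h2
    have e1 : S.card + (Fintype.card D.Comp + 1) = S.card + 1 + Fintype.card D.Comp := by ring
    have e2 : S.card + Fintype.card D.Comp + 1 = S.card + 1 + Fintype.card D.Comp := by ring
    rw [e1] at h2
    rw [e2] at h1
    have h3 := h1.add h2
    rw [← map_add] at h3
    convert h3 using 2
    rw [CubeModel.factorAt, ← colourValue_sub_neg, map_sub]
    ring

omit hQ hD

theorem kappa_pow_eq : (C (Q.κ ^ Fintype.card D.Comp) : MvPolynomial (Dart X V) B) =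
    ∑ σ : D.Comp → ℤˣ, C (((∏ k : D.Comp, o.colour σ (Quot.out k) : ℤˣ) : ℤ) : B) *
      Q.compFactor σ := by
  let f : D.Comp → ℤˣ → MvPolynomial (Dart X V) B := fun k j =>
    C (((j * o.dir (Quot.out k) * o.checker (Quot.out k) : ℤˣ) : ℤ) : B) *
      (.X (Quot.out k) -
        C (colourValue Q.κ (-(j * o.dir (Quot.out k) * o.checker (Quot.out k)))))
  have hf : ∀ k, ∑ j, f k j = C Q.κ := fun k => by
    have hu : ∀ g : ℤˣ → MvPolynomial (Dart X V) B, ∑ j, g j = g 1 + g (-1) := fun g => by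
      rw [show (Finset.univ : Finset ℤˣ) = {1, -1} from rfl, Finset.sum_pair (by decide)]
    rw [hu]
    simp only [f]
    rcases Int.units_eq_one_or (o.dir (Quot.out k)) with h | h <;>
      rcases Int.units_eq_one_or (o.checker (Quot.out k)) with h' | h' <;>
      simp [h, h', colourValue]
  calc (C (Q.κ ^ Fintype.card D.Comp) : MvPolynomial (Dart X V) B) = ∏ k, ∑ j, f k j := by
        rw [Finset.prod_congr rfl fun k _ => hf k, Finset.prod_const, map_pow, Finset.card_univ]
    _ = ∑ σ : D.Comp → ℤˣ, ∏ k, f k (σ k) := by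
        rw [Finset.prod_univ_sum, Fintype.piFinset_univ]
    _ = _ := by
        refine Finset.sum_congr rfl fun σ _ => ?_
        simp only [f, Finset.prod_mul_distrib, CubeModel.compFactor, CubeModel.factorAt,
          Orientation.colour]
        have hk : ∀ k : D.Comp, D.comp (Quot.out k) = k := fun k => Quot.out_eq k
        simp only [hk]
        congr 1
        push_cast
        simp only [map_prod, map_mul, Finset.prod_mul_distrib]

end IsGraded

end LinkDiagram.CubeModel

open MvPolynomial (C)

namespace LinkDiagram.CubeModel

variable {X V F : Type} [Fintype X] [LinearOrder X] [Fintype V] [Fintype F]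
variable {D : LinkDiagram X V F}
variable {o : D.Orientation} {p : Dart X V} {B M : Type*} [CommRing B] [AddCommGroup M] [Module B M]
variable {Q : CubeModel o p B M}
variable {G : Type*} [AddCommGroup G]

namespace IsGraded

variable {𝓜 : G → AddSubgroup M} {e ε : G}

theorem rep_intCast (a : ℤ) : IsHomogeneousEnd 𝓜 0 (Q.rep (C (a : B))) := by
  rw [Q.rep_C, Int.cast_smul_eq_zsmul]
  exact IsHomogeneousEnd.one.intSmul a

/-- The sum of the projectors to the colourings, up to homotopy and a power of `κ`. -/
def projectorSum (Q : CubeModel o p B M) : MvPolynomial (Dart X V) B :=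
  ∑ σ : D.Comp → ℤˣ, C (((∏ k : D.Comp, o.colour σ (Quot.out k) : ℤˣ) : ℤ) : B) *
    C (((∏ d, o.colour σ d : ℤˣ) : ℤ) : B) * (Q.compFactor σ * Q.allFactor σ)

theorem isNullHomotopic_kappa_pow_sub (hQ : Q.IsGraded 𝓜 e ε) (hD : D.Connected) :
    IsNullHomotopic 𝓜 e Q.diff ((Fintype.card (Dart X V) + Fintype.card D.Comp) • ε)
      (Q.rep (C (Q.κ ^ (Fintype.card (Dart X V) + Fintype.card D.Comp)) - projectorSum Q)) := by
  have h : C (Q.κ ^ (Fintype.card (Dart X V) + Fintype.card D.Comp)) - projectorSum Q =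
      ∑ σ : D.Comp → ℤˣ, (C (((∏ k : D.Comp, o.colour σ (Quot.out k) : ℤˣ) : ℤ) : B) *
        C (((∏ d, o.colour σ d : ℤˣ) : ℤ) : B)) * -((∏ d, Q.factorAt σ d) * Q.compFactor σ -
        (∏ d, C (((o.colour σ d : ℤ) : B) * Q.κ)) * Q.compFactor σ) := by
    rw [pow_add, map_mul, kappa_pow_eq, Finset.mul_sum, projectorSum, ← Finset.sum_sub_distrib]
    refine Finset.sum_congr rfl fun σ _ => ?_
    have h1 : ∏ d, (C (((o.colour σ d : ℤ) : B) * Q.κ) : MvPolynomial (Dart X V) B) =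
        C (((∏ d, o.colour σ d : ℤˣ) : ℤ) : B) * C (Q.κ ^ Fintype.card (Dart X V)) := by
      rw [← map_prod, ← map_mul, Finset.prod_mul_distrib, Finset.prod_const, Finset.card_univ]
      congr 2
      push_cast
      rfl
    have h2 : (C (((∏ d, o.colour σ d : ℤˣ) : ℤ) : B) : MvPolynomial (Dart X V) B) *
        C (((∏ d, o.colour σ d : ℤˣ) : ℤ) : B) = 1 := by
      rw [← map_mul, ← Int.cast_mul, ← Units.val_mul, Int.units_mul_self]
      simp
    rw [h1, CubeModel.allFactor]
    linear_combination (-(C (((∏ k : D.Comp, o.colour σ (Quot.out k) : ℤˣ) : ℤ) : B) *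
      C (Q.κ ^ Fintype.card (Dart X V)) * Q.compFactor σ)) * h2
  rw [h, map_sum]
  refine Finset.sum_induction _ (IsNullHomotopic 𝓜 e Q.diff _) (fun _ _ => IsNullHomotopic.add)
    IsNullHomotopic.zero fun σ _ => ?_
  have h1 := (hQ.prod_factorAt hD σ Finset.univ).neg
  have h2 := h1.mul_left (Q.diff_comm_rep _)
    ((rep_intCast (Q := Q) ((∏ k : D.Comp, o.colour σ (Quot.out k) : ℤˣ) : ℤ)).mul
      (rep_intCast (Q := Q) ((∏ d, o.colour σ d : ℤˣ) : ℤ)) |> fun h => by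
        rw [← map_mul] at h; exact h)
  rw [zero_add, zero_add, ← map_neg, ← map_mul] at h2
  exact h2

/-- The polynomial `κ ^ m` minus the sum of its projections to the colourings of the changes of
orientation. -/
def kernelFactor (Q : CubeModel o p B M) : MvPolynomial (Dart X V) B :=
  C (Q.κ ^ Fintype.card (Dart X V)) -
    ∑ σ : o.Change p, C (((∏ d, o.colour σ.1 d : ℤˣ) : ℤ) : B) * Q.allFactor σ.1

theorem rep_kernelFactor (hQ : Q.IsGraded 𝓜 e ε) :
    IsHomogeneousEnd 𝓜 (Fintype.card (Dart X V) • ε) (Q.rep (kernelFactor Q)) := by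
  rw [kernelFactor, map_sub, map_sum, map_pow, map_pow]
  refine IsHomogeneousEnd.sub ?_ (IsHomogeneousEnd.sum fun σ _ => ?_)
  · rw [Q.rep_C]
    exact hQ.kappa.pow _
  · rw [map_mul, ← zero_add (Fintype.card (Dart X V) • ε)]
    exact (rep_intCast _).mul (hQ.allFactor _)

theorem proj_kernelFactor (v : M) : Q.proj (Q.rep (kernelFactor Q) v) = 0 := by
  funext σ
  rw [Q.proj_rep_eval, kernelFactor, map_sub, map_sum, Finset.sum_eq_single σ]
  · have h2 : (((∏ d, o.colour σ.1 d : ℤˣ) : ℤ) : B) * (((∏ d, o.colour σ.1 d : ℤˣ) : ℤ) : B) =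
        1 := by
      rw [← Int.cast_mul, ← Units.val_mul, Int.units_mul_self]
      simp
    rw [map_mul, Q.eval_allFactor, if_pos rfl, MvPolynomial.eval_C, MvPolynomial.eval_C,
      ← mul_assoc, h2, one_mul, sub_self, zero_mul]
    rfl
  · intro τ _ hτ
    rw [map_mul, Q.eval_allFactor, if_neg fun h => hτ (Subtype.ext h), mul_zero]
  · simp

variable (hD : D.Connected)
include hD

theorem allFactor_apply_eq_zero {v : M} (hv : Q.proj v = 0) (σ : D.Comp → ℤˣ) :
    Q.rep (Q.allFactor σ) v = 0 := by
  by_cases h : σ (D.comp p) = o.baseSign p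
  · obtain ⟨τ, rfl⟩ : ∃ τ : o.Change p, τ.1 = σ := ⟨⟨σ, h⟩, rfl⟩
    rw [Q.allFactor_apply hD τ, hv, Pi.zero_apply, zero_mul, zero_smul]
  · have hc : o.colour σ p = -1 := by
      have := (Orientation.colour_base hD (o := o) (p := p) (σ := σ)).not.2 h
      exact (Int.units_eq_one_or _).resolve_left this
    have h0 : Q.rep (Q.allFactor σ) = 0 := by
      refine Q.rep_mul_eq_zero_of_dvd
        (Finset.dvd_prod_of_mem (Q.factorAt σ) (Finset.mem_univ p)) ?_
      rw [CubeModel.factorAt, hc, colourValue, if_pos (by simp), map_zero, sub_zero, Q.rep_base]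
    rw [h0, LinearMap.zero_apply]

theorem projectorSum_apply {v : M} (hv : Q.proj v = 0) : Q.rep (projectorSum Q) v = 0 := by
  rw [projectorSum, map_sum, LinearMap.sum_apply]
  refine Finset.sum_eq_zero fun σ _ => ?_
  rw [map_mul, map_mul Q.rep (Q.compFactor σ), Module.End.mul_apply, Module.End.mul_apply,
    allFactor_apply_eq_zero hD hv, map_zero, map_zero]

theorem kernelFactor_apply {v : M} (hv : Q.proj v = 0) :
    Q.rep (kernelFactor Q) v = Q.κ ^ Fintype.card (Dart X V) • v := by
  rw [kernelFactor, map_sub, LinearMap.sub_apply, map_sum, LinearMap.sum_apply,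
    Finset.sum_eq_zero, sub_zero, Q.rep_C]
  · rfl
  · intro σ _
    rw [map_mul, Module.End.mul_apply, allFactor_apply_eq_zero hD hv, map_zero]

theorem main (hQ : Q.IsGraded 𝓜 e ε) {𝓔 : G → Set (o.Change p → B)}
    (hproj : ∀ n, Set.MapsTo Q.proj (𝓜 n) (𝓔 n)) {b ν : B} (hb : b = ν * Q.κ)
    (hν : IsHomogeneousEnd 𝓜 0 (ν • (1 : Module.End B M))) :
    IsDifferential B (fun n => (𝓜 n : Set M)) e Q.diff ∧
      ∃ h : IsMorphismToZeroComplex B (fun n => (𝓜 n : Set M)) 𝓔 Q.diff Q.proj,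
        Function.Surjective Q.proj ∧
        HomotopicallyNilpotentOn (fun n => (𝓜 n : Set M)) e Q.diff h.ker b ε := by
  refine ⟨⟨Q.diff.isLinear, hQ.diff, fun u => LinearMap.congr_fun (Q.diff_sq hD) u⟩,
    ⟨Q.proj.isLinear, hproj, Q.proj_diff hD⟩, Q.proj_surjective hD, ?_⟩
  set U := IsMorphismToZeroComplex.ker (⟨Q.proj.isLinear, hproj, Q.proj_diff hD⟩ :
    IsMorphismToZeroComplex B (fun n => (𝓜 n : Set M)) 𝓔 Q.diff Q.proj) with hU
  have hmem : ∀ v, v ∈ U ↔ Q.proj v = 0 := fun v => Iff.rfl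
  obtain ⟨k, hk, hdk⟩ := hQ.isNullHomotopic_kappa_pow_sub hD
  let N := Fintype.card (Dart X V) + (Fintype.card (Dart X V) + Fintype.card D.Comp)
  let k' : Module.End B M := ν ^ N • (Q.rep (kernelFactor Q) * k)
  have hk'U : ∀ v, k' v ∈ U := fun v => by
    rw [hmem]
    simp only [k', LinearMap.smul_apply, map_smul, Module.End.mul_apply, proj_kernelFactor,
      smul_zero]
  have hk' : IsHomogeneousEnd 𝓜 (N • ε - e) k' := by
    have h1 : k' = (ν • (1 : Module.End B M)) ^ N * (Q.rep (kernelFactor Q) * k) := by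
      rw [smul_pow, one_pow, smul_mul_assoc, one_mul]
    have h2 := (hν.pow N).mul (hQ.rep_kernelFactor.mul hk)
    rw [← h1] at h2
    convert h2 using 1
    simp only [N, smul_zero, zero_add, add_nsmul]
    abel
  refine ⟨fun u => Q.proj_diff hD u, N, (k'.comp U.subtype).codRestrict U fun u => hk'U u,
    fun n u hu => hk' n hu, fun u => ?_⟩
  have hu : Q.proj u = 0 := (hmem u).1 u.2
  have hcomm : Q.diff * Q.rep (kernelFactor Q) = Q.rep (kernelFactor Q) * Q.diff :=
    Q.diff_comm_rep _
  have hid : Q.diff * k' + k' * Q.diff = ν ^ N • (Q.rep (kernelFactor Q) *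
      Q.rep (C (Q.κ ^ (Fintype.card (Dart X V) + Fintype.card D.Comp)) - projectorSum Q)) := by
    rw [← hdk, mul_add, mul_smul_comm, smul_mul_assoc, ← mul_assoc, hcomm, ← smul_add]
    simp only [mul_assoc]
  have := LinearMap.congr_fun hid (u : M)
  simp only [LinearMap.add_apply, Module.End.mul_apply, LinearMap.smul_apply, map_sub,
    LinearMap.sub_apply, projectorSum_apply hD hu, sub_zero, Q.rep_C, Module.End.one_apply,
    map_smul, kernelFactor_apply hD hu] at this
  refine this.trans ?_
  rw [smul_smul, smul_smul, hb, mul_pow, mul_assoc, ← pow_add]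
  congr 3
  simp only [N]
  ring

end IsGraded

end LinkDiagram.CubeModel

/-! ### Frobenius algebras of rank two -/

section PiTensor

variable {K R S ι : Type*} [CommRing K] [CommRing R] [Algebra K R] [CommRing S] [Algebra K S]
  [Fintype ι] [DecidableEq ι]

theorem PiTensorProduct.lift_mkPiAlgebra_single_mul (f : ι → R →ₗ[K] S) (c : ι) (a : R) (A : S)
    (h : ∀ b, f c (a * b) = A * f c b) (v : ⨂[K] _ : ι, R) :
    lift ((MultilinearMap.mkPiAlgebra K ι S).compLinearMap f)
      (singleAlgHom (R := K) (A := fun _ : ι => R) c a * v) =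
    A * lift ((MultilinearMap.mkPiAlgebra K ι S).compLinearMap f) v := by
  induction v using PiTensorProduct.induction_on with
  | smul_tprod r b =>
    rw [mul_smul_comm, map_smul, map_smul, mul_smul_comm]
    congr 1
    have h1 : singleAlgHom (R := K) (A := fun _ : ι => R) c a = tprod K (Pi.mulSingle c a) := rfl
    rw [h1, tprod_mul_tprod, lift.tprod, lift.tprod]
    simp only [MultilinearMap.compLinearMap_apply, MultilinearMap.mkPiAlgebra_apply, Pi.mul_apply]
    rw [← Finset.mul_prod_erase _ _ (Finset.mem_univ c),
      ← Finset.mul_prod_erase Finset.univ (fun i => f i (b i)) (Finset.mem_univ c),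
      Pi.mulSingle_eq_same, h, mul_assoc]
    congr 2
    refine Finset.prod_congr rfl fun i hi => ?_
    rw [Pi.mulSingle_eq_of_ne (Finset.ne_of_mem_erase hi), one_mul]
  | add v w hv hw => rw [mul_add, map_add, map_add, hv, hw, mul_add]

theorem PiTensorProduct.lift_mkPiAlgebra_one (f : ι → R →ₗ[K] S) :
    lift ((MultilinearMap.mkPiAlgebra K ι S).compLinearMap f) 1 = ∏ i, f i 1 := by
  rw [one_def, lift.tprod]
  simp

theorem PiTensorProduct.tprod_eq_prod_single (b : ι → R) :
    tprod K b = ∏ i, singleAlgHom (R := K) (A := fun _ : ι => R) i (b i) := by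
  have h1 : ∀ i, singleAlgHom (R := K) (A := fun _ : ι => R) i (b i) =
    tprod K (Pi.mulSingle i (b i)) := fun _ => rfl
  simp only [h1]
  rw [← tprod_prod, Finset.univ_prod_mulSingle]

end PiTensor

namespace RankTwoGenerator

variable {K R : Type*} [CommRing K] [CommRing R] [Algebra K R] (g : RankTwoGenerator K R)

theorem conj_gen : g.conj g.gen = g.genBar := by
  change algebraMap K R (g.coord g.gen).1 + algebraMap K R (g.coord g.gen).2 * g.genBar = _
  rw [g.coord_eq (u := g.gen) (a := 0) (b := 1) (by simp)]
  simp

theorem conj_genBar : g.conj g.genBar = g.gen := by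
  rw [genBar, map_sub, AlgHom.commutes, conj_gen, genBar]
  ring

theorem conj_conj (u : R) : g.conj (g.conj u) = u := by
  rw [← g.coord_spec u]
  simp only [map_add, map_mul, AlgHom.commutes, conj_gen, conj_genBar]

theorem twist_twist (e : ℤˣ) (u : R) : g.twist e (g.twist e u) = u := by
  unfold twist
  split_ifs
  · rfl
  · exact g.conj_conj u

theorem twist_gen_neg (e : ℤˣ) :
    g.twist (-e) g.gen - g.twist e g.gen = -(((e : ℤ) : R) * g.beta) := by
  rcases Int.units_eq_one_or e with rfl | rfl
  · simp [twist, conj_gen, beta]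
  · simp [twist, conj_gen, beta]

theorem twist_beta (e : ℤˣ) : g.twist e (((e : ℤ) : R) * g.beta) = g.beta := by
  rcases Int.units_eq_one_or e with rfl | rfl
  · simp [twist]
  · simp [twist, conj_gen, conj_genBar, beta]

theorem two_mul_twist_gen (e : ℤˣ) :
    2 * g.twist e g.gen - ((e : ℤ) : R) * g.beta = algebraMap K R g.tr := by
  rcases Int.units_eq_one_or e with rfl | rfl
  · simp [twist, beta, genBar]
    ring
  · simp [twist, conj_gen, beta, genBar]
    ring

theorem exists_comul_one [Coalgebra K R] [FrobeniusAlgebra K R] : ∃ ω ω' : R, ω * ω' = 1 ∧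
    Coalgebra.comul (R := K) (1 : R) =
      (ω ⊗ₜ[K] (1 : R)) * (g.gen ⊗ₜ 1 + 1 ⊗ₜ g.gen - algebraMap K R g.tr ⊗ₜ 1) := by
  have hex : ∀ z : R ⊗[K] R, ∃ u v : R, z = u ⊗ₜ 1 + v ⊗ₜ g.gen := fun z => by
    induction z using TensorProduct.induction_on with
    | zero => exact ⟨0, 0, by simp⟩
    | tmul a b =>
      refine ⟨algebraMap K R (g.coord b).1 * a, algebraMap K R (g.coord b).2 * a, ?_⟩
      conv_lhs => rw [← g.coord_spec b]
      rw [TensorProduct.tmul_add]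
      simp only [Algebra.algebraMap_eq_smul_one, smul_mul_assoc, one_mul, TensorProduct.tmul_smul,
        TensorProduct.smul_tmul']
    | add z w hz hw =>
      obtain ⟨u, v, rfl⟩ := hz
      obtain ⟨u', v', rfl⟩ := hw
      exact ⟨u + u', v + v', by simp only [TensorProduct.add_tmul]; abel⟩
  obtain ⟨u, v, huv⟩ := hex (Coalgebra.comul (R := K) (1 : R))
  let ε : R →ₗ[K] K := Coalgebra.counit
  have h1 : ∀ a, algebraMap K R (ε (a * u)) + algebraMap K R (ε (a * v)) * g.gen = a := fun a => by
    have h := Coalgebra.rTensor_counit_comul (R := K) a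
    have ha := FrobeniusAlgebra.comul_mul_left (K := K) a (1 : R)
    rw [mul_one] at ha
    rw [ha, huv, mul_add, Algebra.TensorProduct.tmul_mul_tmul, Algebra.TensorProduct.tmul_mul_tmul,
      map_add, LinearMap.rTensor_tmul, LinearMap.rTensor_tmul, one_mul, one_mul] at h
    have h' := congrArg (TensorProduct.lid K R) h
    simpa [Algebra.smul_def] using h'
  have hc : ∀ a, g.coord a = (ε (a * u), ε (a * v)) := fun a => g.coord_eq (h1 a)
  have hnd : ∀ w, (∀ a, ε (a * w) = 0) → w = 0 := fun w hw => by
    have := h1 w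
    rw [mul_comm w u, mul_comm w v, hw, hw] at this
    simpa using this.symm
  have hu : u = v * (g.gen - algebraMap K R g.tr) := by
    rw [← sub_eq_zero]
    refine hnd _ fun a => ?_
    have hs := g.gen_sq
    have hspec := g.coord_spec a
    have h2 := g.coord_eq (u := a * (g.gen - algebraMap K R g.tr))
      (a := -(g.coord a).1 * g.tr - (g.coord a).2 * g.nm) (b := (g.coord a).1) (by
        conv_rhs => rw [← hspec]
        simp only [map_sub, map_neg, map_mul]
        linear_combination (-(algebraMap K R (g.coord a).2)) * hs)
    have h3 := congrArg Prod.snd h2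
    rw [hc, hc a] at h3
    simp only at h3
    rw [mul_sub, map_sub, ← h3, sub_eq_zero]
    congr 1
    ring
  refine ⟨v, algebraMap K R (ε g.gen) + (g.gen - algebraMap K R g.tr) * algebraMap K R (ε 1),
    ?_, ?_⟩
  · have h := Coalgebra.lTensor_counit_comul (R := K) (1 : R)
    rw [huv, map_add, LinearMap.lTensor_tmul, LinearMap.lTensor_tmul] at h
    have h' := congrArg (TensorProduct.rid K R) h
    simp only [map_add, TensorProduct.rid_tmul, Algebra.smul_def, map_one] at h'
    change algebraMap K R (ε 1) * u + algebraMap K R (ε g.gen) * v = 1 * 1 at h'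
    rw [hu] at h'
    linear_combination h'
  · rw [huv, hu]
    simp only [Algebra.TensorProduct.tmul_mul_tmul, mul_one, one_mul, mul_sub, mul_add,
      TensorProduct.sub_tmul]
    abel

end RankTwoGenerator

namespace LinkDiagram

variable {X V F : Type} [Fintype X] [LinearOrder X] [Fintype V] [Fintype F]
variable {D : LinkDiagram X V F}
variable {K R : Type*} [CommRing K] [CommRing R] [Algebra K R]

section Surgery

variable [Coalgebra K R]

/-- The map from a factor of `Φ(D_s)` in the definition of the surgery map. -/
def surgeryFactor (D : LinkDiagram X V F) (K R : Type*) [CommRing K] [CommRing R] [Algebra K R]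
    [Coalgebra K R] (s s' : X → ℤˣ) (x : X) (c : D.Circ s) : R →ₗ[K] D.Phi K R s' :=
  if c = D.circ s (.inl (x, 0)) ∧ c = D.circ s (.inl (x, 2)) then
    (Algebra.TensorProduct.productMap (D.factor K R s' (D.circ s' (.inl (x, 0))))
      (D.factor K R s' (D.circ s' (.inl (x, 2))))).toLinearMap ∘ₗ Coalgebra.comul
  else (D.factor K R s' (D.circ s' (Quot.out c))).toLinearMap

theorem surgery_eq (s s' : X → ℤˣ) (x : X) : D.surgery K R s s' x =
    PiTensorProduct.lift ((MultilinearMap.mkPiAlgebra K (D.Circ s) (D.Phi K R s')).compLinearMap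
      (surgeryFactor D K R s s' x)) := rfl

variable [FrobeniusAlgebra K R]

theorem surgery_factor_mul {τ : Dart X V → ℤˣ} (hτ : D.IsAlternating τ) {s s' : X → ℤˣ} {x : X}
    (hs : s' = flip s x) (d : Dart X V) (a : R) (v : D.Phi K R s) :
    D.surgery K R s s' x (D.factor K R s (D.circ s d) a * v) =
      D.factor K R s' (D.circ s' d) a * D.surgery K R s s' x v := by
  subst hs
  refine PiTensorProduct.lift_mkPiAlgebra_single_mul
    (surgeryFactor D K R s (flip s x) x) (D.circ s d) a _ (fun b => ?_) v
  unfold surgeryFactor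
  split_ifs with h
  · simp only [LinearMap.comp_apply, AlgHom.toLinearMap_apply]
    rcases Near.flip (Or.inl h.1 : D.Near s x d) with e | e
    · rw [FrobeniusAlgebra.comul_mul_left, map_mul, e]
      simp
    · rw [mul_comm a b, FrobeniusAlgebra.comul_mul_right, map_mul, e, mul_comm]
      simp
  · simp only [AlgHom.toLinearMap_apply, map_mul]
    have e : D.circ (flip s x) (Quot.out (D.circ s d)) = D.circ (flip s x) d := by
      by_cases hx : D.Joined (flip s x) x
      · exact circ_flip_of_joined hx (circ_out _)
      · refine (circ_flip_of_not_near (circ_out _).symm fun hn => h ?_).symm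
        have hj : D.Joined s x := by
          have := hτ.joined_flip s x
          tauto
        rcases hn with hn | hn
        · exact ⟨hn, hn.trans hj⟩
        · exact ⟨hn.trans hj.symm, hn⟩
    rw [e]

theorem surgery_one_of_not_joined (s s' : X → ℤˣ) {x : X} (h : ¬ D.Joined s x) :
    D.surgery K R s s' x 1 = 1 := by
  rw [surgery_eq, PiTensorProduct.lift_mkPiAlgebra_one]
  refine Finset.prod_eq_one fun c _ => ?_
  rw [surgeryFactor, if_neg fun hc => h (hc.1.symm.trans hc.2)]
  simp

theorem surgery_one_of_joined (s s' : X → ℤˣ) {x : X} (h : D.Joined s x) :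
    D.surgery K R s s' x 1 =
      Algebra.TensorProduct.productMap (D.factor K R s' (D.circ s' (.inl (x, 0))))
      (D.factor K R s' (D.circ s' (.inl (x, 2)))) (Coalgebra.comul 1) := by
  rw [surgery_eq, PiTensorProduct.lift_mkPiAlgebra_one,
    Finset.prod_eq_single (D.circ s (.inl (x, 0)))]
  · rw [surgeryFactor, if_pos ⟨rfl, h⟩]
    rfl
  · intro c _ hc
    rw [surgeryFactor, if_neg fun h => hc h.1]
    simp
  · simp

end Surgery

namespace Orientation

variable (o : D.Orientation) (p : Dart X V) (g : RankTwoGenerator K R)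

theorem kh_smul_apply (a : R) (v : o.KH p g) (s : X → ℤˣ) :
    (a • v) s = D.factor K R s (D.circ s p) (g.twist (o.baseSign p) a) * v s := rfl

theorem kh_add_apply (v w : o.KH p g) (s : X → ℤˣ) : (v + w) s = v s + w s := rfl

/-- The element of `Φ(D_s)` by which an element of the ring of scalars acts. -/
def khScalar (s : X → ℤˣ) : R →+* D.Phi K R s :=
  (D.factor K R s (D.circ s p)).toRingHom.comp (g.twist (o.baseSign p)).toRingHom

/-- The polynomials in the half-edges, as elements of `Φ(D_s)`. -/
def khPoly (s : X → ℤˣ) : MvPolynomial (Dart X V) R →+* D.Phi K R s :=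
  MvPolynomial.eval₂Hom (o.khScalar p g s)
    fun d => D.factor K R s (D.circ s d) g.gen - D.factor K R s (D.circ s p) g.gen

/-- The action of the polynomials in the half-edges on `KH(D,p,R)`. -/
def khRep : MvPolynomial (Dart X V) R →ₐ[R] Module.End R (o.KH p g) where
  toFun f :=
    { toFun := fun v s => o.khPoly p g s f * v s
      map_add' := fun v w => by
        funext s
        exact mul_add _ _ _
      map_smul' := fun a v => by
        funext s
        exact mul_left_comm _ _ _ }
  map_one' := by
    ext v
    funext s
    change o.khPoly p g s 1 * v s = v s
    rw [map_one, one_mul]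
  map_mul' f f' := by
    ext v
    funext s
    change o.khPoly p g s (f * f') * v s = o.khPoly p g s f * (o.khPoly p g s f' * v s)
    rw [map_mul, mul_assoc]
  map_zero' := by
    ext v
    funext s
    change o.khPoly p g s 0 * v s = 0
    rw [map_zero, zero_mul]
  map_add' f f' := by
    ext v
    funext s
    change o.khPoly p g s (f + f') * v s = o.khPoly p g s f * v s + o.khPoly p g s f' * v s
    rw [map_add, add_mul]
  commutes' a := by
    ext v
    funext s
    change o.khPoly p g s (MvPolynomial.C a) * v s = _
    rw [khPoly, MvPolynomial.coe_eval₂Hom, MvPolynomial.eval₂_C]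
    rfl

theorem khRep_apply (f : MvPolynomial (Dart X V) R) (v : o.KH p g) (s : X → ℤˣ) :
    o.khRep p g f v s = o.khPoly p g s f * v s := rfl

theorem khPoly_X (s : X → ℤˣ) (d : Dart X V) : o.khPoly p g s (.X d) =
    D.factor K R s (D.circ s d) g.gen - D.factor K R s (D.circ s p) g.gen := by
  simp [khPoly]

theorem khPoly_C (s : X → ℤˣ) (a : R) : o.khPoly p g s (.C a) =
    D.factor K R s (D.circ s p) (g.twist (o.baseSign p) a) := by
  rw [khPoly, MvPolynomial.coe_eval₂Hom, MvPolynomial.eval₂_C]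
  rfl

/-- The action of the functions of the states. -/
def khPart : ((X → ℤˣ) → ℤ) →+* Module.End R (o.KH p g) where
  toFun a :=
    { toFun := fun v s => a s • v s
      map_add' := fun v w => by
        funext s
        exact zsmul_add _ _ _
      map_smul' := fun b v => by
        funext s
        exact (mul_smul_comm _ _ _).symm }
  map_one' := by
    ext v
    funext s
    exact one_zsmul _
  map_mul' a b := by
    ext v
    funext s
    exact mul_smul (a s) (b s) (v s)
  map_zero' := by
    ext v
    funext s
    exact zero_zsmul _
  map_add' a b := by
    ext v
    funext s
    exact add_zsmul _ _ _

theorem khPart_apply (a : (X → ℤˣ) → ℤ) (v : o.KH p g) (s : X → ℤˣ) :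
    o.khPart p g a v s = a s • v s := rfl

/-- The unit of the summand of a state. -/
def khOne (s : X → ℤˣ) : o.KH p g := (Pi.single s 1 : ∀ s, D.Phi K R s)

theorem khOne_same (s : X → ℤˣ) : o.khOne p g s s = 1 := by
  unfold khOne
  exact Pi.single_eq_same (M := fun s => D.Phi K R s) s 1

theorem khOne_of_ne {s s' : X → ℤˣ} (h : s' ≠ s) : o.khOne p g s s' = 0 := by
  unfold khOne
  exact Pi.single_eq_of_ne (M := fun s => D.Phi K R s) h 1

variable [Coalgebra K R] [FrobeniusAlgebra K R]

/-- The surgeries at `x` in both directions. -/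
def khSurg (hD : D.Connected) (x : X) : Module.End R (o.KH p g) where
  toFun v s := D.surgery K R (flip s x) s x (v (flip s x))
  map_add' v w := by
    funext s
    exact map_add _ _ _
  map_smul' a v := by
    funext s
    exact surgery_factor_mul (isAlternating_checker hD o) (flip_flip s x).symm _ _ _

theorem khSurg_apply (hD : D.Connected) (x : X) (v : o.KH p g) (s : X → ℤˣ) :
    o.khSurg p g hD x v s = D.surgery K R (flip s x) s x (v (flip s x)) := rfl

theorem khSurg_one (hD : D.Connected) (s : X → ℤˣ) (x : X) {y : ∀ s, D.Phi K R s}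
    (hy : D.surgery K R s (flip s x) x 1 = y (flip s x)) (s' : X → ℤˣ) :
    o.khSurg p g hD x (o.khOne p g s) s' = y s' * o.khOne p g (flip s x) s' := by
  rw [khSurg_apply]
  by_cases h : s' = flip s x
  · subst h
    rw [khOne_same, mul_one, ← hy, flip_flip, khOne_same]
  · rw [khOne_of_ne _ _ _ h, mul_zero, khOne_of_ne _ _ _ fun e => h (flip_eq_iff.1 e), map_zero]

theorem khSurg_rep (hD : D.Connected) (x : X) (d : Dart X V) :
    o.khSurg p g hD x * o.khRep p g (.X d) = o.khRep p g (.X d) * o.khSurg p g hD x := by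
  ext v
  funext s
  simp only [Module.End.mul_apply, khSurg_apply, khRep_apply, khPoly_X, sub_mul, map_sub]
  rw [surgery_factor_mul (isAlternating_checker hD o) (flip_flip s x).symm,
    surgery_factor_mul (isAlternating_checker hD o) (flip_flip s x).symm]

omit [Coalgebra K R] [FrobeniusAlgebra K R]

theorem kh_span (N : Submodule R (o.KH p g)) (h1 : ∀ s, o.khOne p g s ∈ N)
    (h2 : ∀ d, ∀ v ∈ N, o.khRep p g (.X d) v ∈ N) : N = ⊤ := by
  let single : ∀ s, D.Phi K R s →+ o.KH p g := fun s =>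
    AddMonoidHom.single (fun s => D.Phi K R s) s
  have hsame : ∀ s w, single s w s = w := fun s w => Pi.single_eq_same _ _
  have hne : ∀ {s s'} w, s' ≠ s → single s w s' = 0 := fun w h => Pi.single_eq_of_ne h _
  have hmul : ∀ s (y : ∀ s, D.Phi K R s) w s', y s' * single s w s' = single s (y s * w) s' := by
    intro s y w s'
    by_cases h : s' = s
    · subst h
      rw [hsame, hsame]
    · rw [hne _ h, hne _ h, mul_zero]
  have hbase : ∀ s a w, single s w ∈ N →
      single s (D.factor K R s (D.circ s p) a * w) ∈ N := fun s a w hw => by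
    have := N.smul_mem (g.twist (o.baseSign p) a) hw
    convert this using 1
    funext s'
    rw [kh_smul_apply, g.twist_twist, hmul s (fun s => D.factor K R s (D.circ s p) a)]
  have hfac : ∀ s c a w, single s w ∈ N → single s (D.factor K R s c a * w) ∈ N := by
    intro s c a w hw
    obtain ⟨d, rfl⟩ : ∃ d, D.circ s d = c := Quot.mk_surjective c
    have hK : ∀ k : K, ∀ w, single s w ∈ N → single s (algebraMap K _ k * w) ∈ N := fun k w hw => by
      have := hbase s (algebraMap K R k) w hw
      rwa [AlgHom.commutes] at this
    have hgen : single s (D.factor K R s (D.circ s d) g.gen * w) ∈ N := by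
      have h := N.add_mem (h2 d _ hw) (hbase s g.gen w hw)
      convert h using 1
      funext s'
      rw [kh_add_apply, khRep_apply, khPoly_X,
        hmul s (fun s => D.factor K R s (D.circ s d) g.gen - D.factor K R s (D.circ s p) g.gen),
        sub_mul, map_sub]
      exact (sub_add_cancel _ _).symm
    rw [← g.coord_spec a, map_add, map_mul (D.factor K R s (D.circ s d)), AlgHom.commutes,
      AlgHom.commutes, add_mul, map_add, mul_assoc]
    exact N.add_mem (hK _ _ hw) (hK _ _ hgen)
  have hall : ∀ s w, single s w ∈ N := by
    intro s w
    induction w using PiTensorProduct.induction_on with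
    | smul_tprod r b =>
      rw [Algebra.smul_def, PiTensorProduct.tprod_eq_prod_single]
      have hp : ∀ S : Finset (D.Circ s), single s (∏ c ∈ S, D.factor K R s c (b c)) ∈ N := by
        intro S
        induction S using Finset.induction_on with
        | empty => exact h1 s
        | insert c S hc ih =>
          rw [Finset.prod_insert hc]
          exact hfac _ _ _ _ ih
      have := hfac s (D.circ s p) (algebraMap K R r) _ (hp Finset.univ)
      rwa [AlgHom.commutes] at this
    | add v w hv hw =>
      rw [map_add]
      exact N.add_mem hv hw
  rw [eq_top_iff]
  intro v _
  have hv : v = ∑ s, single s (v s) :=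
    (Finset.univ_sum_single (M := fun s => D.Phi K R s) v).symm
  rw [hv]
  exact N.sum_mem fun s _ => hall s _

end Orientation

end LinkDiagram

open MvPolynomial (C)

namespace LinkDiagram

variable {X V F : Type} [Fintype X] [LinearOrder X] [Fintype V] [Fintype F]
variable {D : LinkDiagram X V F}

namespace Orientation

section Degree

variable (o : D.Orientation)

theorem stateDegree_flip {s : X → ℤˣ} {x : X} (h : s x = -1) :
    o.stateDegree (flip s x) = o.stateDegree s + 1 := by
  have h1 : Finset.univ.filter (fun y => s y = -1) =
      insert x (Finset.univ.filter fun y => flip s x y = -1) := by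
    ext y
    simp only [Finset.mem_filter, Finset.mem_univ, true_and, Finset.mem_insert]
    by_cases hy : y = x
    · subst hy
      simp [h]
    · simp [hy, flip_of_ne s hy]
  have h2 : x ∉ Finset.univ.filter fun y => flip s x y = -1 := by
    simp [flip_same, h]
  rw [stateDegree, stateDegree, h1, Finset.card_insert_of_notMem h2]
  push_cast
  ring

theorem stateDegree_flip_of_wedgeFun_ne {e : ℤˣ} {s : X → ℤˣ} {x : X}
    (h : wedgeFun e x s ≠ 0) : o.stateDegree s = o.stateDegree (flip s x) + e := by
  have hs : s x = e := by
    by_contra hc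
    exact h (if_neg hc)
  rcases Int.units_eq_one_or e with rfl | rfl
  · have := o.stateDegree_flip (s := flip s x) (x := x) (by rw [flip_same, hs])
    rw [flip_flip] at this
    rw [this]
    rfl
  · rw [o.stateDegree_flip hs]
    simp

end Degree

variable {K R : Type*} [CommRing K] [CommRing R] [Algebra K R]
variable (o : D.Orientation) (p : Dart X V) (g : RankTwoGenerator K R)

/-- The evaluation of `Φ(D_s)` at the colouring of a change of orientation. -/
def khEval (σ : o.Change p) : D.Phi K R (changeState σ) →ₗ[K] R :=
  PiTensorProduct.lift
    ((MultilinearMap.mkPiAlgebra K (D.Circ (changeState σ)) R).compLinearMap fun c =>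
      (g.twist (circSign σ c)).toLinearMap)

theorem khPhi_apply (v : o.KH p g) (σ : o.Change p) :
    o.khPhi p g v σ = (contractionSign σ : ℤ) • o.khEval p g σ (v (changeState σ)) := rfl

variable (hD : D.Connected)
include hD

theorem khEval_factor_mul (σ : o.Change p) (d : Dart X V) (a : R)
    (w : D.Phi K R (changeState σ)) :
    o.khEval p g σ (D.factor K R _ (D.circ _ d) a * w) =
      g.twist (o.baseSign p * o.colour σ.1 d) a * o.khEval p g σ w := by
  rw [← circSign_eq hD]
  refine PiTensorProduct.lift_mkPiAlgebra_single_mul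
    (fun c => (g.twist (circSign σ c)).toLinearMap) _ a _ (fun b => ?_) w
  simp only [AlgHom.toLinearMap_apply, map_mul]

theorem khEval_base_mul (σ : o.Change p) (a : R) (w : D.Phi K R (changeState σ)) :
    o.khEval p g σ (D.factor K R _ (D.circ _ p) a * w) =
      g.twist (o.baseSign p) a * o.khEval p g σ w := by
  rw [khEval_factor_mul o p g hD, (colour_base hD).2 σ.2, mul_one]

/-- The map `φ(R)` as a linear map. -/
def khProj : o.KH p g →ₗ[R] (o.Change p → R) where
  toFun := o.khPhi p g
  map_add' v w := by
    funext σ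
    rw [Pi.add_apply, khPhi_apply, khPhi_apply, khPhi_apply, kh_add_apply, map_add, smul_add]
  map_smul' a v := by
    funext σ
    rw [Pi.smul_apply, khPhi_apply, khPhi_apply, kh_smul_apply, khEval_base_mul o p g hD,
      g.twist_twist]
    exact (mul_smul_comm _ _ _).symm

/-- The complex `KH(D,p,R)` as a cube of surgeries. -/
def khModel [Coalgebra K R] [FrobeniusAlgebra K R] {ω ω' : R} (hω : ω * ω' = 1)
    (hc : Coalgebra.comul (R := K) (1 : R) =
      (ω ⊗ₜ[K] (1 : R)) * (g.gen ⊗ₜ 1 + 1 ⊗ₜ g.gen - algebraMap K R g.tr ⊗ₜ 1)) :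
    CubeModel o p R (o.KH p g) where
  part := o.khPart p g
  rep := o.khRep p g
  surg := o.khSurg p g hD
  one := o.khOne p g
  proj := o.khProj p g hD
  κ := ((o.baseSign p : ℤ) : R) * g.beta
  u₀ := g.twist (o.baseSign p) ω
  u₁ := algebraMap K R (g.coord ω).2
  v₀ := g.twist (o.baseSign p) ω'
  v₁ := algebraMap K R (g.coord ω').2
  sgn := contractionSign
  part_rep a d := by
    ext v
    funext s
    exact (mul_smul_comm (a s) (o.khPoly p g s (.X d)) (v s)).symm
  surg_part x a := by
    ext v
    funext s
    exact map_zsmul (D.surgery K R (flip s x) s x) _ _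
  part_one a s := by
    funext s'
    rw [khPart_apply]
    change _ = a s • o.khOne p g s s'
    by_cases h : s' = s
    · rw [h]
    · rw [khOne_of_ne _ _ _ h]
      exact (smul_zero (a s')).trans (smul_zero (a s)).symm
  surg_rep := o.khSurg_rep p g hD
  rep_circ s d d' h := by
    funext s'
    rw [khRep_apply, khRep_apply, khPoly_X, khPoly_X]
    by_cases hs : s' = s
    · rw [hs, h]
    · rw [khOne_of_ne _ _ _ hs, mul_zero, mul_zero]
  rep_sq d := by
    ext v
    funext s
    change o.khPoly p g s (.X d) * (o.khPoly p g s (.X d) * v s) =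
      -(D.factor K R s (D.circ s p) _ * (o.khPoly p g s (.X d) * v s))
    rw [khPoly_X, g.twist_beta]
    have e1 := congrArg (D.factor K R s (D.circ s d)) g.gen_sq
    have e2 := congrArg (D.factor K R s (D.circ s p)) g.gen_sq
    simp only [map_mul, map_sub, AlgHom.commutes] at e1 e2
    simp only [RankTwoGenerator.beta, RankTwoGenerator.genBar, map_sub, AlgHom.commutes]
    linear_combination (v s) * (e1 - e2)
  rep_base := by
    ext v
    funext s
    rw [khRep_apply, khPoly_X, sub_self, zero_mul]
    rfl
  surg_one_joined s x h := by
    funext s'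
    rw [khRep_apply]
    refine o.khSurg_one p g hD s x (y := fun s' => o.khPoly p g s' _) ?_ s'
    have hκ : o.khPoly p g (flip s x) (C (((o.baseSign p : ℤ) : R) * g.beta)) =
        D.factor K R (flip s x) (D.circ (flip s x) p) g.beta := by
      rw [khPoly_C, g.twist_beta]
    rw [surgery_one_of_joined _ _ h, hc, map_mul (o.khPoly p g _), map_add (o.khPoly p g _),
      map_add (o.khPoly p g _) (C _ + _), map_add (o.khPoly p g _) (C (_ * g.beta)), hκ]
    simp only [map_mul, map_add, map_sub, Algebra.TensorProduct.productMap_apply_tmul, map_one,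
      mul_one, one_mul, khPoly_X, khPoly_C, g.twist_twist, AlgHom.commutes]
    have e0 := congrArg (D.factor K R (flip s x) (D.circ (flip s x) (.inl (x, 0))))
      (g.coord_spec ω)
    have e1 := congrArg (D.factor K R (flip s x) (D.circ (flip s x) p)) (g.coord_spec ω)
    simp only [map_add, map_mul, AlgHom.commutes] at e0 e1
    simp only [RankTwoGenerator.beta, RankTwoGenerator.genBar, map_sub, AlgHom.commutes]
    rw [← e0, ← e1]
    ring
  surg_one s x h := by
    funext s'
    rw [o.khSurg_one p g hD s x (y := fun s' => 1) (surgery_one_of_not_joined _ _ h), one_mul]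
  span := o.kh_span p g
  unit₀ := by rw [← map_mul, hω, map_one]
  unit₁ := by
    have hb := g.two_mul_twist_gen (o.baseSign p)
    have e1 := congrArg (g.twist (o.baseSign p)) (g.coord_spec ω)
    have e2 := congrArg (g.twist (o.baseSign p)) (g.coord_spec ω')
    simp only [map_add, map_mul, AlgHom.commutes] at e1 e2
    have hs := g.gen_sq
    have h1 := g.coord_eq (u := (1 : R)) (a := 1) (b := 0) (by simp)
    have h2 := g.coord_eq (u := (1 : R))
      (a := (g.coord ω).1 * (g.coord ω').1 - (g.coord ω).2 * (g.coord ω').2 * g.nm)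
      (b := (g.coord ω).1 * (g.coord ω').2 + (g.coord ω).2 * (g.coord ω').1
        + (g.coord ω).2 * (g.coord ω').2 * g.tr) (by
        rw [← hω]
        conv_rhs => rw [← g.coord_spec ω, ← g.coord_spec ω']
        simp only [map_add, map_mul, map_sub]
        linear_combination
          (-(algebraMap K R (g.coord ω).2 * algebraMap K R (g.coord ω').2)) * hs)
    have h3 := congrArg (fun z : K × K => algebraMap K R z.2) (h1.symm.trans h2)
    simp only [map_add, map_mul, map_zero] at h3
    rw [← e1, ← e2]
    linear_combination (algebraMap K R (g.coord ω).2 * algebraMap K R (g.coord ω').2) * hb - h3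
  proj_rep d v σ := by
    change o.khPhi p g _ σ = _ * o.khPhi p g v σ
    rw [khPhi_apply, khPhi_apply, khRep_apply, khPoly_X, sub_mul, map_sub,
      khEval_factor_mul o p g hD, khEval_base_mul o p g hD, ← sub_mul]
    have h : g.twist (o.baseSign p * o.colour σ.1 d) g.gen - g.twist (o.baseSign p) g.gen =
        colourValue (((o.baseSign p : ℤ) : R) * g.beta) (o.colour σ.1 d) := by
      rcases Int.units_eq_one_or (o.colour σ.1 d) with h | h
      · rw [h, mul_one, sub_self, colourValue, if_pos rfl]
      · rw [h, mul_neg, mul_one, g.twist_gen_neg, colourValue, if_neg (by decide)]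
    rw [h]
    exact (mul_smul_comm _ _ _).symm
  proj_one s σ := by
    change o.khPhi p g _ σ = _
    rw [khPhi_apply]
    split_ifs with h
    · rw [← h, khOne_same, khEval, PiTensorProduct.lift_mkPiAlgebra_one]
      simp
    · rw [khOne_of_ne _ _ _ h, map_zero, smul_zero]

omit hD

/-- The grading of `KH(D,p,R)` by additive subgroups. -/
def khGrading (n : ℤ) : AddSubgroup (o.KH p g) where
  carrier := o.khHomogeneous p g n
  add_mem' {v w} hv hw s hs := by
    by_cases h : v s = 0
    · refine hw s fun h' => hs ?_
      rw [kh_add_apply, h, h', add_zero]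
    · exact hv s h
  zero_mem' s hs := absurd rfl hs
  neg_mem' {v} hv s hs := hv s fun h => hs (by
    change -v s = 0
    rw [h, neg_zero])

theorem isHomogeneousEnd_khRep (f : MvPolynomial (Dart X V) R) :
    IsHomogeneousEnd (o.khGrading p g) 0 (o.khRep p g f) := fun n v hv s hs => by
  rw [add_zero]
  exact hv s fun h => hs (by rw [khRep_apply, h, mul_zero])

include hD

theorem khModel_edge [Coalgebra K R] [FrobeniusAlgebra K R] {ω ω' : R} (hω : ω * ω' = 1)
    (hc : Coalgebra.comul (R := K) (1 : R) =
      (ω ⊗ₜ[K] (1 : R)) * (g.gen ⊗ₜ 1 + 1 ⊗ₜ g.gen - algebraMap K R g.tr ⊗ₜ 1)) (e : ℤˣ) (x : X)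
    (v : o.KH p g) (s : X → ℤˣ) : (o.khModel p g hD hω hc).edge e x v s =
      wedgeFun e x s • D.surgery K R (flip s x) s x (v (flip s x)) := rfl

theorem khModel_isGraded [Coalgebra K R] [FrobeniusAlgebra K R] {ω ω' : R} (hω : ω * ω' = 1)
    (hc : Coalgebra.comul (R := K) (1 : R) =
      (ω ⊗ₜ[K] (1 : R)) * (g.gen ⊗ₜ 1 + 1 ⊗ₜ g.gen - algebraMap K R g.tr ⊗ₜ 1)) :
    (o.khModel p g hD hω hc).IsGraded (o.khGrading p g) (-1) 0 := by
  have hedge : ∀ (e : ℤˣ) x, IsHomogeneousEnd (o.khGrading p g) (e : ℤ)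
      ((o.khModel p g hD hω hc).edge e x) := fun e x n v hv s hs => by
    rw [khModel_edge] at hs
    have hw : wedgeFun e x s ≠ 0 := fun h => hs (by rw [h, zero_smul])
    have hv' : v (flip s x) ≠ 0 := fun h => hs (by rw [h, map_zero]; exact smul_zero (wedgeFun e x s))
    rw [o.stateDegree_flip_of_wedgeFun_ne hw, hv _ hv']
  refine ⟨fun x => hedge (-1) x, fun x => hedge 1 x, fun d => o.isHomogeneousEnd_khRep p g _, ?_,
    fun d => o.isHomogeneousEnd_khRep p g _⟩
  rw [← (o.khModel p g hD hω hc).rep_C]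
  exact o.isHomogeneousEnd_khRep p g _

theorem khModel_diff [Coalgebra K R] [FrobeniusAlgebra K R] {ω ω' : R} (hω : ω * ω' = 1)
    (hc : Coalgebra.comul (R := K) (1 : R) =
      (ω ⊗ₜ[K] (1 : R)) * (g.gen ⊗ₜ 1 + 1 ⊗ₜ g.gen - algebraMap K R g.tr ⊗ₜ 1)) :
    ⇑(o.khModel p g hD hω hc).diff = o.khD p g := by
  funext v s
  rw [CubeModel.diff, LinearMap.sum_apply]
  have h : (∑ x, (o.khModel p g hD hω hc).edge (-1) x v) s =
      ∑ x, (o.khModel p g hD hω hc).edge (-1) x v s :=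
    Finset.sum_apply (M := fun s => D.Phi K R s) s Finset.univ _
  rw [h]
  refine Finset.sum_congr rfl fun x _ => ?_
  rw [khModel_edge, wedgeFun]
  split_ifs with hx
  · have : flip s x = Function.update s x 1 := by rw [flip, hx, neg_neg]
    rw [this]
  · rw [zero_smul]

theorem kh_main [Coalgebra K R] [FrobeniusAlgebra K R] :
    IsDifferential R (o.khHomogeneous p g) (-1) (o.khD p g) ∧
      ∃ h : IsMorphismToZeroComplex R (o.khHomogeneous p g) (o.eHomogeneous p R) (o.khD p g)
          (o.khPhi p g),
        Function.Surjective (o.khPhi p g) ∧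
        HomotopicallyNilpotentOn (o.khHomogeneous p g) (-1) (o.khD p g) h.ker g.beta 0 := by
  obtain ⟨ω, ω', hω, hc⟩ := g.exists_comul_one
  rw [← o.khModel_diff p g hD hω hc]
  refine CubeModel.IsGraded.main hD (o.khModel_isGraded p g hD hω hc) (𝓔 := o.eHomogeneous p R)
    (fun n v hv σ hσ => ?_) (ν := ((o.baseSign p : ℤ) : R)) ?_ ?_
  · rw [changeDegree_eq]
    refine hv _ fun h => hσ ?_
    change o.khPhi p g v σ = 0
    rw [khPhi_apply, h, map_zero, smul_zero]
  · change g.beta = _ * (_ * g.beta)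
    rw [← mul_assoc, ← Int.cast_mul, ← Units.val_mul, Int.units_mul_self]
    simp
  · rw [← (o.khModel p g hD hω hc).rep_C]
    exact o.isHomogeneousEnd_khRep p g _

end Orientation

end LinkDiagram

namespace LinkDiagram

variable {X V F : Type} [Fintype X] [LinearOrder X] [Fintype V] [Fintype F]
variable {D : LinkDiagram X V F} {s : X → ℤˣ} {x : X}

/-- The components of `D_s` which do not pass near `x`. -/
def remote (D : LinkDiagram X V F) (s : X → ℤˣ) (x : X) : Finset (D.Circ s) :=
  Finset.univ.filter fun c => c ≠ D.circ s (.inl (x, 0)) ∧ c ≠ D.circ s (.inl (x, 2))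

theorem circ_mem_remote {d : Dart X V} : D.circ s d ∈ D.remote s x ↔ ¬ D.Near s x d := by
  simp [remote, Near, not_or]

@[to_additive]
theorem prod_circ_of_joined {M : Type*} [CommMonoid M] (h : D.Joined s x) (g : D.Circ s → M) :
    ∏ c, g c = g (D.circ s (.inl (x, 0))) * ∏ c ∈ D.remote s x, g c := by
  rw [← Finset.mul_prod_erase _ _ (Finset.mem_univ (D.circ s (.inl (x, 0))))]
  congr 1
  refine Finset.prod_congr ?_ fun _ _ => rfl
  ext c
  simp [remote, ← show D.circ s (.inl (x, 0)) = D.circ s (.inl (x, 2)) from h]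

@[to_additive]
theorem prod_circ_of_not_joined {M : Type*} [CommMonoid M] (h : ¬ D.Joined s x)
    (g : D.Circ s → M) : ∏ c, g c =
      g (D.circ s (.inl (x, 0))) * g (D.circ s (.inl (x, 2))) * ∏ c ∈ D.remote s x, g c := by
  rw [← Finset.mul_prod_erase _ _ (Finset.mem_univ (D.circ s (.inl (x, 0)))),
    ← Finset.mul_prod_erase _ _ (a := D.circ s (.inl (x, 2))), mul_assoc]
  · congr 2
    refine Finset.prod_congr ?_ fun _ _ => rfl
    ext c
    simp [remote, and_comm]
  · simpa using fun h' => h (Eq.symm h')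

theorem circ_out_flip {d : Dart X V} (h : ¬ D.Near s x d) :
    D.circ (flip s x) (Quot.out (D.circ s d)) = D.circ (flip s x) d :=
  (circ_flip_of_not_near (circ_out (D.circ s d)).symm h).symm

theorem circ_flip_out {d : Dart X V} (h : ¬ D.Near s x d) :
    D.circ s (Quot.out (D.circ (flip s x) d)) = D.circ s d := by
  have := circ_out_flip (s := flip s x) (x := x) (D := D) (d := d) (by rwa [near_flip_iff])
  rwa [flip_flip] at this

@[to_additive]
theorem prod_remote_flip {M : Type*} [CommMonoid M] {g : D.Circ s → M}
    {g' : D.Circ (flip s x) → M}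
    (h : ∀ d, ¬ D.Near s x d → g (D.circ s d) = g' (D.circ (flip s x) d)) :
    ∏ c ∈ D.remote s x, g c = ∏ c ∈ D.remote (flip s x) x, g' c := by
  have hn : ∀ c : D.Circ s, c ∈ D.remote s x → ¬ D.Near s x (Quot.out c) := fun c hc => by
    rwa [← circ_mem_remote, circ_out]
  have hn' : ∀ c : D.Circ (flip s x), c ∈ D.remote (flip s x) x → ¬ D.Near s x (Quot.out c) :=
    fun c hc => by rwa [← near_flip_iff, ← circ_mem_remote, circ_out]
  refine Finset.prod_bij' (fun c _ => D.circ (flip s x) (Quot.out c))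
    (fun c _ => D.circ s (Quot.out c)) (fun c hc => ?_) (fun c hc => ?_) (fun c hc => ?_)
    (fun c hc => ?_) (fun c hc => ?_)
  · rw [circ_mem_remote, near_flip_iff]
    exact hn c hc
  · rw [circ_mem_remote]
    exact hn' c hc
  · rw [circ_flip_out (hn c hc), circ_out]
  · rw [circ_out_flip (hn' c hc), circ_out]
  · rw [← h _ (hn c hc), circ_out]

/-- The maps on the components of `D_s` and `D_{flip s x}` agree away from `x`. -/
def Agree (x : X) (l : D.Circ s → ℤˣ) (l' : D.Circ (flip s x) → ℤˣ) : Prop :=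
  ∀ d, ¬ D.Near s x d → l' (D.circ (flip s x) d) = l (D.circ s d)

/-- The map on the components of `D_{flip s x}` with given values near `x` which agrees with `l`
away from `x`. -/
def glue (x : X) (l : D.Circ s → ℤˣ) (j k : ℤˣ) : D.Circ (flip s x) → ℤˣ := fun c =>
  if c = D.circ _ (.inl (x, 0)) then j else if c = D.circ _ (.inl (x, 2)) then k
  else l (D.circ s (Quot.out c))

theorem glue_zero (l : D.Circ s → ℤˣ) (j k : ℤˣ) :
    glue x l j k (D.circ (flip s x) (.inl (x, 0))) = j := if_pos rfl

theorem glue_two (h : ¬ D.Joined (flip s x) x) (l : D.Circ s → ℤˣ) (j k : ℤˣ) :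
    glue x l j k (D.circ (flip s x) (.inl (x, 2))) = k := by
  rw [glue, if_neg fun h' => h (Eq.symm h'), if_pos rfl]

theorem agree_glue (l : D.Circ s → ℤˣ) (j k : ℤˣ) : Agree x l (glue x l j k) := fun d hd => by
  have h := hd
  rw [← near_flip_iff, Near, not_or] at h
  rw [glue, if_neg h.1, if_neg h.2, circ_flip_out hd]

theorem Agree.eq_glue {l : D.Circ s → ℤˣ} {l' : D.Circ (flip s x) → ℤˣ} (h : Agree x l l') :
    l' = glue x l (l' (D.circ _ (.inl (x, 0)))) (l' (D.circ _ (.inl (x, 2)))) := by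
  funext c
  rw [glue]
  split_ifs with h0 h2
  · rw [h0]
  · rw [h2]
  · rw [← h _, circ_out]
    rw [← near_flip_iff, Near, circ_out, not_or]
    exact ⟨h0, h2⟩

theorem sum_agree_of_not_joined {B : Type*} [AddCommMonoid B] (h : ¬ D.Joined (flip s x) x)
    (l : D.Circ s → ℤˣ) (G : (D.Circ (flip s x) → ℤˣ) → B) :
    (∑ l', if Agree x l l' then G l' else 0) = ∑ jk : ℤˣ × ℤˣ, G (glue x l jk.1 jk.2) := by
  rw [← Finset.sum_filter]
  refine Finset.sum_bij' (fun l' _ => (l' (D.circ _ (.inl (x, 0))), l' (D.circ _ (.inl (x, 2)))))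
    (fun jk _ => glue x l jk.1 jk.2) (fun _ _ => Finset.mem_univ _)
    (fun jk _ => Finset.mem_filter.2 ⟨Finset.mem_univ _, agree_glue _ _ _⟩)
    (fun l' hl' => (Finset.mem_filter.1 hl').2.eq_glue.symm) (fun jk _ => ?_) (fun l' hl' => ?_)
  · rw [glue_zero, glue_two h]
  · rw [← (Finset.mem_filter.1 hl').2.eq_glue]

theorem sum_agree_of_joined {B : Type*} [AddCommMonoid B] (h : D.Joined (flip s x) x)
    (l : D.Circ s → ℤˣ) (G : (D.Circ (flip s x) → ℤˣ) → B) :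
    (∑ l', if Agree x l l' then G l' else 0) = ∑ k : ℤˣ, G (glue x l k k) := by
  have heq : ∀ l' : D.Circ (flip s x) → ℤˣ, Agree x l l' →
      l' = glue x l (l' (D.circ _ (.inl (x, 0)))) (l' (D.circ _ (.inl (x, 0)))) := fun l' hl' => by
    have h1 := hl'.eq_glue
    rwa [← show D.circ (flip s x) (.inl (x, 0)) = D.circ _ (.inl (x, 2)) from h] at h1
  rw [← Finset.sum_filter]
  refine Finset.sum_bij' (fun l' _ => l' (D.circ _ (.inl (x, 0))))
    (fun k _ => glue x l k k) (fun _ _ => Finset.mem_univ _)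
    (fun jk _ => Finset.mem_filter.2 ⟨Finset.mem_univ _, agree_glue _ _ _⟩)
    (fun l' hl' => (heq l' (Finset.mem_filter.1 hl').2).symm) (fun k _ => glue_zero l k k)
    (fun l' hl' => ?_)
  rw [← heq l' (Finset.mem_filter.1 hl').2]

/-- The values of `b` at two half-edges of the same component of `D_s` are equal. -/
def IsColouring (s : X → ℤˣ) (D : LinkDiagram X V F) (b : Dart X V → ℤˣ) : Prop :=
  ∀ d d', D.circ s d = D.circ s d' → b d = b d'

theorem IsColouring.out {b : Dart X V → ℤˣ} (hb : IsColouring s D b) (d : Dart X V) :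
    b (Quot.out (D.circ s d)) = b d := hb _ _ (circ_out _)

theorem IsColouring.of_joined_flip {b : Dart X V → ℤˣ} (hb : IsColouring (flip s x) D b)
    (h : D.Joined (flip s x) x) : IsColouring s D b :=
  fun _ _ hd => hb _ _ (circ_flip_of_joined h hd)

theorem IsColouring.of_eq {b : Dart X V → ℤˣ} (hb : IsColouring (flip s x) D b)
    (h : b (.inl (x, 0)) = b (.inl (x, 2))) : IsColouring s D b := fun d d' hd => by
  rcases circ_flip_or x hd with h' | ⟨h' | h', h'' | h''⟩
  · exact hb _ _ h'
  all_goals rw [hb _ _ h', hb _ _ h'']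
  · exact h
  · exact h.symm

section Weight

variable {B : Type*} [CommRing B] (w : ℤˣ → ℤˣ → B) (b : Dart X V → ℤˣ)

/-- The product of the weights `w a i` of the components of `D_s`, where `a` and `i` are the
values of `b` and `l`. -/
def weight (l : D.Circ s → ℤˣ) : B := ∏ c : D.Circ s, w (b (Quot.out c)) (l c)

variable {w b}

theorem prod_remote_weight (hb : IsColouring (flip s x) D b) {l : D.Circ s → ℤˣ}
    {l' : D.Circ (flip s x) → ℤˣ} (h : Agree x l l') :
    ∏ c ∈ D.remote s x, w (b (Quot.out c)) (l c) =
      ∏ c ∈ D.remote (flip s x) x, w (b (Quot.out c)) (l' c) :=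
  prod_remote_flip fun d hd => by rw [hb _ _ (circ_out_flip hd), h d hd, hb.out]

theorem sum_agree_weight_of_not_joined (h : ¬ D.Joined (flip s x) x)
    (hb : IsColouring (flip s x) D b) (l : D.Circ s → ℤˣ) (S : ℤˣ → ℤˣ → B) :
    (∑ l', (if Agree x l l' then S (l' (D.circ _ (.inl (x, 0)))) (l' (D.circ _ (.inl (x, 2))))
      else 0) * weight w b l') =
      (∑ jk : ℤˣ × ℤˣ, S jk.1 jk.2 * (w (b (.inl (x, 0))) jk.1 * w (b (.inl (x, 2))) jk.2)) *
        ∏ c ∈ D.remote s x, w (b (Quot.out c)) (l c) := by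
  simp only [ite_mul, zero_mul]
  rw [sum_agree_of_not_joined h l fun l' =>
    S (l' (D.circ _ (.inl (x, 0)))) (l' (D.circ _ (.inl (x, 2)))) * weight w b l', Finset.sum_mul]
  refine Finset.sum_congr rfl fun jk _ => ?_
  rw [weight, prod_circ_of_not_joined h, glue_zero, glue_two h, hb.out, hb.out,
    ← prod_remote_weight hb (agree_glue l jk.1 jk.2)]
  ring

theorem sum_agree_weight_of_joined (h : D.Joined (flip s x) x)
    (hb : IsColouring (flip s x) D b) (l : D.Circ s → ℤˣ) (S : ℤˣ → B) :
    (∑ l', (if Agree x l l' then S (l' (D.circ _ (.inl (x, 0)))) else 0) * weight w b l') =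
      (∑ k, S k * w (b (.inl (x, 0))) k) *
        ∏ c ∈ D.remote s x, w (b (Quot.out c)) (l c) := by
  simp only [ite_mul, zero_mul]
  rw [sum_agree_of_joined h l fun l' => S (l' (D.circ _ (.inl (x, 0)))) * weight w b l',
    Finset.sum_mul]
  refine Finset.sum_congr rfl fun k _ => ?_
  rw [weight, prod_circ_of_joined h, glue_zero, hb.out,
    ← prod_remote_weight hb (agree_glue l k k), mul_assoc]

theorem sum_update_weight (hb : IsColouring s D b) (d : Dart X V) (l : D.Circ s → ℤˣ)
    (S : ℤˣ → B) :
    (∑ l', (if ∀ d', D.circ s d' ≠ D.circ s d → l (D.circ s d') = l' (D.circ s d') then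
      S (l' (D.circ s d)) else 0) * weight w b l') =
      (∑ k, S k * w (b d) k) *
        ∏ c ∈ Finset.univ.erase (D.circ s d), w (b (Quot.out (c : D.Circ s))) (l c) := by
  simp only [ite_mul, zero_mul]
  rw [← Finset.sum_filter, Finset.sum_mul]
  refine Finset.sum_bij' (fun l' _ => l' (D.circ s d)) (fun k _ => Function.update l (D.circ s d) k)
    (fun _ _ => Finset.mem_univ _) (fun k _ => ?_) (fun l' hl' => ?_) (fun k _ => ?_)
    (fun l' hl' => ?_)
  · refine Finset.mem_filter.2 ⟨Finset.mem_univ _, fun d' hd' => ?_⟩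
    rw [Function.update_of_ne hd']
  · funext c
    by_cases hc : c = D.circ s d
    · rw [hc, Function.update_self]
    · rw [Function.update_of_ne hc]
      have := (Finset.mem_filter.1 hl').2 (Quot.out c) (by rwa [circ_out])
      rwa [circ_out] at this
  · rw [Function.update_self]
  · rw [weight, ← Finset.mul_prod_erase _ _ (Finset.mem_univ (D.circ s d)), hb.out, ← mul_assoc]
    congr 1
    refine Finset.prod_congr rfl fun c hc => ?_
    have := (Finset.mem_filter.1 hl').2 (Quot.out c)
      (by rw [circ_out]; exact Finset.ne_of_mem_erase hc)
    rw [circ_out] at this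
    rw [this]

theorem weight_eq_mul_erase (hb : IsColouring s D b) (d : Dart X V) (l : D.Circ s → ℤˣ) :
    weight w b l = w (b d) (l (D.circ s d)) *
      ∏ c ∈ Finset.univ.erase (D.circ s d), w (b (Quot.out (c : D.Circ s))) (l c) := by
  rw [weight, ← Finset.mul_prod_erase _ _ (Finset.mem_univ (D.circ s d)), hb.out]

theorem weight_of_joined (h : D.Joined s x) (hb : IsColouring s D b) (l : D.Circ s → ℤˣ) :
    weight w b l = w (b (.inl (x, 0))) (l (D.circ s (.inl (x, 0)))) *
      ∏ c ∈ D.remote s x, w (b (Quot.out c)) (l c) := by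
  rw [weight, prod_circ_of_joined h, hb.out]

theorem weight_of_not_joined (h : ¬ D.Joined s x) (hb : IsColouring s D b)
    (l : D.Circ s → ℤˣ) : weight w b l =
      w (b (.inl (x, 0))) (l (D.circ s (.inl (x, 0)))) *
        w (b (.inl (x, 2))) (l (D.circ s (.inl (x, 2)))) *
      ∏ c ∈ D.remote s x, w (b (Quot.out c)) (l c) := by
  rw [weight, prod_circ_of_not_joined h, hb.out, hb.out]

/-- The sum of a function on the maps of value `1` at the component of `p`. -/
theorem sum_reduced {p : Dart X V} {f : (D.Circ s → ℤˣ) → B}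
    (h : ∀ l, l (D.circ s p) ≠ 1 → f l = 0) :
    ∑ l : {l : D.Circ s → ℤˣ // l (D.circ s p) = 1}, f l.1 = ∑ l, f l := by
  rw [← Finset.sum_subtype (Finset.univ.filter fun l : D.Circ s → ℤˣ => l (D.circ s p) = 1)
    (by simp) f, Finset.sum_filter]
  refine Finset.sum_congr rfl fun l _ => ?_
  split_ifs with hl
  · rfl
  · exact (h l hl).symm

theorem sum_prod_circ (f : D.Circ s → ℤˣ → B) :
    ∑ l : D.Circ s → ℤˣ, ∏ c, f c (l c) = ∏ c, ∑ k, f c k := by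
  rw [Finset.prod_univ_sum, Fintype.piFinset_univ]

end Weight

end LinkDiagram

open MvPolynomial (C)

theorem Int.sum_units {M : Type*} [AddCommMonoid M] (f : ℤˣ → M) : ∑ k, f k = f 1 + f (-1) := by
  rw [UnitsInt.univ, Finset.sum_pair (by decide)]

theorem CoeffA.one_sub_mul_θinv : (1 - CoeffA.t * CoeffA.δ) * CoeffA.θinv = 1 := by
  have h : (1 - CoeffA.t * CoeffA.δ) = algebraMap PolyTD CoeffA polyTheta := by
    simp [polyTheta, CoeffA.t, CoeffA.δ]
  rw [h]
  exact IsLocalization.Away.mul_invSelf _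

namespace LinkDiagram

variable {X V F : Type} [Fintype X] [LinearOrder X] [Fintype V] [Fintype F]
variable {D : LinkDiagram X V F} {s : X → ℤˣ} {x : X} {p : Dart X V}
variable {B : Type*} [CommRing B] (η : CoeffA →+* B)

/-- The image of `θ⁻¹ δ`. -/
def redKappa : B := η (CoeffA.θinv * CoeffA.δ)

/-- The value of the basis element of sign `l` at the colour `a`. -/
def redValue (a l : ℤˣ) : B :=
  if a = 1 then (if l = 1 then 1 else 0) else (if l = 1 then η CoeffA.θinv else -redKappa η)

/-- The value of a splitting between edges of colours `a` and `a'`. -/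
def splitValue (a a' : ℤˣ) : B :=
  if a = a' then (if a = 1 then η CoeffA.δ else -redKappa η) else 0

theorem map_one_sub_mul_θinv : (1 - η CoeffA.t * η CoeffA.δ) * η CoeffA.θinv = 1 := by
  rw [← map_mul, ← map_one η, ← map_sub, ← map_mul, CoeffA.one_sub_mul_θinv]

theorem sum_mergeCoeff (i j a : ℤˣ) : ∑ k, η (mergeCoeff i j k) * redValue η a k =
    redValue η a i * redValue η a j := by
  have h := map_one_sub_mul_θinv η
  have hn : ¬ ((-1 : ℤˣ) = 1) := by decide
  have hn' : ¬ ((1 : ℤˣ) = -1) := by decide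
  rw [Int.sum_units]
  rcases Int.units_eq_one_or i with rfl | rfl <;> rcases Int.units_eq_one_or j with rfl | rfl <;>
    rcases Int.units_eq_one_or a with rfl | rfl <;>
    simp only [mergeCoeff, redValue, redKappa, hn, hn', if_true, if_false, and_self, and_false,
      false_and, map_one, map_zero, map_neg, map_mul] <;>
    first
    | ring1
    | linear_combination (-η CoeffA.θinv) * h

theorem sum_splitCoeff (i a a' : ℤˣ) : ∑ jk : ℤˣ × ℤˣ, η (splitCoeff i jk.1 jk.2) *
    (redValue η a jk.1 * redValue η a' jk.2) = splitValue η a a' * redValue η a i := by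
  have hn : ¬ ((-1 : ℤˣ) = 1) := by decide
  have hn' : ¬ ((1 : ℤˣ) = -1) := by decide
  rw [Fintype.sum_prod_type, Int.sum_units, Int.sum_units, Int.sum_units]
  rcases Int.units_eq_one_or i with rfl | rfl <;> rcases Int.units_eq_one_or a with rfl | rfl <;>
    rcases Int.units_eq_one_or a' with rfl | rfl <;>
    simp only [splitCoeff, redValue, redKappa, splitValue, hn, hn', if_true, if_false, and_self,
      and_false, false_and, map_one, map_zero, map_mul] <;>
    ring

theorem redValue_neg_one (a : ℤˣ) : redValue η a (-1) = colourValue (redKappa η) a := by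
  rcases Int.units_eq_one_or a with rfl | rfl <;> simp [redValue, colourValue]

theorem redValue_one (a : ℤˣ) :
    redValue η a 1 = 1 - η CoeffA.t * colourValue (redKappa η) a := by
  have h := map_one_sub_mul_θinv η
  rcases Int.units_eq_one_or a with rfl | rfl
  · simp [redValue, colourValue]
  · simp only [redValue, colourValue, redKappa, if_neg (show ¬ ((-1 : ℤˣ) = 1) by decide), if_true,
      map_mul]
    linear_combination h

theorem redWeight_eq (o : D.Orientation) (a l : ℤˣ) :
    η (o.redWeight p (o.baseSign p * a) l) = redValue η a l := by
  simp only [Orientation.redWeight, mul_eq_left, redValue, redKappa]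
  split_ifs <;> simp

/-- Functions on a cube are determined by their evaluations at the colourings. -/
theorem eq_zero_of_sum_redValue [IsDomain B] (hη : η CoeffA.δ ≠ 0) {ι : Type*} [Fintype ι]
    {f : (ι → ℤˣ) → B} (h : ∀ a : ι → ℤˣ, ∑ l, f l * ∏ c, redValue η (a c) (l c) = 0)
    (l : ι → ℤˣ) : f l = 0 := by
  have hκ : redKappa η ≠ 0 := by
    rw [redKappa, map_mul]
    exact mul_ne_zero (right_ne_zero_of_mul_eq_one (map_one_sub_mul_θinv η)) hη
  let u : ℤˣ → ℤˣ → B := fun l a => if l = 1 then (if a = 1 then -redKappa η else 0)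
    else (if a = 1 then -η CoeffA.θinv else 1)
  have hu : ∀ l l' : ℤˣ, ∑ a, u l a * redValue η a l' = if l = l' then -redKappa η else 0 := by
    intro l l'
    have hn : ¬ ((-1 : ℤˣ) = 1) := by decide
    have hn' : ¬ ((1 : ℤˣ) = -1) := by decide
    rw [Int.sum_units]
    rcases Int.units_eq_one_or l with rfl | rfl <;>
      rcases Int.units_eq_one_or l' with rfl | rfl <;>
      simp only [u, redValue, hn, hn', if_true, if_false] <;> ring
  have key : ∑ a : ι → ℤˣ, (∏ c, u (l c) (a c)) * ∑ l', f l' * ∏ c, redValue η (a c) (l' c) =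
      f l * (-redKappa η) ^ Fintype.card ι := by
    simp_rw [Finset.mul_sum]
    rw [Finset.sum_comm]
    have h1 : ∀ l', ∑ a : ι → ℤˣ, (∏ c, u (l c) (a c)) * (f l' * ∏ c, redValue η (a c) (l' c)) =
        f l' * ∏ c, if l c = l' c then -redKappa η else 0 := fun l' => by
      simp_rw [← hu]
      rw [Finset.prod_univ_sum, Fintype.piFinset_univ, Finset.mul_sum]
      refine Finset.sum_congr rfl fun a _ => ?_
      rw [Finset.prod_mul_distrib]
      ring
    simp_rw [h1]
    rw [Finset.sum_eq_single l]
    · simp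
    · intro l' _ hl'
      obtain ⟨c, hc⟩ := Function.ne_iff.1 hl'
      rw [Finset.prod_eq_zero (Finset.mem_univ c) (if_neg (Ne.symm hc)), mul_zero]
    · simp
  simp_rw [h, mul_zero, Finset.sum_const_zero] at key
  exact (mul_eq_zero.1 key.symm).resolve_right (pow_ne_zero _ (neg_ne_zero.2 hκ))

/-- The evaluation at `b` of the component of index `s` of a vector. -/
def redEval (p : Dart X V) (s : X → ℤˣ) (b : Dart X V → ℤˣ) : (D.RedIndex p → B) →ₗ[B] B where
  toFun v := ∑ l : {l : D.Circ s → ℤˣ // l (D.circ s p) = 1}, v ⟨s, l⟩ * weight (redValue η) b l.1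
  map_add' v w := by
    simp_rw [Pi.add_apply, add_mul]
    exact Finset.sum_add_distrib
  map_smul' a v := by
    simp_rw [Pi.smul_apply, smul_eq_mul, RingHom.id_apply, Finset.mul_sum, mul_assoc]

theorem redEval_apply (s : X → ℤˣ) (b : Dart X V → ℤˣ) (v : D.RedIndex p → B) :
    redEval η p s b v = ∑ l : {l : D.Circ s → ℤˣ // l (D.circ s p) = 1},
      v ⟨s, l⟩ * weight (redValue η) b l.1 := rfl

theorem redEval_ext [IsDomain B] (hη : η CoeffA.δ ≠ 0) {v v' : D.RedIndex p → B}
    (h : ∀ s b, IsColouring s D b → b p = 1 → redEval η p s b v = redEval η p s b v') : v = v' := by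
  rw [← sub_eq_zero]
  have h' : ∀ s b, IsColouring s D b → b p = 1 → redEval η p s b (v - v') = 0 :=
    fun s b hb hp => by rw [map_sub, h s b hb hp, sub_self]
  funext ⟨s, l⟩
  let f : (D.Circ s → ℤˣ) → B := fun l =>
    if hl : l (D.circ s p) = 1 then (v - v') ⟨s, l, hl⟩ else 0
  have hf : ∀ a : D.Circ s → ℤˣ, a (D.circ s p) = 1 →
      ∑ l, f l * ∏ c, redValue η (a c) (l c) = 0 := fun a ha => by
    rw [← h' s (fun d => a (D.circ s d)) (fun d d' hd => by simp only [hd]) ha, redEval_apply,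
      ← sum_reduced (p := p)]
    · refine Finset.sum_congr rfl fun l _ => ?_
      simp only [f, dif_pos l.2, weight, circ_out]
    · intro l hl
      simp only [f, dif_neg hl, zero_mul]
  have hz : f l.1 = 0 := by
    refine eq_zero_of_sum_redValue η hη (fun a => ?_) l.1
    rcases Int.units_eq_one_or (a (D.circ s p)) with ha | ha
    · exact hf a ha
    · have h1 := hf (Function.update a (D.circ s p) 1) (Function.update_self _ _ _)
      have h2 : ∀ l, f l * ∏ c, redValue η (a c) (l c) = η CoeffA.θinv *
          (f l * ∏ c, redValue η (Function.update a (D.circ s p) 1 c) (l c)) := fun l => by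
        by_cases hl : l (D.circ s p) = 1
        · rw [← Finset.mul_prod_erase _ _ (Finset.mem_univ (D.circ s p)),
            ← Finset.mul_prod_erase Finset.univ
              (fun c => redValue η (Function.update a (D.circ s p) 1 c) (l c))
              (Finset.mem_univ (D.circ s p)), Function.update_self, hl, ha]
          have h3 : ∀ c ∈ Finset.univ.erase (D.circ s p),
              redValue η (Function.update a (D.circ s p) 1 c) (l c) = redValue η (a c) (l c) :=
            fun c hc => by rw [Function.update_of_ne (Finset.ne_of_mem_erase hc)]
          rw [Finset.prod_congr rfl h3]
          simp only [redValue, if_neg (show ¬ ((-1 : ℤˣ) = 1) by decide), if_true]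
          ring
        · simp only [f, dif_neg hl, zero_mul, mul_zero]
      simp_rw [h2]
      rw [← Finset.mul_sum, h1, mul_zero]
  simp only [f, dif_pos l.2] at hz
  exact hz

theorem redEval_mulVec (K : Matrix (D.RedIndex p) (D.RedIndex p) B) {s s' : X → ℤˣ}
    {b : Dart X V → ℤˣ} {μ : B}
    (h : ∀ i : D.RedIndex p, ∑ l : {l : D.Circ s' → ℤˣ // l (D.circ s' p) = 1},
      K ⟨s', l⟩ i * weight (redValue η) b l.1 =
        if i.1 = s then μ * weight (redValue η) b i.2.1 else 0) (v : D.RedIndex p → B) :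
    redEval η p s' b (K.mulVec v) = μ * redEval η p s b v := by
  have h1 : redEval η p s' b (K.mulVec v) =
      ∑ i : D.RedIndex p, v i * if i.1 = s then μ * weight (redValue η) b i.2.1 else 0 := by
    simp_rw [← h, redEval_apply, Matrix.mulVec, dotProduct, Finset.sum_mul, Finset.mul_sum]
    rw [Finset.sum_comm]
    refine Finset.sum_congr rfl fun i _ => Finset.sum_congr rfl fun l _ => ?_
    ring
  rw [h1, redEval_apply, Finset.mul_sum, Fintype.sum_sigma, Finset.sum_eq_single s]
  · refine Finset.sum_congr rfl fun l _ => ?_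
    rw [if_pos rfl]
    ring
  · intro s₀ _ hs
    refine Finset.sum_eq_zero fun l _ => ?_
    rw [if_neg hs, mul_zero]
  · simp

end LinkDiagram

open MvPolynomial (C)

open scoped IsMulCommutative in
/-- The action of polynomials through commuting endomorphisms. -/
def Module.End.polyRep {B M ι : Type*} [CommRing B] [AddCommGroup M] [Module B M]
    (f : ι → Module.End B M) (h : ∀ i j, f i * f j = f j * f i) :
    MvPolynomial ι B →ₐ[B] Module.End B M :=
  haveI : IsMulCommutative (Algebra.adjoin B (Set.range f)) := Algebra.isMulCommutative_adjoin B (by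
    rintro _ ⟨i, rfl⟩ _ ⟨j, rfl⟩
    exact h i j)
  (Algebra.adjoin B (Set.range f)).val.comp
    (MvPolynomial.aeval (S₁ := Algebra.adjoin B (Set.range f))
      fun i => ⟨f i, Algebra.subset_adjoin ⟨i, rfl⟩⟩)

open scoped IsMulCommutative in
theorem Module.End.polyRep_X {B M ι : Type*} [CommRing B] [AddCommGroup M] [Module B M]
    (f : ι → Module.End B M) (h : ∀ i j, f i * f j = f j * f i) (i : ι) :
    Module.End.polyRep f h (.X i) = f i := by
  simp [Module.End.polyRep]

namespace LinkDiagram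

variable {X V F : Type} [Fintype X] [LinearOrder X] [Fintype V] [Fintype F]
variable {D : LinkDiagram X V F} {s : X → ℤˣ} {x : X}

theorem redSurgery_eq (l : D.Circ s → ℤˣ) (l' : D.Circ (flip s x) → ℤˣ) :
    redSurgery x s (flip s x) l l' = if Agree x l l' then
      (if D.Joined s x then splitCoeff (l (D.circ s (.inl (x, 0)))) (l' (D.circ _ (.inl (x, 0))))
        (l' (D.circ _ (.inl (x, 2))))
      else mergeCoeff (l (D.circ s (.inl (x, 0)))) (l (D.circ s (.inl (x, 2))))
        (l' (D.circ _ (.inl (x, 0))))) else 0 := by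
  have h : (∀ d, D.circ s d ≠ D.circ s (.inl (x, 0)) → D.circ s d ≠ D.circ s (.inl (x, 2)) →
      l' (D.circ (flip s x) d) = l (D.circ s d)) ↔ Agree x l l' := by
    simp only [Agree, Near, not_or, and_imp, ne_eq]
  simp only [redSurgery, h]
  rfl

variable {B : Type*} [CommRing B] (η : CoeffA →+* B) (D) (p : Dart X V)

/-- The matrix of the surgery at `x`, in both directions. -/
def redSurgMatrix (x : X) : Matrix (D.RedIndex p) (D.RedIndex p) B := fun i' i =>
  if i.1 = flip i'.1 x then η (redSurgery x i.1 i'.1 i.2.1 i'.2.1) else 0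

/-- The matrix of the multiplication by the basis element of sign `-1` at the edge `d`. -/
def redEdgeMatrix (d : Dart X V) : Matrix (D.RedIndex p) (D.RedIndex p) B := fun i' i =>
  if i.1 = i'.1 ∧ ∀ d', D.circ i'.1 d' ≠ D.circ i'.1 d →
      i.2.1 (D.circ i.1 d') = i'.2.1 (D.circ i'.1 d') then
    η (mergeCoeff (-1) (i.2.1 (D.circ i.1 d)) (i'.2.1 (D.circ i'.1 d)))
  else 0

/-- The unit of the summand of index `s`. -/
def redOne (s : X → ℤˣ) : D.RedIndex p → B := fun i =>
  if i.1 = s then ∏ c, (if i.2.1 c = 1 then 1 else η CoeffA.t) else 0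

variable {D p}

/-- The value of a surgery at a colouring. -/
def surgValue (D : LinkDiagram X V F) (s : X → ℤˣ) (x : X) (b : Dart X V → ℤˣ) : B :=
  if D.Joined s x then splitValue η (b (.inl (x, 0))) (b (.inl (x, 2))) else 1

theorem weight_eq_zero {b : Dart X V → ℤˣ} (hb : IsColouring s D b) (hp : b p = 1)
    {l : D.Circ s → ℤˣ} (hl : l (D.circ s p) ≠ 1) : weight (redValue η) b l = 0 := by
  rw [weight_eq_mul_erase hb p, hp, redValue, if_pos rfl, if_neg hl, zero_mul]

theorem redEval_edge {b : Dart X V → ℤˣ} (hb : IsColouring s D b) (hp : b p = 1)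
    (d : Dart X V) (v : D.RedIndex p → B) :
    redEval η p s b ((redEdgeMatrix D η p d).mulVec v) =
      colourValue (redKappa η) (b d) * redEval η p s b v := by
  refine redEval_mulVec η _ (fun i => ?_) v
  obtain ⟨s₀, l₀⟩ := i
  split_ifs with hs
  · subst hs
    simp only [redEdgeMatrix, true_and]
    rw [sum_reduced (p := p) (f := fun l => (if ∀ d', D.circ s₀ d' ≠ D.circ s₀ d →
      l₀.1 (D.circ s₀ d') = l (D.circ s₀ d') then
        η (mergeCoeff (-1) (l₀.1 (D.circ s₀ d)) (l (D.circ s₀ d))) else 0) *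
          weight (redValue η) b l) fun l hl => by rw [weight_eq_zero η hb hp hl, mul_zero]]
    rw [sum_update_weight hb d l₀.1 fun k => η (mergeCoeff (-1) (l₀.1 (D.circ s₀ d)) k),
      sum_mergeCoeff, redValue_neg_one, weight_eq_mul_erase hb d, mul_assoc]
  · refine Finset.sum_eq_zero fun l _ => ?_
    rw [redEdgeMatrix, if_neg fun h => hs h.1, zero_mul]

variable (hD : D.Connected) (o : D.Orientation)
include hD o

theorem redEval_surg {b : Dart X V → ℤˣ} (hb : IsColouring (flip s x) D b) (hp : b p = 1)
    (v : D.RedIndex p → B) :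
    redEval η p (flip s x) b ((redSurgMatrix D η p x).mulVec v) =
      surgValue η D s x b * redEval η p s b v := by
  refine redEval_mulVec η _ (fun i => ?_) v
  obtain ⟨s₀, l₀⟩ := i
  split_ifs with hs
  · change s₀ = s at hs
    subst hs
    simp only [redSurgMatrix, flip_flip, if_true]
    rw [sum_reduced (p := p) (f := fun l => η (redSurgery x s₀ (flip s₀ x) l₀.1 l) *
      weight (redValue η) b l) fun l hl => by rw [weight_eq_zero η hb hp hl, mul_zero]]
    have hj := (isAlternating_checker hD o).joined_flip s₀ x
    simp only [redSurgery_eq, apply_ite η, map_zero]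
    by_cases h : D.Joined s₀ x
    · have h' : ¬ D.Joined (flip s₀ x) x := by rw [hj]; exact not_not.2 h
      simp only [if_pos h, surgValue]
      rw [sum_agree_weight_of_not_joined h' hb l₀.1 fun j k =>
        η (splitCoeff (l₀.1 (D.circ s₀ (.inl (x, 0)))) j k), sum_splitCoeff]
      by_cases hx : b (.inl (x, 0)) = b (.inl (x, 2))
      · rw [weight_of_joined h (hb.of_eq hx), mul_assoc]
      · rw [splitValue, if_neg hx, zero_mul, zero_mul, zero_mul]
    · have h' : D.Joined (flip s₀ x) x := hj.2 h
      simp only [if_neg h, surgValue]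
      rw [sum_agree_weight_of_joined h' hb l₀.1 fun k =>
        η (mergeCoeff (l₀.1 (D.circ s₀ (.inl (x, 0)))) (l₀.1 (D.circ s₀ (.inl (x, 2)))) k),
        sum_mergeCoeff, weight_of_not_joined h (hb.of_joined_flip h'), one_mul,
        ← hb _ _ h']
  · refine Finset.sum_eq_zero fun l _ => ?_
    simp only [redSurgMatrix, flip_flip]
    rw [if_neg hs, zero_mul]

omit hD o

theorem redEval_one_of_ne (b : Dart X V → ℤˣ) {s' : X → ℤˣ} (hs : s' ≠ s) :
    redEval η p s' b (redOne D η p s) = 0 := by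
  rw [redEval_apply]
  refine Finset.sum_eq_zero fun l _ => ?_
  simp only [redOne]
  rw [if_neg hs, zero_mul]

theorem redEval_one {b : Dart X V → ℤˣ} {s' : X → ℤˣ} (hb : IsColouring s' D b) (hp : b p = 1) :
    redEval η p s' b (redOne D η p s) = if s' = s then 1 else 0 := by
  split_ifs with hs
  · subst hs
    rw [redEval_apply]
    simp only [redOne, if_true]
    rw [sum_reduced (p := p) (f := fun l : D.Circ s' → ℤˣ =>
      (∏ c, if l c = 1 then 1 else η CoeffA.t) *
        weight (redValue η) b l) fun l hl => by rw [weight_eq_zero η hb hp hl, mul_zero]]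
    simp only [weight, ← Finset.prod_mul_distrib]
    rw [sum_prod_circ fun c k => (if k = 1 then 1 else η CoeffA.t) *
      redValue η (b (Quot.out c)) k]
    refine Finset.prod_eq_one fun c _ => ?_
    rw [Int.sum_units, redValue_one, redValue_neg_one, if_pos rfl, if_neg (by decide)]
    ring
  · exact redEval_one_of_ne η b hs

theorem redEval_single {b : Dart X V → ℤˣ} {s' : X → ℤˣ} (i : D.RedIndex p) :
    redEval η p s' b (Pi.single i 1) = if s' = i.1 then weight (redValue η) b i.2.1 else 0 := by
  obtain ⟨s, l⟩ := i
  rw [redEval_apply]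
  split_ifs with hs
  · change s' = s at hs
    subst hs
    rw [Finset.sum_eq_single l]
    · rw [Pi.single_eq_same, one_mul]
    · intro l' _ hl'
      rw [Pi.single_eq_of_ne (by simpa using hl'), zero_mul]
    · simp
  · refine Finset.sum_eq_zero fun l' _ => ?_
    rw [Pi.single_eq_of_ne fun h => hs (congrArg Sigma.fst h), zero_mul]

section Rep

variable [IsDomain B] (hη : η CoeffA.δ ≠ 0) (D p)

/-- The operator of an edge. -/
def redEdge (d : Dart X V) : Module.End B (D.RedIndex p → B) :=
  Matrix.mulVecLin (redEdgeMatrix D η p d)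

variable {D p}

theorem redEval_redEdge {b : Dart X V → ℤˣ} (hb : IsColouring s D b) (hp : b p = 1)
    (d : Dart X V) (v : D.RedIndex p → B) : redEval η p s b (redEdge D η p d v) =
      colourValue (redKappa η) (b d) * redEval η p s b v := redEval_edge η hb hp d v

variable (D p)

/-- The action of polynomials in the operators of the edges. -/
def redRep : MvPolynomial (Dart X V) B →ₐ[B] Module.End B (D.RedIndex p → B) :=
  Module.End.polyRep (redEdge D η p) fun d d' => by
    ext1 i
    ext1
    refine redEval_ext η hη fun s b hb hp => ?_
    simp only [LinearMap.comp_apply, Module.End.mul_apply, redEval_redEdge η hb hp]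
    ring

variable {D p}

theorem redEval_rep {b : Dart X V → ℤˣ} (hb : IsColouring s D b) (hp : b p = 1)
    (f : MvPolynomial (Dart X V) B) (v : D.RedIndex p → B) :
    redEval η p s b (redRep D η p hη f v) =
      MvPolynomial.eval (fun d => colourValue (redKappa η) (b d)) f * redEval η p s b v := by
  induction f using MvPolynomial.induction_on generalizing v with
  | C a =>
    rw [← MvPolynomial.algebraMap_eq, AlgHom.commutes, Module.algebraMap_end_apply, map_smul,
      MvPolynomial.algebraMap_eq, MvPolynomial.eval_C, smul_eq_mul]
  | add f g hf hg => rw [map_add, LinearMap.add_apply, map_add, hf, hg, map_add, add_mul]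
  | mul_X f d hf =>
    rw [map_mul, Module.End.mul_apply, hf, redRep, Module.End.polyRep_X, redEval_redEdge η hb hp,
      map_mul, MvPolynomial.eval_X, mul_assoc]

end Rep

end LinkDiagram

open MvPolynomial (C)

namespace LinkDiagram

variable {X V F : Type} [Fintype X] [LinearOrder X] [Fintype V] [Fintype F]
variable {D : LinkDiagram X V F} {s : X → ℤˣ} {x : X}
variable {B : Type*} [CommRing B] (η : CoeffA →+* B) (D) (p : Dart X V)

/-- The operator which multiplies the summand of index `s` by `a s`. -/
def redPart : ((X → ℤˣ) → ℤ) →+* Module.End B (D.RedIndex p → B) where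
  toFun a :=
    { toFun := fun v i => a i.1 • v i
      map_add' := fun v w => funext fun i => smul_add (a i.1) (v i) (w i)
      map_smul' := fun c v => funext fun i => smul_comm (a i.1) c (v i) }
  map_one' := by
    ext1 i
    ext1
    funext j
    simp
  map_mul' a a' := by
    refine LinearMap.ext fun v => funext fun i => ?_
    exact mul_smul (a i.1) (a' i.1) (v i)
  map_zero' := LinearMap.ext fun v => funext fun i => zero_smul ℤ (v i)
  map_add' a a' := LinearMap.ext fun v => funext fun i => add_smul (a i.1) (a' i.1) (v i)

variable {D p}

theorem redPart_apply (a : (X → ℤˣ) → ℤ) (v : D.RedIndex p → B) (i : D.RedIndex p) :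
    redPart D p a v i = a i.1 • v i := rfl

theorem redEval_part (a : (X → ℤˣ) → ℤ) (b : Dart X V → ℤˣ) (v : D.RedIndex p → B) :
    redEval η p s b (redPart D p a v) = (a s : B) * redEval η p s b v := by
  rw [redEval_apply, redEval_apply, Finset.mul_sum]
  refine Finset.sum_congr rfl fun l _ => ?_
  rw [redPart_apply, zsmul_eq_mul, mul_assoc]

theorem eval_surgery_polynomial (a a' : ℤˣ) :
    (η (1 - CoeffA.t * CoeffA.δ) +
      -η ((1 - CoeffA.t * CoeffA.δ) * CoeffA.t) * colourValue (redKappa η) a) *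
      (redKappa η + colourValue (redKappa η) a + colourValue (redKappa η) a') =
      splitValue η a a' := by
  have h := map_one_sub_mul_θinv η
  have hn : ¬ ((-1 : ℤˣ) = 1) := by decide
  have hn' : ¬ ((1 : ℤˣ) = -1) := by decide
  rcases Int.units_eq_one_or a with rfl | rfl <;> rcases Int.units_eq_one_or a' with rfl | rfl <;>
    simp only [colourValue, splitValue, redKappa, hn, hn', if_true, if_false, map_mul, map_sub,
      map_one]
  · linear_combination (η CoeffA.δ) * h
  · ring
  · ring
  · linear_combination (-(η CoeffA.t * η CoeffA.δ * (η CoeffA.θinv * η CoeffA.δ))) * h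

namespace Orientation

variable (hD : D.Connected) (o : D.Orientation)
include hD

theorem redPhi_apply (σ : o.Change p) (v : D.RedIndex p → B) : o.redPhi p η v σ =
    ((contractionSign σ : ℤ) : B) * redEval η p (changeState σ) (o.colour σ.1) v := by
  rw [redPhi, Matrix.mulVec, dotProduct, Fintype.sum_sigma, Finset.sum_eq_single (changeState σ)]
  · rw [redEval_apply, Finset.mul_sum]
    refine Finset.sum_congr rfl fun l _ => ?_
    have h : ∀ c, o.redWeight p (circSign σ c) (l.1 c) =
        o.redWeight p (o.baseSign p * o.colour σ.1 (Quot.out c)) (l.1 c) := fun c => by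
      rw [← circSign_eq hD, circ_out]
    rw [Matrix.map_apply, redPhiMatrix, dif_pos rfl, map_mul, map_intCast, map_prod]
    simp only [h, redWeight_eq]
    rw [weight]
    ring
  · intro s _ hs
    refine Finset.sum_eq_zero fun l _ => ?_
    rw [Matrix.map_apply, redPhiMatrix, dif_neg (Ne.symm hs), map_zero, zero_mul]
  · simp

theorem isColouring_colour (σ : o.Change p) : IsColouring (changeState σ) D (o.colour σ.1) :=
  fun _ _ h => colour_eq_of_circ_eq hD σ h

variable [IsDomain B] (hη : η CoeffA.δ ≠ 0) (p)

/-- The complex `B ⊗ KH'(D,p)` as a cube of surgeries. -/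
def redModel : CubeModel o p B (D.RedIndex p → B) where
  part := redPart D p
  rep := redRep D η p hη
  surg x := Matrix.mulVecLin (redSurgMatrix D η p x)
  one := redOne D η p
  proj := Matrix.mulVecLin ((o.redPhiMatrix p).map η)
  κ := redKappa η
  u₀ := η (1 - CoeffA.t * CoeffA.δ)
  u₁ := -η ((1 - CoeffA.t * CoeffA.δ) * CoeffA.t)
  v₀ := η CoeffA.θinv
  v₁ := η CoeffA.t
  sgn := contractionSign
  part_rep a d := by
    refine LinearMap.ext fun v => redEval_ext η hη fun s b hb hp => ?_
    simp only [Module.End.mul_apply, redEval_part, redEval_rep η hη hb hp]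
    ring
  surg_part x a := by
    refine LinearMap.ext fun v => redEval_ext η hη fun s b hb hp => ?_
    obtain ⟨s, rfl⟩ : ∃ s', s = flip s' x := ⟨flip s x, (flip_flip s x).symm⟩
    simp only [Module.End.mul_apply, Matrix.mulVecLin_apply, redEval_part,
      redEval_surg η hD o hb hp, flip_flip]
    ring
  part_one a s := by
    funext i
    rw [redPart_apply, Pi.smul_apply]
    by_cases h : i.1 = s
    · rw [h]
    · rw [redOne, if_neg h, smul_zero, smul_zero]
  surg_rep x d := by
    refine LinearMap.ext fun v => redEval_ext η hη fun s b hb hp => ?_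
    obtain ⟨s, rfl⟩ : ∃ s', s = flip s' x := ⟨flip s x, (flip_flip s x).symm⟩
    simp only [Module.End.mul_apply, Matrix.mulVecLin_apply, redEval_rep η hη hb hp,
      redEval_surg η hD o hb hp]
    by_cases h : D.Joined s x ∧ b (.inl (x, 0)) ≠ b (.inl (x, 2))
    · rw [surgValue, if_pos h.1, splitValue, if_neg h.2]
      ring
    · have hb' : IsColouring s D b := by
        by_cases hj : D.Joined s x
        · exact hb.of_eq (not_not.1 fun h' => h ⟨hj, h'⟩)
        · exact hb.of_joined_flip (((isAlternating_checker hD o).joined_flip s x).2 hj)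
      rw [redEval_rep η hη hb' hp]
      ring
  rep_circ s d d' h := by
    refine redEval_ext η hη fun s' b hb hp => ?_
    rw [redEval_rep η hη hb hp, redEval_rep η hη hb hp, redEval_one η hb hp]
    split_ifs with hs
    · subst hs
      rw [MvPolynomial.eval_X, MvPolynomial.eval_X, hb _ _ h]
    · rw [mul_zero, mul_zero]
  rep_sq d := by
    refine LinearMap.ext fun v => redEval_ext η hη fun s b hb hp => ?_
    simp only [Module.End.mul_apply, LinearMap.neg_apply, LinearMap.smul_apply, map_neg, map_smul,
      redEval_rep η hη hb hp, MvPolynomial.eval_X, smul_eq_mul]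
    linear_combination redEval η p s b v * colourValue_mul (redKappa η) (b d)
  rep_base := by
    refine LinearMap.ext fun v => redEval_ext η hη fun s b hb hp => ?_
    rw [redEval_rep η hη hb hp, MvPolynomial.eval_X, hp, colourValue, if_pos rfl, zero_mul,
      LinearMap.zero_apply, map_zero]
  surg_one_joined s x h := by
    refine redEval_ext η hη fun s' b hb hp => ?_
    obtain ⟨s', rfl⟩ : ∃ s'', s' = flip s'' x := ⟨flip s' x, (flip_flip s' x).symm⟩
    rw [Matrix.mulVecLin_apply, redEval_surg η hD o hb hp, redEval_rep η hη hb hp,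
      redEval_one η hb hp]
    by_cases hs : s' = s
    · subst hs
      simp only [map_add, MvPolynomial.eval_mul, MvPolynomial.eval_X, MvPolynomial.eval_C,
        if_true]
      rw [surgValue, if_pos h, mul_one, eval_surgery_polynomial]
      by_cases hx : b (.inl (x, 0)) = b (.inl (x, 2))
      · rw [redEval_one η (hb.of_eq hx) hp, if_pos rfl, mul_one]
      · rw [splitValue, if_neg hx, zero_mul]
    · have hs' : flip s' x ≠ flip s x := fun h' => hs (by
        rw [← flip_flip s' x, h', flip_flip])
      rw [redEval_one_of_ne η b hs, if_neg hs', mul_zero, mul_zero]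
  surg_one s x h := by
    refine redEval_ext η hη fun s' b hb hp => ?_
    obtain ⟨s', rfl⟩ : ∃ s'', s' = flip s'' x := ⟨flip s' x, (flip_flip s' x).symm⟩
    rw [Matrix.mulVecLin_apply, redEval_surg η hD o hb hp, redEval_one η hb hp]
    by_cases hs : s' = s
    · subst hs
      have hb' := hb.of_joined_flip (((isAlternating_checker hD o).joined_flip s' x).2 h)
      rw [surgValue, if_neg h, redEval_one η hb' hp, if_pos rfl, if_pos rfl, mul_one]
    · have hs' : flip s' x ≠ flip s x := fun h' => hs (by
        rw [← flip_flip s' x, h', flip_flip])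
      rw [redEval_one_of_ne η b hs, if_neg hs', mul_zero]
  span N h1 h2 := by
    have h3 : ∀ (f : MvPolynomial (Dart X V) B), ∀ v ∈ N, redRep D η p hη f v ∈ N := fun f => by
      induction f using MvPolynomial.induction_on with
      | C a =>
        intro v hv
        rw [← MvPolynomial.algebraMap_eq, AlgHom.commutes, Module.algebraMap_end_apply]
        exact N.smul_mem a hv
      | add f g hf hg =>
        intro v hv
        rw [map_add]
        exact N.add_mem (hf v hv) (hg v hv)
      | mul_X f d hf =>
        intro v hv
        rw [map_mul]
        exact hf _ (h2 d v hv)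
    have h4 : ∀ i : D.RedIndex p, Pi.single i (1 : B) ∈ N := fun i => by
      have h5 : Pi.single i (1 : B) = redRep D η p hη (∏ c, if i.2.1 c = 1 then
          1 - C (η CoeffA.t) * .X (Quot.out c) else .X (Quot.out c)) (redOne D η p i.1) := by
        refine redEval_ext η hη fun s b hb hp => ?_
        rw [redEval_rep η hη hb hp, redEval_single, redEval_one η hb hp]
        split_ifs with hs
        · subst hs
          rw [mul_one, map_prod, weight]
          refine Finset.prod_congr rfl fun c _ => ?_
          rcases Int.units_eq_one_or (i.2.1 c) with hc | hc
          · rw [hc, if_pos rfl, redValue_one]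
            simp
          · rw [hc, if_neg (by decide), redValue_neg_one, MvPolynomial.eval_X]
        · rw [mul_zero]
      rw [h5]
      exact h3 _ _ (h1 _)
    rw [eq_top_iff]
    intro v _
    rw [← Finset.univ_sum_single v]
    refine N.sum_mem fun i _ => ?_
    have h6 : Pi.single i (v i) = v i • (Pi.single i 1 : D.RedIndex p → B) := by
      rw [← Pi.single_smul, smul_eq_mul, mul_one]
    rw [h6]
    exact N.smul_mem _ (h4 i)
  unit₀ := by rw [← map_mul, CoeffA.one_sub_mul_θinv, map_one]
  unit₁ := by
    have h := map_one_sub_mul_θinv η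
    simp only [redKappa, map_mul, map_sub, map_one]
    linear_combination (-η CoeffA.t + η CoeffA.t ^ 2 * η CoeffA.δ) * h
  proj_rep d v σ := by
    change o.redPhi p η _ σ = _ * o.redPhi p η v σ
    rw [redPhi_apply η hD, redPhi_apply η hD,
      redEval_rep η hη (isColouring_colour hD o σ) ((colour_base hD).2 σ.2), MvPolynomial.eval_X]
    ring
  proj_one s σ := by
    change o.redPhi p η _ σ = _
    rw [redPhi_apply η hD, redEval_one η (isColouring_colour hD o σ) ((colour_base hD).2 σ.2)]
    split_ifs <;> simp

theorem redModel_edge (e : ℤˣ) (x : X) (v : D.RedIndex p → B) (i : D.RedIndex p) :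
    (redModel η p hD o hη).edge e x v i =
      ∑ j, ((wedgeFun e x i.1 : ℤ) : B) * redSurgMatrix D η p x i j * v j := by
  change wedgeFun e x i.1 • (redSurgMatrix D η p x).mulVec v i = _
  rw [Matrix.mulVec, dotProduct, zsmul_eq_mul, Finset.mul_sum]
  exact Finset.sum_congr rfl fun j _ => (mul_assoc _ _ _).symm

theorem redModel_diff : ⇑(redModel η p hD o hη).diff = o.redD p η := by
  funext v i
  rw [CubeModel.diff, LinearMap.sum_apply, Finset.sum_apply, redD, Matrix.mulVec, dotProduct]
  simp_rw [redModel_edge]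
  rw [Finset.sum_comm]
  refine Finset.sum_congr rfl fun j _ => ?_
  rw [← Finset.sum_mul, Matrix.map_apply, redMatrix, map_sum]
  congr 1
  refine Finset.sum_congr rfl fun x _ => ?_
  rw [redSurgMatrix, wedgeFun]
  by_cases h : j.1 x = 1 ∧ i.1 = Function.update j.1 x (-1)
  · have hi : i.1 = flip j.1 x := by rw [flip, h.1]; exact h.2
    rw [if_pos h, if_pos (by rw [hi, flip_same, h.1]), if_pos (by rw [hi, flip_flip]), map_mul,
      map_intCast]
  · rw [if_neg h, map_zero]
    by_cases h1 : i.1 x = -1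
    · rw [if_neg (c := j.1 = _), mul_zero]
      rintro h2
      have h3 : j.1 x = 1 := by rw [h2, flip_same, h1, neg_neg]
      refine h ⟨h3, ?_⟩
      rw [← flip_eq_iff, flip, h3] at h2
      exact h2.symm
    · rw [if_neg h1]
      simp

end Orientation

end LinkDiagram

/-- The grading `𝓑` of the ring `B` is compatible with the grading of the universal coefficients. -/
structure IsCoeffGrading {B : Type*} [CommRing B] (η : CoeffA →+* B) (𝓑 : ℤ → Set B) : Prop where
  zero_mem : ∀ n, 0 ∈ 𝓑 n
  add_mem : ∀ {n a b}, a ∈ 𝓑 n → b ∈ 𝓑 n → a + b ∈ 𝓑 n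
  neg_mem : ∀ {n a}, a ∈ 𝓑 n → -a ∈ 𝓑 n
  mul_mem : ∀ {m n a b}, a ∈ 𝓑 m → b ∈ 𝓑 n → a * b ∈ 𝓑 (m + n)
  map_mem : ∀ {n a}, a ∈ CoeffA.homogeneous n → η a ∈ 𝓑 n

namespace CoeffA

theorem algebraMap_mem {n : ℤ} {f : PolyTD}
    (h : MvPolynomial.IsWeightedHomogeneous (![2, -2] : Fin 2 → ℤ) f n) :
    algebraMap PolyTD CoeffA f ∈ homogeneous n := ⟨0, f, h, by rw [pow_zero, mul_one]⟩

theorem zero_mem (n : ℤ) : 0 ∈ homogeneous n := by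
  rw [← map_zero (algebraMap PolyTD CoeffA)]
  exact algebraMap_mem (MvPolynomial.isWeightedHomogeneous_zero _ _ _)

theorem one_mem : 1 ∈ homogeneous 0 := by
  rw [← map_one (algebraMap PolyTD CoeffA)]
  exact algebraMap_mem (MvPolynomial.isWeightedHomogeneous_one _ _)

theorem t_mem : t ∈ homogeneous 2 :=
  algebraMap_mem (MvPolynomial.isWeightedHomogeneous_X ℤ (![2, -2] : Fin 2 → ℤ) 0)

theorem δ_mem : δ ∈ homogeneous (-2) :=
  algebraMap_mem (MvPolynomial.isWeightedHomogeneous_X ℤ (![2, -2] : Fin 2 → ℤ) 1)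

theorem θinv_mem : θinv ∈ homogeneous 0 :=
  ⟨1, 1, MvPolynomial.isWeightedHomogeneous_one _ _, by rw [map_one, one_mul, pow_one]⟩

theorem mul_mem {m n : ℤ} {a b : CoeffA} (ha : a ∈ homogeneous m) (hb : b ∈ homogeneous n) :
    a * b ∈ homogeneous (m + n) := by
  obtain ⟨k, f, hf, rfl⟩ := ha
  obtain ⟨l, g, hg, rfl⟩ := hb
  refine ⟨k + l, f * g, hf.mul hg, ?_⟩
  rw [map_mul, pow_add]
  ring

theorem neg_mem {n : ℤ} {a : CoeffA} (ha : a ∈ homogeneous n) : -a ∈ homogeneous n := by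
  obtain ⟨k, f, hf, rfl⟩ := ha
  refine ⟨k, -f, ?_, by rw [map_neg, neg_mul]⟩
  exact (MvPolynomial.weightedHomogeneousSubmodule ℤ (![2, -2] : Fin 2 → ℤ) n).neg_mem hf

theorem isWeightedHomogeneous_polyTheta :
    MvPolynomial.IsWeightedHomogeneous (![2, -2] : Fin 2 → ℤ) polyTheta 0 := by
  refine (MvPolynomial.weightedHomogeneousSubmodule ℤ (![2, -2] : Fin 2 → ℤ) 0).sub_mem
    (MvPolynomial.isWeightedHomogeneous_one _ _) ?_
  exact (MvPolynomial.isWeightedHomogeneous_X ℤ (![2, -2] : Fin 2 → ℤ) 0).mul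
    (MvPolynomial.isWeightedHomogeneous_X ℤ (![2, -2] : Fin 2 → ℤ) 1)

theorem algebraMap_polyTheta_mul_θinv : algebraMap PolyTD CoeffA polyTheta * θinv = 1 :=
  IsLocalization.Away.mul_invSelf _

theorem add_mem {n : ℤ} {a b : CoeffA} (ha : a ∈ homogeneous n) (hb : b ∈ homogeneous n) :
    a + b ∈ homogeneous n := by
  obtain ⟨k, f, hf, rfl⟩ := ha
  obtain ⟨l, g, hg, rfl⟩ := hb
  have h : ∀ m : ℕ, MvPolynomial.IsWeightedHomogeneous (![2, -2] : Fin 2 → ℤ) (polyTheta ^ m) 0 :=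
    fun m => by simpa using isWeightedHomogeneous_polyTheta.pow m
  have hθ : ∀ m : ℕ, algebraMap PolyTD CoeffA polyTheta ^ m * θinv ^ m = 1 := fun m => by
    rw [← mul_pow, algebraMap_polyTheta_mul_θinv, one_pow]
  refine ⟨k + l, f * polyTheta ^ l + g * polyTheta ^ k, ?_, ?_⟩
  · have h1 := hf.mul (h l)
    have h2 := hg.mul (h k)
    rw [add_zero] at h1 h2
    exact h1.add h2
  · rw [map_add, map_mul, map_mul, map_pow, map_pow, pow_add]
    linear_combination (-(algebraMap PolyTD CoeffA f * θinv ^ k)) * hθ l -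
      algebraMap PolyTD CoeffA g * θinv ^ l * hθ k

theorem isCoeffGrading_id : IsCoeffGrading (RingHom.id CoeffA) homogeneous where
  zero_mem := zero_mem
  add_mem := add_mem
  neg_mem := neg_mem
  mul_mem := mul_mem
  map_mem := id

theorem polyTheta_ne_zero : polyTheta ≠ 0 := fun h => by
  have := congrArg (MvPolynomial.eval fun _ => (0 : ℤ)) h
  simp [polyTheta] at this

instance : IsDomain CoeffA :=
  IsLocalization.isDomain_localization 
    (powers_le_nonZeroDivisors_of_noZeroDivisors polyTheta_ne_zero)

theorem toPoly_algebraMap (f : PolyTD) : toPoly (algebraMap PolyTD CoeffA f) =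
    MvPolynomial.aeval ![0, Polynomial.X] f :=
  IsLocalization.Away.lift_eq _ _ _

theorem toPoly_δ : toPoly δ = Polynomial.X := by
  rw [δ, toPoly_algebraMap, MvPolynomial.aeval_X]
  rfl

theorem δ_ne_zero : δ ≠ 0 := fun h => by
  have := toPoly_δ
  rw [h, map_zero] at this
  exact Polynomial.X_ne_zero this.symm

theorem toPoly_θinv : toPoly θinv = 1 := by
  have h := congrArg toPoly algebraMap_polyTheta_mul_θinv
  rw [map_mul, toPoly_algebraMap, map_one] at h
  simpa [polyTheta] using h

end CoeffA

theorem mem_polyHomogeneous {n : ℤ} {f : Polynomial ℤ} :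
    f ∈ polyHomogeneous n ↔ ∀ k, f.coeff k ≠ 0 → -2 * (k : ℤ) = n := by
  simp only [polyHomogeneous, Set.mem_ofPred_eq, Polynomial.mem_support_iff]

theorem polyHomogeneous_add_mem {n : ℤ} {f g : Polynomial ℤ} (hf : f ∈ polyHomogeneous n)
    (hg : g ∈ polyHomogeneous n) : f + g ∈ polyHomogeneous n := by
  rw [mem_polyHomogeneous] at *
  intro k hk
  by_cases h : f.coeff k = 0
  · refine hg k fun h' => hk ?_
    rw [Polynomial.coeff_add, h, h', add_zero]
  · exact hf k h

theorem toPoly_mem_polyHomogeneous {n : ℤ} {a : CoeffA} (ha : a ∈ CoeffA.homogeneous n) :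
    CoeffA.toPoly a ∈ polyHomogeneous n := by
  obtain ⟨k, f, hf, rfl⟩ := ha
  rw [map_mul, map_pow, CoeffA.toPoly_θinv, one_pow, mul_one, CoeffA.toPoly_algebraMap, f.as_sum,
    map_sum]
  refine Finset.sum_induction _ (· ∈ polyHomogeneous n) (fun _ _ => polyHomogeneous_add_mem)
    (fun k hk => by simp at hk) fun d hd => ?_
  have hd' := hf (MvPolynomial.mem_support_iff.1 hd)
  rw [MvPolynomial.aeval_monomial, Finsupp.prod_fintype _ _ (fun _ => pow_zero _),
    Fin.prod_univ_two, mem_polyHomogeneous]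
  intro m hm
  rw [Finsupp.weight_apply, Finsupp.sum_fintype _ _ (fun i => zero_smul ℕ ((![2, -2] : Fin 2 → ℤ) i)),
    Fin.sum_univ_two] at hd'
  simp only [Matrix.cons_val_zero, Matrix.cons_val_one, nsmul_eq_mul] at hd' hm
  by_cases h0 : d 0 = 0
  · rw [h0, pow_zero, one_mul, eq_intCast, ← Polynomial.C_eq_intCast,
      Polynomial.coeff_C_mul, Polynomial.coeff_X_pow] at hm
    have : m = d 1 := by
      by_contra h
      rw [if_neg h, mul_zero] at hm
      exact hm rfl
    rw [this, ← hd', h0]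
    push_cast
    ring
  · rw [zero_pow h0, zero_mul, mul_zero, Polynomial.coeff_zero] at hm
    exact absurd rfl hm

theorem isCoeffGrading_toPoly : IsCoeffGrading CoeffA.toPoly polyHomogeneous where
  zero_mem n k hk := by simp at hk
  add_mem := polyHomogeneous_add_mem
  neg_mem {n a} h := by
    rw [mem_polyHomogeneous] at *
    intro k hk
    exact h k fun h' => hk (by rw [Polynomial.coeff_neg, h', neg_zero])
  mul_mem {m n a b} ha hb := by
    rw [mem_polyHomogeneous] at *
    intro k hk
    rw [Polynomial.coeff_mul] at hk
    obtain ⟨ij, hij, h⟩ := Finset.exists_ne_zero_of_sum_ne_zero hk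
    rw [← ha _ (left_ne_zero_of_mul h), ← hb _ (right_ne_zero_of_mul h),
      ← Finset.HasAntidiagonal.mem_antidiagonal.1 hij]
    push_cast
    ring
  map_mem := toPoly_mem_polyHomogeneous

open MvPolynomial (C)

namespace IsCoeffGrading

variable {B ι : Type*} [CommRing B] {η : CoeffA →+* B} {𝓑 : ℤ → Set B}
variable (h : IsCoeffGrading η 𝓑)
include h

theorem sum_mem {κ : Type*} {n : ℤ} {s : Finset κ} {f : κ → B} (hf : ∀ i ∈ s, f i ∈ 𝓑 n) :
    ∑ i ∈ s, f i ∈ 𝓑 n :=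
  Finset.sum_induction _ (· ∈ 𝓑 n) (fun _ _ => h.add_mem) (h.zero_mem n) hf

theorem intCast_mem (a : ℤ) : (a : B) ∈ 𝓑 0 := by
  have h1 : (1 : B) ∈ 𝓑 0 := by
    rw [← map_one η]
    exact h.map_mem CoeffA.one_mem
  induction a with
  | zero => rw [Int.cast_zero]; exact h.zero_mem 0
  | succ a ha => rw [Int.cast_add, Int.cast_one]; exact h.add_mem ha h1
  | pred a ha =>
    rw [Int.cast_sub, Int.cast_one, sub_eq_add_neg]
    exact h.add_mem ha (h.neg_mem h1)

theorem prod_mem {κ : Type*} {s : Finset κ} {f : κ → B} {m : κ → ℤ} (hf : ∀ i ∈ s, f i ∈ 𝓑 (m i)) :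
    ∏ i ∈ s, f i ∈ 𝓑 (∑ i ∈ s, m i) := by
  induction s using Finset.induction_on with
  | empty =>
    rw [Finset.prod_empty, Finset.sum_empty, ← Int.cast_one]
    exact h.intCast_mem 1
  | insert a s ha ih =>
    rw [Finset.prod_insert ha, Finset.sum_insert ha]
    exact h.mul_mem (hf a (Finset.mem_insert_self a s))
      (ih fun i hi => hf i (Finset.mem_insert_of_mem hi))

/-- The grading of a free module by additive subgroups. -/
def grading (deg : ι → ℤ × ℤ) (n : ℤ × ℤ) : AddSubgroup (ι → B) where
  carrier := freeHomogeneous 𝓑 deg n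
  zero_mem' i hi := absurd rfl hi
  add_mem' {v w} hv hw i hi := by
    by_cases h1 : v i = 0
    · rw [Pi.add_apply, h1, zero_add] at hi ⊢
      exact hw i hi
    · refine ⟨(hv i h1).1, ?_⟩
      by_cases h2 : w i = 0
      · rw [Pi.add_apply, h2, add_zero]
        exact (hv i h1).2
      · exact h.add_mem (hv i h1).2 (hw i h2).2
  neg_mem' {v} hv i hi := by
    have h1 := hv i fun h' => hi (by rw [Pi.neg_apply, h', neg_zero])
    exact ⟨h1.1, h.neg_mem h1.2⟩

theorem isHomogeneousEnd_of_entries [Fintype ι] {deg : ι → ℤ × ℤ} {g : ℤ × ℤ}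
    {T : Module.End B (ι → B)} (K : ι → ι → B) (hT : ∀ v i, T v i = ∑ j, K i j * v j)
    (hK : ∀ i j, K i j ≠ 0 → (deg i).1 = (deg j).1 + g.1 ∧
      K i j ∈ 𝓑 (g.2 + (deg j).2 - (deg i).2)) : IsHomogeneousEnd (h.grading deg) g T := by
  intro n v hv i hi
  rw [hT] at hi ⊢
  obtain ⟨j, -, hj⟩ := Finset.exists_ne_zero_of_sum_ne_zero hi
  have h1 := hK i j (left_ne_zero_of_mul hj)
  have h2 := hv j (right_ne_zero_of_mul hj)
  refine ⟨by rw [h1.1, h2.1]; rfl, h.sum_mem fun j _ => ?_⟩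
  by_cases hj : K i j * v j = 0
  · rw [hj]
    exact h.zero_mem _
  · have h3 := h.mul_mem (hK i j (left_ne_zero_of_mul hj)).2 (hv j (right_ne_zero_of_mul hj)).2
    rwa [show g.2 + (deg j).2 - (deg i).2 + (n.2 - (deg j).2) = (n + g).2 - (deg i).2 by
      rw [Prod.snd_add]; ring] at h3

theorem isHomogeneousEnd_smul (deg : ι → ℤ × ℤ) {m : ℤ} {c : B} (hc : c ∈ 𝓑 m) :
    IsHomogeneousEnd (h.grading deg) (0, m) (c • (1 : Module.End B (ι → B))) := by
  intro n v hv i hi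
  change c * v i ≠ 0 at hi
  have h1 := hv i (right_ne_zero_of_mul hi)
  refine ⟨by rw [h1.1, Prod.fst_add, add_zero], ?_⟩
  have h2 := h.mul_mem hc h1.2
  rwa [show m + (n.2 - (deg i).2) = (n + (0, m)).2 - (deg i).2 by rw [Prod.snd_add]; ring] at h2

end IsCoeffGrading

namespace LinkDiagram

variable {X V F : Type} [Fintype X] [LinearOrder X] [Fintype V] [Fintype F]
variable {D : LinkDiagram X V F} {s : X → ℤˣ} {x : X}

theorem mergeCoeff_mem (i j k : ℤˣ) :
    mergeCoeff i j k ∈ CoeffA.homogeneous (-1 + i + j - k) := by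
  have h1 := CoeffA.neg_mem (CoeffA.mul_mem CoeffA.θinv_mem CoeffA.t_mem)
  have h2 := CoeffA.neg_mem (CoeffA.mul_mem CoeffA.θinv_mem CoeffA.δ_mem)
  have hn : ¬ ((-1 : ℤˣ) = 1) := by decide
  have hn' : ¬ ((1 : ℤˣ) = -1) := by decide
  rcases Int.units_eq_one_or i with rfl | rfl <;> rcases Int.units_eq_one_or j with rfl | rfl <;>
    rcases Int.units_eq_one_or k with rfl | rfl <;>
    simp only [mergeCoeff, hn, hn', if_true, if_false, and_self, and_false, false_and]
  · exact CoeffA.one_mem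
  · exact h1
  · exact CoeffA.zero_mem _
  · exact CoeffA.θinv_mem
  · exact CoeffA.zero_mem _
  · exact CoeffA.θinv_mem
  · exact CoeffA.zero_mem _
  · exact h2

theorem splitCoeff_mem (i j k : ℤˣ) :
    splitCoeff i j k ∈ CoeffA.homogeneous (-1 + i - j - k) := by
  have hn : ¬ ((-1 : ℤˣ) = 1) := by decide
  have hn' : ¬ ((1 : ℤˣ) = -1) := by decide
  rcases Int.units_eq_one_or i with rfl | rfl <;> rcases Int.units_eq_one_or j with rfl | rfl <;>
    rcases Int.units_eq_one_or k with rfl | rfl <;>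
    simp only [splitCoeff, hn, hn', if_true, if_false, and_self, and_false, false_and]
  · exact CoeffA.δ_mem
  · exact CoeffA.one_mem
  · exact CoeffA.one_mem
  · exact CoeffA.zero_mem _
  · exact CoeffA.zero_mem _
  · exact CoeffA.zero_mem _
  · exact CoeffA.zero_mem _
  · exact CoeffA.one_mem

theorem redSurgery_mem (hD : D.Connected) (o : D.Orientation) {l : D.Circ s → ℤˣ}
    {l' : D.Circ (flip s x) → ℤˣ} : redSurgery x s (flip s x) l l' ∈
      CoeffA.homogeneous (-1 + ∑ c, (l c : ℤ) - ∑ c, (l' c : ℤ)) := by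
  rw [redSurgery_eq]
  split_ifs with h hj
  · have hj' : ¬ D.Joined (flip s x) x := by
      rw [(isAlternating_checker hD o).joined_flip]
      exact not_not.2 hj
    rw [sum_circ_of_joined hj, sum_circ_of_not_joined hj', sum_remote_flip
      (g' := fun c => (l' c : ℤ)) fun d hd => by rw [h d hd]]
    convert splitCoeff_mem _ _ _ using 2
    ring
  · have hj' := ((isAlternating_checker hD o).joined_flip s x).2 hj
    rw [sum_circ_of_not_joined hj, sum_circ_of_joined hj', sum_remote_flip
      (g' := fun c => (l' c : ℤ)) fun d hd => by rw [h d hd]]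
    convert mergeCoeff_mem _ _ _ using 2
    ring
  · exact CoeffA.zero_mem _

namespace Orientation

variable {B : Type*} [CommRing B] {η : CoeffA →+* B} {𝓑 : ℤ → Set B} (h𝓑 : IsCoeffGrading η 𝓑)
variable (p : Dart X V) (o : D.Orientation)
include h𝓑

theorem redValue_mem (a l : ℤˣ) : redValue η a l ∈ 𝓑 (l - 1) := by
  have h1 : (1 : B) ∈ 𝓑 0 := by simpa using h𝓑.intCast_mem 1
  have h2 := h𝓑.neg_mem (h𝓑.map_mem (CoeffA.mul_mem CoeffA.θinv_mem CoeffA.δ_mem))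
  have hn : ¬ ((-1 : ℤˣ) = 1) := by decide
  rcases Int.units_eq_one_or a with rfl | rfl <;> rcases Int.units_eq_one_or l with rfl | rfl <;>
    simp only [redValue, redKappa, hn, if_true, if_false]
  · exact h1
  · exact h𝓑.zero_mem _
  · exact h𝓑.map_mem CoeffA.θinv_mem
  · exact h2

theorem redPhi_mem (hD : D.Connected) {n : ℤ × ℤ} {v : D.RedIndex p → B}
    (hv : v ∈ o.redHomogeneous p 𝓑 n) : o.redPhi p η v ∈ o.eBihomogeneous p 𝓑 n := by
  intro σ hσ
  rw [redPhi_apply η hD, redEval_apply] at hσ ⊢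
  obtain ⟨l, -, hl⟩ := Finset.exists_ne_zero_of_sum_ne_zero (right_ne_zero_of_mul hσ)
  refine ⟨(changeDegree_eq σ).trans (hv _ (left_ne_zero_of_mul hl)).1, ?_⟩
  rw [← zero_add (n.2 - _)]
  refine h𝓑.mul_mem (h𝓑.intCast_mem _) (h𝓑.sum_mem fun l _ => ?_)
  by_cases h0 : v ⟨changeState σ, l⟩ = 0
  · rw [h0, zero_mul]
    exact h𝓑.zero_mem _
  · have h1 := h𝓑.mul_mem (hv _ h0).2 (h𝓑.prod_mem
      (s := (Finset.univ : Finset (D.Circ (changeState σ))))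
      fun c _ => redValue_mem h𝓑 (o.colour σ.1 (Quot.out c)) (l.1 c))
    have h2 : n.2 - (o.redDegree p ⟨changeState σ, l⟩).2 +
        ∑ c : D.Circ (changeState σ), ((l.1 c : ℤ) - 1) = n.2 - (o.changeBidegree p σ).2 := by
      simp only [changeBidegree, redDegree, Finset.sum_sub_distrib, Nat.card_eq_fintype_card,
        Finset.sum_const, Finset.card_univ, nsmul_eq_mul, mul_one]
      ring
    rwa [h2] at h1

variable [IsDomain B] (hD : D.Connected) (hη : η CoeffA.δ ≠ 0)
include hD

theorem redModel_isHomogeneousEnd_edge (e : ℤˣ) (x : X) :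
    IsHomogeneousEnd (h𝓑.grading (o.redDegree p)) ((e : ℤ), -1)
      ((redModel η p hD o hη).edge e x) := by
  refine h𝓑.isHomogeneousEnd_of_entries _ (redModel_edge η p hD o hη e x) fun i j hij => ?_
  have h1 : wedgeFun e x i.1 ≠ 0 := fun h => hij (by rw [h, Int.cast_zero, zero_mul])
  have h2 : j.1 = flip i.1 x := by
    by_contra h
    rw [redSurgMatrix, if_neg h, mul_zero] at hij
    exact hij rfl
  have h3 := o.stateDegree_flip_of_wedgeFun_ne h1
  obtain ⟨s, l⟩ := j
  obtain ⟨s', l'⟩ := i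
  obtain rfl : flip s x = s' := flip_eq_iff.2 h2
  refine ⟨by rwa [flip_flip] at h3, ?_⟩
  simp only [redSurgMatrix, flip_flip, if_true]
  rw [← zero_add (_ - _)]
  exact h𝓑.mul_mem (h𝓑.intCast_mem _) (h𝓑.map_mem (redSurgery_mem hD o))

theorem redModel_isHomogeneousEnd_rep_X (d : Dart X V) :
    IsHomogeneousEnd (h𝓑.grading (o.redDegree p)) (0, -2)
      ((redModel η p hD o hη).rep (.X d)) := by
  refine h𝓑.isHomogeneousEnd_of_entries (redEdgeMatrix D η p d) (fun v i => ?_) fun i j hij => ?_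
  · change redRep D η p hη (.X d) v i = _
    rw [redRep, Module.End.polyRep_X]
    rfl
  obtain ⟨s, l⟩ := j
  obtain ⟨s', l'⟩ := i
  have h1 : s = s' ∧ ∀ d', D.circ s' d' ≠ D.circ s' d →
      l.1 (D.circ s d') = l'.1 (D.circ s' d') := by
    by_contra h
    rw [redEdgeMatrix, if_neg h] at hij
    exact hij rfl
  obtain ⟨rfl, h2⟩ := h1
  refine ⟨(add_zero _).symm, ?_⟩
  rw [redEdgeMatrix, if_pos ⟨rfl, h2⟩]
  refine h𝓑.map_mem ?_
  convert mergeCoeff_mem _ _ _ using 2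
  have h3 : ∑ c ∈ Finset.univ.erase (D.circ s d), (l.1 c : ℤ) =
      ∑ c ∈ Finset.univ.erase (D.circ s d), (l'.1 c : ℤ) := Finset.sum_congr rfl fun c hc => by
    have := h2 (Quot.out c) (by rw [circ_out]; exact Finset.ne_of_mem_erase hc)
    rw [circ_out] at this
    rw [this]
  simp only [redDegree]
  rw [← Finset.add_sum_erase _ (fun c => (l.1 c : ℤ)) (Finset.mem_univ (D.circ s d)),
    ← Finset.add_sum_erase _ (fun c => (l'.1 c : ℤ)) (Finset.mem_univ (D.circ s d)), h3]
  push_cast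
  ring

theorem redModel_isGraded :
    (redModel η p hD o hη).IsGraded (h𝓑.grading (o.redDegree p)) (-1, -1) (0, -2) where
  edge_neg x := o.redModel_isHomogeneousEnd_edge h𝓑 p hD hη (-1) x
  edge_one x := o.redModel_isHomogeneousEnd_edge h𝓑 p hD hη 1 x
  rep_X d := o.redModel_isHomogeneousEnd_rep_X h𝓑 p hD hη d
  kappa := h𝓑.isHomogeneousEnd_smul _
    (h𝓑.map_mem (CoeffA.mul_mem CoeffA.θinv_mem CoeffA.δ_mem))
  unit d := by
    rw [map_add, map_mul, (redModel η p hD o hη).rep_C, (redModel η p hD o hη).rep_C]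
    exact (h𝓑.isHomogeneousEnd_smul _ (h𝓑.map_mem CoeffA.θinv_mem)).add
      ((h𝓑.isHomogeneousEnd_smul _ (h𝓑.map_mem CoeffA.t_mem)).mul
        (o.redModel_isHomogeneousEnd_rep_X h𝓑 p hD hη d))

theorem red_main (hη : η CoeffA.δ ≠ 0) :
    IsDifferential B (o.redHomogeneous p 𝓑) (-1, -1) (o.redD p η) ∧
      ∃ h : IsMorphismToZeroComplex B (o.redHomogeneous p 𝓑) (o.eBihomogeneous p 𝓑) (o.redD p η)
          (o.redPhi p η),
        Function.Surjective (o.redPhi p η) ∧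
        HomotopicallyNilpotentOn (o.redHomogeneous p 𝓑) (-1, -1) (o.redD p η) h.ker
          (η CoeffA.δ) (0, -2) := by
  rw [← o.redModel_diff η p hD hη]
  refine CubeModel.IsGraded.main hD (o.redModel_isGraded h𝓑 p hD hη) (𝓔 := o.eBihomogeneous p 𝓑)
    (fun n v hv => o.redPhi_mem h𝓑 p hD hv) (ν := η (1 - CoeffA.t * CoeffA.δ)) ?_ ?_
  · change _ = _ * redKappa η
    have h := map_one_sub_mul_θinv η
    rw [redKappa, map_mul, map_sub, map_one, map_mul]
    linear_combination (-η CoeffA.δ) * h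
  · refine h𝓑.isHomogeneousEnd_smul _ (h𝓑.map_mem ?_)
    rw [sub_eq_add_neg]
    exact CoeffA.add_mem CoeffA.one_mem
      (CoeffA.neg_mem (CoeffA.mul_mem CoeffA.t_mem CoeffA.δ_mem))

end Orientation

end LinkDiagram

end

theorem mainTheorem6 {X V F : Type} [Fintype X] [LinearOrder X] [Fintype V] [Fintype F]
    (D : LinkDiagram X V F) (o : D.Orientation) (p : Dart X V) (hD : D.Connected) :
    (∀ (K R : Type*) [CommRing K] [CommRing R] [Algebra K R] [Coalgebra K R]
      [FrobeniusAlgebra K R] (g : RankTwoGenerator K R),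
      IsDifferential R (o.khHomogeneous p g) (-1) (o.khD p g) ∧
      ∃ h : IsMorphismToZeroComplex R (o.khHomogeneous p g) (o.eHomogeneous p R) (o.khD p g)
          (o.khPhi p g),
        Function.Surjective (o.khPhi p g) ∧
        HomotopicallyNilpotentOn (o.khHomogeneous p g) (-1) (o.khD p g) h.ker g.beta 0) ∧
    (IsDifferential CoeffA (o.redHomogeneous p CoeffA.homogeneous) (-1, -1)
        (o.redD p (RingHom.id CoeffA)) ∧
      ∃ h : IsMorphismToZeroComplex CoeffA (o.redHomogeneous p CoeffA.homogeneous)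
          (o.eBihomogeneous p CoeffA.homogeneous) (o.redD p (RingHom.id CoeffA))
          (o.redPhi p (RingHom.id CoeffA)),
        Function.Surjective (o.redPhi p (RingHom.id CoeffA)) ∧
        HomotopicallyNilpotentOn (o.redHomogeneous p CoeffA.homogeneous) (-1, -1)
          (o.redD p (RingHom.id CoeffA)) h.ker CoeffA.δ (0, -2)) ∧
    (IsDifferential (Polynomial ℤ) (o.redHomogeneous p polyHomogeneous) (-1, -1)
        (o.redD p CoeffA.toPoly) ∧
      ∃ h : IsMorphismToZeroComplex (Polynomial ℤ) (o.redHomogeneous p polyHomogeneous)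
          (o.eBihomogeneous p polyHomogeneous) (o.redD p CoeffA.toPoly)
          (o.redPhi p CoeffA.toPoly),
        Function.Surjective (o.redPhi p CoeffA.toPoly) ∧
        HomotopicallyNilpotentOn (o.redHomogeneous p polyHomogeneous) (-1, -1)
          (o.redD p CoeffA.toPoly) h.ker Polynomial.X (0, -2)) := by
  refine ⟨fun K R _ _ _ _ _ g => o.kh_main p g hD, ?_, ?_⟩
  · exact o.red_main CoeffA.isCoeffGrading_id p hD CoeffA.δ_ne_zero
  · rw [← CoeffA.toPoly_δ]
    exact o.red_main isCoeffGrading_toPoly p hD (by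
      rw [CoeffA.toPoly_δ]
      exact Polynomial.X_ne_zero)
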